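/- Let $l\ge 1$ be an integer. Imaginary quadratic fields $K$ are regarded as subfields of $\mathbb{C}$ (so isomorphic fields are identified); $\mathcal{O}_K$ is the ring of integers and $e_K$ is the exponent of the class group of $\mathcal{O}_K$. A Hecke character $\psi$ of $K$ with $\infty$-type $l$ is a homomorphism, for some nonzero ideal $\mathfrak{m}$ of $\mathcal{O}_K$, from the group of fractional ideals of $K$ prime to $\mathfrak{m}$ to $\mathbb{C}^*$ such that $\psi(\alpha\mathcal{O}_K)=\alpha^l$ for all $\alpha\in K^*$ with $\alpha\equiv 1$ mod$^*$ $\mathfrak{m}$ (multiplicative congruence); it is extended by $0$ to the ideals not prime to $\mathfrak{m}$. It has rational coefficients if $\sum_{N(\mathfrak{a})=n}\psi(\mathfrak{a})\in\mathbb{Q}$ for all $n\ge 1$, where the sum is over the integral ideals of norm $n$; these are the Fourier coefficients of $f_\psi=\sum_{\mathfrak a}\psi(\mathfrak{a})q^{N(\mathfrak{a})}$. Two Hecke characters $\psi,\psi'$ of the same field $K$ with $\infty$-type $l$ are equal up to twisting if there are a Dirichlet character $\phi$ and a ray class character $\omega$ of $K$ such that $\psi'(\mathfrak{a})=\psi(\mathfrak{a})\,\phi(N(\mathfrak{a}))\,\omega(\mathfrak{a})$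 for all integral ideals $\mathfrak{a}$ prime to some nonzero ideal of $\mathcal{O}_K$, where $\omega^4=1$ if $K=\mathbb{Q}(\sqrt{-1})$, $\omega^6=1$ if $K=\mathbb{Q}(\sqrt{-3})$, and $\omega=1$ otherwise. Hecke characters of different fields are never equal up to twisting. Theorem. The map which sends a Hecke character to its field $K$ induces a well-defined bijection $$\left\{\begin{matrix}\text{Hecke characters of imaginary quadratic fields}\\ \text{with }\infty\text{-type } l \text{ and rational coefficients}\\ \text{up to twisting}\end{matrix}\right\}\longrightarrow\left\{\begin{matrix}\text{imaginary quadratic fields } K\\ \text{with } e_K\mid l\end{matrix}\right\}.$$ In particular, $e_K\mid l$ whenever $K$ has a Hecke character with $\infty$-type $l$ and rational coefficients. -/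

import Mathlib

open NumberField
open scoped nonZeroDivisors

/-- An imaginary quadratic field, realised as a subfield of `ℂ`.  Every imaginary quadratic field is
isomorphic to exactly one such subfield (its two complex embeddings have the same image). -/
@[ext]
structure ImagQuadField where
  toSubfield : IntermediateField ℚ ℂ
  finrank_eq_two : Module.finrank ℚ toSubfield = 2
  not_real : ∃ x ∈ toSubfield, x.im ≠ 0

namespace ImagQuadField

instance : CoeSort ImagQuadField Type := ⟨fun K => K.toSubfield⟩

instance instNumberField (K : ImagQuadField) : NumberField K where
  to_charZero := inferInstance
  to_finiteDimensional := Module.finite_of_finrank_eq_succ K.finrank_eq_two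

/-- The exponent `e_K` of the class group of the ring of integers of `K`. -/
noncomputable def classExponent (K : ImagQuadField) : ℕ :=
  Monoid.exponent (ClassGroup (𝓞 K))

end ImagQuadField

section Ideals

variable (K : Type*) [Field K] [NumberField K]

/-- The group of fractional ideals of `K` which are prime to `m`, i.e. the quotients of nonzero
integral ideals which are coprime to `m`. -/
noncomputable def idealsPrimeTo (m : Ideal (𝓞 K)) : Subgroup (FractionalIdeal (𝓞 K)⁰ K)ˣ where
  carrier := {I | ∃ a b : (Ideal (𝓞 K))⁰, IsCoprime (a : Ideal (𝓞 K)) m ∧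
    IsCoprime (b : Ideal (𝓞 K)) m ∧ I = FractionalIdeal.mk0 K a / FractionalIdeal.mk0 K b}
  one_mem' := ⟨1, 1, isCoprime_one_left, isCoprime_one_left, by simp⟩
  mul_mem' := by
    rintro _ _ ⟨a, b, ha, hb, rfl⟩ ⟨a', b', ha', hb', rfl⟩
    exact ⟨a * a', b * b', ha.mul_left ha', hb.mul_left hb', by
      rw [map_mul, map_mul, div_mul_div_comm]⟩
  inv_mem' := by
    rintro _ ⟨a, b, ha, hb, rfl⟩
    exact ⟨b, a, hb, ha, by rw [inv_div]⟩

variable {K}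

theorem mk0_mem_idealsPrimeTo {m : Ideal (𝓞 K)} (a : (Ideal (𝓞 K))⁰)
    (ha : IsCoprime (a : Ideal (𝓞 K)) m) : FractionalIdeal.mk0 K a ∈ idealsPrimeTo K m :=
  ⟨a, 1, ha, isCoprime_one_left, by simp⟩

theorem idealsPrimeTo_mul_le_left (m m' : Ideal (𝓞 K)) :
    idealsPrimeTo K (m * m') ≤ idealsPrimeTo K m := by
  rintro _ ⟨a, b, ha, hb, rfl⟩
  exact ⟨a, b, ha.of_mul_right_left, hb.of_mul_right_left, rfl⟩

theorem idealsPrimeTo_mul_le_right (m m' : Ideal (𝓞 K)) :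
    idealsPrimeTo K (m * m') ≤ idealsPrimeTo K m' := by
  rintro _ ⟨a, b, ha, hb, rfl⟩
  exact ⟨a, b, ha.of_mul_right_right, hb.of_mul_right_right, rfl⟩

/-- Multiplicative congruence `α ≡ 1 mod* m`: `α = b / c` with `b, c` integral, `c ≠ 0` prime to `m`
and `b ≡ c mod m` (so that `b` is prime to `m`, too). -/
def MulCongrOne (m : Ideal (𝓞 K)) (α : Kˣ) : Prop :=
  ∃ b c : 𝓞 K, c ≠ 0 ∧ IsCoprime (Ideal.span {c}) m ∧ b - c ∈ m ∧
    (α : K) * algebraMap (𝓞 K) K c = algebraMap (𝓞 K) K b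

/-- The norm of an ideal prime to `N` is prime to `N`. -/
theorem isUnit_absNorm {a : Ideal (𝓞 K)} {N : ℕ}
    (h : IsCoprime a (Ideal.span {(N : 𝓞 K)})) : IsUnit (Ideal.absNorm a : ZMod N) := by
  rw [ZMod.isUnit_iff_coprime]
  by_contra hc
  obtain ⟨p, hp, hpa, hpN⟩ := Nat.Prime.not_coprime_iff_dvd.mp hc
  have : Fact p.Prime := ⟨hp⟩
  obtain ⟨P, hP, hPp, hPa⟩ : ∃ P : Ideal (𝓞 K), P.IsPrime ∧ (p : 𝓞 K) ∈ P ∧ a ≤ P := by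
    by_contra! hno
    have hcop : IsCoprime a (Ideal.span {(p : 𝓞 K)}) := by
      rw [Ideal.isCoprime_iff_sup_eq]
      by_contra htop
      obtain ⟨M, hM, hle⟩ := Ideal.exists_le_maximal _ htop
      exact hno M hM.isPrime
        ((le_sup_right.trans hle) (Ideal.mem_span_singleton_self _)) (le_sup_left.trans hle)
    rw [Ideal.isCoprime_iff_add, Ideal.one_eq_top, Ideal.add_eq_sup, ← Ideal.one_eq_top] at hcop
    -- multiplication by `p` is then bijective on the quotient, whose order `p` divides
    have hfin : Nat.card (𝓞 K ⧸ a) ≠ 0 := by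
      intro h0
      have ha : a = ⊥ := by
        rw [← Ideal.absNorm_eq_zero_iff]; exact h0
      subst ha
      have h1 : Ideal.span {(p : 𝓞 K)} = ⊤ := by simpa using hcop
      have h2 : Ideal.absNorm (Ideal.span {(p : 𝓞 K)}) = 1 := by rw [h1]; simp
      have h3 : (Ideal.span {(p : 𝓞 K)}).absNorm = p ^ Module.finrank ℚ K := by
        rw [Ideal.absNorm_span_natCast, RingOfIntegers.rank]
      have h4 := Nat.one_lt_pow (Module.finrank_pos (R := ℚ) (M := K)).ne' hp.one_lt
      omega
    have : Finite (𝓞 K ⧸ a) := Nat.finite_of_card_ne_zero hfin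
    obtain ⟨x, hx⟩ := exists_prime_addOrderOf_dvd_card' (G := 𝓞 K ⧸ a) p hpa
    obtain ⟨y, rfl⟩ := Ideal.Quotient.mk_surjective x
    have hpy : (p : 𝓞 K) * y ∈ a := by
      rw [← Ideal.Quotient.eq_zero_iff_mem, map_mul, map_natCast, ← nsmul_eq_mul, ← hx]
      exact addOrderOf_nsmul_eq_zero _
    have h1 : (1 : 𝓞 K) ∈ a ⊔ Ideal.span {(p : 𝓞 K)} := by rw [hcop]; simp
    obtain ⟨u, hu, v, hv, huv⟩ := Submodule.mem_sup.mp h1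
    obtain ⟨w, rfl⟩ := Ideal.mem_span_singleton.mp hv
    have hy : y ∈ a := by
      have : y = u * y + w * ((p : 𝓞 K) * y) := by linear_combination (-y) * huv
      rw [this]
      exact a.add_mem (a.mul_mem_right _ hu) (a.mul_mem_left _ hpy)
    rw [Ideal.Quotient.eq_zero_iff_mem.mpr hy, addOrderOf_zero] at hx
    exact hp.one_lt.ne hx
  apply hP.ne_top
  rw [Ideal.isCoprime_iff_sup_eq] at h
  rw [eq_top_iff, ← h, sup_le_iff]
  refine ⟨hPa, ?_⟩
  rw [Ideal.span_singleton_le_iff_mem]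
  obtain ⟨k, rfl⟩ := hpN
  rw [Nat.cast_mul]
  exact P.mul_mem_right _ hPp

end Ideals

/-- A Hecke character with `∞`-type `l`, modulo some nonzero ideal `modulus`, of a field `K` which is
embedded in `ℂ` (`K` will be an imaginary quadratic subfield of `ℂ`). For `l = 0` these are the
characters of the ray class groups of `K`. -/
structure HeckeCharacter (K : Type*) [Field K] [NumberField K] [Algebra K ℂ] (l : ℕ) where
  modulus : Ideal (𝓞 K)
  modulus_ne_bot : modulus ≠ ⊥
  toHom : idealsPrimeTo K modulus →* ℂˣ
  map_principal : ∀ (I : idealsPrimeTo K modulus) (α : Kˣ),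
    (I : (FractionalIdeal (𝓞 K)⁰ K)ˣ) = toPrincipalIdeal (𝓞 K) K α →
    MulCongrOne modulus α → (toHom I : ℂ) = algebraMap K ℂ α ^ l

namespace HeckeCharacter

variable {K : Type*} [Field K] [NumberField K] [Algebra K ℂ] {l : ℕ}

open Classical in
/-- The value of a Hecke character on an integral ideal, extended by `0` to the ideals which are not
prime to the modulus. -/
noncomputable def val (ψ : HeckeCharacter K l) (a : Ideal (𝓞 K)) : ℂ :=
  if h : a ∈ (Ideal (𝓞 K))⁰ ∧ IsCoprime a ψ.modulus then
    (ψ.toHom ⟨FractionalIdeal.mk0 K ⟨a, h.1⟩, mk0_mem_idealsPrimeTo ⟨a, h.1⟩ h.2⟩ : ℂ)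
  else 0

/-- The `n`-th Fourier coefficient of `f_ψ = ∑ ψ(a) q ^ N(a)`, the sum being over the integral
ideals `a`. -/
noncomputable def coeff (ψ : HeckeCharacter K l) (n : ℕ) : ℂ :=
  ∑ᶠ (a : Ideal (𝓞 K)) (_ : Ideal.absNorm a = n), ψ.val a

/-- `ψ` has rational coefficients if the associated eigenform `f_ψ` has. -/
def HasRationalCoefficients (ψ : HeckeCharacter K l) : Prop :=
  ∀ n : ℕ, 1 ≤ n → ∃ q : ℚ, ψ.coeff n = q

open Classical in
/-- The order of the additional twisting characters of `K`: quartic characters for `ℚ(√-1)`,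
sextic characters for `ℚ(√-3)`, and none for the other fields. -/
noncomputable def extraTwistOrder (K : Type*) [Field K] : ℕ :=
  if ∃ x : K, x ^ 2 = -1 then 4 else if ∃ x : K, x ^ 2 = -3 then 6 else 1

/-- `ψ'` is a twist of `ψ`: up to finitely many primes, `ψ' = ψ ⊗ (φ ∘ N) ⊗ ω` where `φ` is a
Dirichlet character, `N` is the norm, and `ω` is trivial unless `K` is `ℚ(√-1)` or `ℚ(√-3)`, when
it may be any quartic (resp. sextic) ray class character of `K`. -/
def IsTwist (ψ ψ' : HeckeCharacter K l) : Prop :=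
  ∃ (N : ℕ) (φ : DirichletCharacter ℂ N) (ω : HeckeCharacter K 0) (n : Ideal (𝓞 K)),
    N ≠ 0 ∧ (∀ I, ω.toHom I ^ extraTwistOrder K = 1) ∧ n ≠ ⊥ ∧
    ∀ a : Ideal (𝓞 K), IsCoprime a n →
      ψ'.val a = ψ.val a * φ (Ideal.absNorm a : ZMod N) * ω.val a

/-- The trivial ray class character. -/
noncomputable def trivialChar (K : Type*) [Field K] [NumberField K] [Algebra K ℂ] : HeckeCharacter K 0 where
  modulus := ⊤
  modulus_ne_bot := top_ne_bot
  toHom := 1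
  map_principal := by simp

/-- The product of two characters as a homomorphism on the ideals prime to both moduli. -/
noncomputable def mulHom (ω ω' : HeckeCharacter K 0) :
    idealsPrimeTo K (ω.modulus * ω'.modulus) →* ℂˣ :=
  ω.toHom.comp (Subgroup.inclusion (idealsPrimeTo_mul_le_left ω.modulus ω'.modulus)) *
    ω'.toHom.comp (Subgroup.inclusion (idealsPrimeTo_mul_le_right ω.modulus ω'.modulus))

theorem mulHom_apply (ω ω' : HeckeCharacter K 0)
    (I : idealsPrimeTo K (ω.modulus * ω'.modulus)) :
    mulHom ω ω' I = ω.toHom ⟨I.1, idealsPrimeTo_mul_le_left ω.modulus ω'.modulus I.2⟩ *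
      ω'.toHom ⟨I.1, idealsPrimeTo_mul_le_right ω.modulus ω'.modulus I.2⟩ := rfl

/-- The product of two ray class characters. -/
noncomputable def mulChar (ω ω' : HeckeCharacter K 0) : HeckeCharacter K 0 where
  modulus := ω.modulus * ω'.modulus
  modulus_ne_bot := by
    rw [Ne, Ideal.mul_eq_bot, not_or]
    exact ⟨ω.modulus_ne_bot, ω'.modulus_ne_bot⟩
  toHom := mulHom ω ω'
  map_principal := by
    intro I α hI hα
    obtain ⟨b, c, hc, hcop, hbc, h⟩ := hα
    have l1 : ω.modulus * ω'.modulus ≤ ω.modulus := Ideal.mul_le_left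
    have l2 : ω.modulus * ω'.modulus ≤ ω'.modulus := Ideal.mul_le_right
    have k1 : MulCongrOne ω.modulus α :=
      ⟨b, c, hc, hcop.of_mul_right_left, l1 hbc, h⟩
    have k2 : MulCongrOne ω'.modulus α :=
      ⟨b, c, hc, hcop.of_mul_right_right, l2 hbc, h⟩
    have h1 := ω.map_principal ⟨I.1, idealsPrimeTo_mul_le_left ω.modulus ω'.modulus I.2⟩ α hI k1
    have h2 := ω'.map_principal ⟨I.1, idealsPrimeTo_mul_le_right ω.modulus ω'.modulus I.2⟩ α hI k2
    rw [pow_zero] at h1 h2 ⊢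
    rw [mulHom_apply, Units.val_mul, h1, h2, one_mul]

/-- The inverse of a ray class character. -/
noncomputable def invChar (ω : HeckeCharacter K 0) : HeckeCharacter K 0 where
  modulus := ω.modulus
  modulus_ne_bot := ω.modulus_ne_bot
  toHom := ω.toHom⁻¹
  map_principal := by
    intro I α hI h
    have h1 := ω.map_principal I α hI h
    simp only [pow_zero] at h1 ⊢
    simp [h1]

theorem val_of_coprime (ψ : HeckeCharacter K l) {a : Ideal (𝓞 K)} (h0 : a ∈ (Ideal (𝓞 K))⁰)
    (h : IsCoprime a ψ.modulus) : ψ.val a =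
    (ψ.toHom ⟨FractionalIdeal.mk0 K ⟨a, h0⟩, mk0_mem_idealsPrimeTo ⟨a, h0⟩ h⟩ : ℂ) := by
  rw [val, dif_pos ⟨h0, h⟩]

theorem val_of_not_mem (ψ : HeckeCharacter K l) {a : Ideal (𝓞 K)} (h0 : a ∉ (Ideal (𝓞 K))⁰) :
    ψ.val a = 0 := by
  rw [val, dif_neg (fun h => h0 h.1)]

theorem val_trivialChar {a : Ideal (𝓞 K)} (h0 : a ∈ (Ideal (𝓞 K))⁰) :
    (trivialChar K).val a = 1 := by
  have h : IsCoprime a (⊤ : Ideal (𝓞 K)) := by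
    rw [← Ideal.one_eq_top]
    exact isCoprime_one_right
  rw [val_of_coprime (trivialChar K) h0 h]
  exact Units.val_one

theorem val_mulChar (ω ω' : HeckeCharacter K 0) {a : Ideal (𝓞 K)}
    (h : IsCoprime a ω.modulus) (h' : IsCoprime a ω'.modulus) :
    (mulChar ω ω').val a = ω.val a * ω'.val a := by
  by_cases h0 : a ∈ (Ideal (𝓞 K))⁰
  · rw [val_of_coprime (mulChar ω ω') h0 (h.mul_right h'), val_of_coprime ω h0 h,
      val_of_coprime ω' h0 h', ← Units.val_mul]
    exact congrArg Units.val (mulHom_apply ω ω' _)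
  · rw [val_of_not_mem _ h0, val_of_not_mem _ h0, zero_mul]

theorem val_mul_invChar (ω : HeckeCharacter K 0) {a : Ideal (𝓞 K)} (h0 : a ∈ (Ideal (𝓞 K))⁰)
    (h : IsCoprime a ω.modulus) : ω.val a * (invChar ω).val a = 1 := by
  rw [val_of_coprime _ h0 h, val_of_coprime (invChar ω) h0 h]
  exact Units.mul_inv _

theorem IsTwist.refl (ψ : HeckeCharacter K l) : IsTwist ψ ψ := by
  refine ⟨1, 1, trivialChar K, ⊤, one_ne_zero, fun _ => one_pow _, top_ne_bot, fun a _ => ?_⟩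
  by_cases h0 : a ∈ (Ideal (𝓞 K))⁰
  · rw [val_trivialChar h0, MulChar.one_apply (isUnit_of_subsingleton _)]; simp
  · rw [val_of_not_mem _ h0]; simp

theorem IsTwist.symm {ψ ψ' : HeckeCharacter K l} (h : IsTwist ψ ψ') : IsTwist ψ' ψ := by
  obtain ⟨N, φ, ω, n, hN, hω, hn, h⟩ := h
  refine ⟨N, φ⁻¹, invChar ω, n * (Ideal.span {(N : 𝓞 K)} * ω.modulus), hN, ?_, ?_, ?_⟩
  · intro I
    exact (inv_pow (ω.toHom I) _).trans (by rw [hω I, inv_one])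
  · refine mul_ne_zero hn (mul_ne_zero ?_ ω.modulus_ne_bot)
    simpa using hN
  · intro a ha
    have ha1 := ha.of_mul_right_left
    have ha2 := ha.of_mul_right_right.of_mul_right_left
    have ha3 := ha.of_mul_right_right.of_mul_right_right
    by_cases h0 : a ∈ (Ideal (𝓞 K))⁰
    · have e1 := val_mul_invChar ω h0 ha3
      have e2 : φ (Ideal.absNorm a : ZMod N) * φ⁻¹ (Ideal.absNorm a : ZMod N) = 1 := by
        rw [← MulChar.mul_apply, mul_inv_cancel, MulChar.one_apply (isUnit_absNorm ha2)]
      rw [h a ha1]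
      linear_combination (-ψ.val a) * e1 - ψ.val a * ω.val a * (invChar ω).val a * e2
    · rw [val_of_not_mem _ h0, val_of_not_mem _ h0]; simp

theorem IsTwist.trans {ψ ψ' ψ'' : HeckeCharacter K l} (h : IsTwist ψ ψ') (h' : IsTwist ψ' ψ'') :
    IsTwist ψ ψ'' := by
  obtain ⟨N, φ, ω, n, hN, hω, hn, h⟩ := h
  obtain ⟨N', φ', ω', n', hN', hω', hn', h'⟩ := h'
  refine ⟨N * N', φ.changeLevel (dvd_mul_right N N') * φ'.changeLevel (dvd_mul_left N' N),
    mulChar ω ω', n * n' * (Ideal.span {((N * N' : ℕ) : 𝓞 K)} * (ω.modulus * ω'.modulus)),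
    mul_ne_zero hN hN', ?_, ?_, ?_⟩
  · intro I
    have e (J : idealsPrimeTo K (ω.modulus * ω'.modulus)) :
        (mulHom ω ω' J) ^ extraTwistOrder K = 1 := by
      rw [mulHom_apply, mul_pow, hω, hω', one_mul]
    exact e I
  · refine mul_ne_zero (mul_ne_zero hn hn')
      (mul_ne_zero ?_ (mul_ne_zero ω.modulus_ne_bot ω'.modulus_ne_bot))
    simpa using And.intro hN hN'
  · intro a ha
    have ha1 := ha.of_mul_right_left
    have ha2 := isUnit_absNorm ha.of_mul_right_right.of_mul_right_left
    have ha3 := ha.of_mul_right_right.of_mul_right_right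
    rw [h' a ha1.of_mul_right_right, h a ha1.of_mul_right_left,
      val_mulChar _ _ ha3.of_mul_right_left ha3.of_mul_right_right, MulChar.mul_apply,
      ← ha2.unit_spec, DirichletCharacter.changeLevel_eq_cast_of_dvd,
      DirichletCharacter.changeLevel_eq_cast_of_dvd, ha2.unit_spec]
    rw [ZMod.cast_natCast (dvd_mul_right N N'), ZMod.cast_natCast (dvd_mul_left N' N)]
    ring

end HeckeCharacter

/-- A Hecke character, of an arbitrary imaginary quadratic field, with `∞`-type `l` and rational
coefficients. -/
structure RationalHeckeCharacter (l : ℕ) where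
  field : ImagQuadField
  char : HeckeCharacter field l
  rational : char.HasRationalCoefficients

/-- Hecke characters with `∞`-type `l` and rational coefficients, up to twisting. -/
instance twistSetoid (l : ℕ) : Setoid (RationalHeckeCharacter l) where
  r ψ ψ' := ∃ h : ψ.field = ψ'.field, HeckeCharacter.IsTwist (h ▸ ψ.char) ψ'.char
  iseqv := by
    refine ⟨fun ψ => ⟨rfl, .refl _⟩, ?_, ?_⟩
    · rintro ⟨K, ψ, hψ⟩ ⟨K', ψ', hψ'⟩ ⟨h, ht⟩
      dsimp only at h
      subst h
      exact ⟨rfl, ht.symm⟩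
    · rintro ⟨K, ψ, hψ⟩ ⟨K', ψ', hψ'⟩ ⟨K'', ψ'', hψ''⟩ ⟨h, ht⟩ ⟨h', ht'⟩
      dsimp only at h h'
      subst h h'
      exact ⟨rfl, ht.trans ht'⟩

set_option linter.unusedSectionVars false

/-! Write ā for the complex conjugate of a.

Rational coefficients force ψ(a) to be a generator of a^l in K, with ψ(ā) its conjugate, whenever a
and ā are prime to the modulus (`exists_generator`). At a prime P ≠ P̄ the coefficients at N(P) and
N(P)² give the sum and the product of ψ(P) and ψ(P̄), so ψ(P) is a root of a rational quadratic.
Some power ψ(P)^n equals α^l with α in K, by the ∞-type, and α^l is irrational because P^(nl) is not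
its own conjugate. Reducing the power modulo the quadratic puts ψ(P) itself in K. Every ideal class
contains such ideals, so e_K ∣ l (`exponent_dvd`).

Injectivity (`isTwist`): the quotient ω of two such characters of K is a ray class character with
values in the units of K. Over ℚ(√-1) and ℚ(√-3) it is an allowed quartic or sextic twist. Otherwise
its values are ±1 and ω(ā) = ω(a), and ω has to factor through the norm. If N(a) is 1 modulo a
suitable N, a Thue-type pigeonhole argument writes N(a) as the norm of an element of K with small
denominator (`exists_norm_eq_absNorm_mul`), and multiplication by an element of norm 1 turns it into
b/c with b ≡ c modulo the modulus of ω (`exists_modulus_norm`). The ideals a(c) and (b) have the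
same norm, so they are gC and gC̄ (`exists_mul_conjI_of_absNorm_eq`), and ω agrees on them. Hence
ω(a) = 1, and ω is a Dirichlet character composed with the norm.

Surjectivity (`exists_character`): a character amounts to a multiplicative choice of generators of
the l-th powers of ideals, compatible with conjugation and with the ∞-type; it is obtained as a
subgroup of pairs (I, β) which is the graph of a homomorphism (`exists_character_of_subgroup`). Over
ℚ(√-1) and ℚ(√-3) the generator congruent to 1 modulo 2 + 2√-1, respectively 3, is unique. If the
units are ±1, a subgroup of index two avoiding (1, -1) is needed, and it exists unless -1 is γ²α^l
for a certain kind of α (`exists_character_of_neg_one`). For even l that would make -1 a square. For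
odd l the class group has odd exponent, so only one prime ramifies: K is generated by √-p with p = 2
or p ≡ 3 mod 4 (`exists_prime_sq_eq_neg`), and a congruence modulo 16 or √-p excludes the equation.
-/

/-- `K` is an imaginary quadratic field, with a fixed embedding into `ℂ`. -/
class IsImagQuad (K : Type*) [Field K] [NumberField K] [Algebra K ℂ] : Prop where
  finrank_eq_two : Module.finrank ℚ K = 2
  not_real : ∃ x : K, (algebraMap K ℂ x).im ≠ 0

instance (K : ImagQuadField) : IsImagQuad K where
  finrank_eq_two := K.finrank_eq_two
  not_real := by
    obtain ⟨x, hx, h⟩ := K.not_real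
    exact ⟨⟨x, hx⟩, h⟩

/-! ### Complex conjugation on elements, ideals and units -/

namespace IsImagQuad

variable (K : Type*) [Field K] [NumberField K] [Algebra K ℂ] [IsImagQuad K]

instance : Algebra.IsQuadraticExtension ℚ K where
  finrank_eq_two' := finrank_eq_two

/-- Complex conjugation on `K`. -/
noncomputable def conj : K ≃ₐ[ℚ] K :=
  AlgEquiv.restrictNormal (Complex.conjAe.restrictScalars ℚ) K

variable {K}

theorem algebraMap_conj (x : K) :
    algebraMap K ℂ (conj K x) = starRingEnd ℂ (algebraMap K ℂ x) :=
  AlgEquiv.restrictNormal_commutes (Complex.conjAe.restrictScalars ℚ) K x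

theorem conj_conj (x : K) : conj K (conj K x) = x := by
  apply (algebraMap K ℂ).injective
  simp [algebraMap_conj]

variable (K) in
theorem conj_ne_one : conj K ≠ 1 := by
  intro h
  obtain ⟨x, hx⟩ := not_real (K := K)
  apply hx
  have := algebraMap_conj x
  rw [h, AlgEquiv.one_apply, eq_comm, Complex.conj_eq_iff_im] at this
  exact this

open Classical in
variable (K) in
theorem univ_gal : (Finset.univ : Finset (K ≃ₐ[ℚ] K)) = {1, conj K} := by
  symm
  apply Finset.eq_univ_of_card
  rw [Finset.card_pair (conj_ne_one K).symm, ← Nat.card_eq_fintype_card, IsGalois.card_aut_eq_finrank,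
    finrank_eq_two]

theorem norm_eq (x : K) : algebraMap ℚ K (Algebra.norm ℚ x) = x * conj K x := by
  classical
  rw [Algebra.norm_eq_prod_automorphisms, univ_gal, Finset.prod_pair (conj_ne_one K).symm]
  rfl

theorem exists_rat_of_conj_eq {x : K} (h : conj K x = x) : ∃ q : ℚ, (q : K) = x := by
  classical
  have : x ∈ (⊥ : IntermediateField ℚ K) := by
    rw [IsGalois.mem_bot_iff_fixed]
    intro f
    have hf : f ∈ (Finset.univ : Finset (K ≃ₐ[ℚ] K)) := Finset.mem_univ f
    rw [univ_gal, Finset.mem_insert, Finset.mem_singleton] at hf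
    rcases hf with rfl | rfl
    · rfl
    · exact h
  obtain ⟨q, hq⟩ := IntermediateField.mem_bot.mp this
  exact ⟨q, by simpa using hq⟩

variable (K) in
/-- Complex conjugation on the ring of integers. -/
noncomputable def conjO : 𝓞 K ≃+* 𝓞 K := RingOfIntegers.mapRingEquiv (conj K).toRingEquiv

theorem coe_conjO (x : 𝓞 K) : ((conjO K x : 𝓞 K) : K) = conj K x := rfl

theorem conjO_conjO (x : 𝓞 K) : conjO K (conjO K x) = x := by
  apply RingOfIntegers.ext
  rw [coe_conjO, coe_conjO, conj_conj]

/-- In ℂ the product is |x|², so the norm is nonnegative and the absolute value inside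
`Ideal.absNorm` loses no sign. -/
theorem mul_conjO (x : 𝓞 K) : x * conjO K x = (Ideal.absNorm (Ideal.span {x}) : 𝓞 K) := by
  have h1 : (Algebra.norm ℤ x : ℚ) = Algebra.norm ℚ (x : K) := by
    simpa using (Algebra.coe_norm_int x)
  have h2 := norm_eq (x : K)
  have h3 : (0 : ℚ) ≤ Algebra.norm ℚ (x : K) := by
    have := congrArg (algebraMap K ℂ) h2
    rw [map_mul, algebraMap_conj, Complex.mul_conj, ← IsScalarTower.algebraMap_apply] at this
    have h4 : ((Algebra.norm ℚ (x : K) : ℝ) : ℂ) = (Complex.normSq (algebraMap K ℂ x) : ℂ) := by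
      simpa using this
    have h5 := Complex.ofReal_injective h4
    have h6 := Complex.normSq_nonneg (algebraMap K ℂ (x : K))
    rw [← h5] at h6
    exact_mod_cast h6
  rw [← h1] at h3 h2
  have h4 : (0 : ℤ) ≤ Algebra.norm ℤ x := by exact_mod_cast h3
  rw [Ideal.absNorm_span_singleton]
  apply RingOfIntegers.ext
  change (x : K) * conj K x = _
  rw [← h2]
  have : ((Algebra.norm ℤ x).natAbs : ℤ) = Algebra.norm ℤ x := Int.natAbs_of_nonneg h4
  change _ = (((Algebra.norm ℤ x).natAbs : 𝓞 K) : K)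
  rw [← Int.cast_natCast, this]
  simp

/-- Complex conjugation on ideals. -/
noncomputable def conjI (I : Ideal (𝓞 K)) : Ideal (𝓞 K) := I.map (conjO K)

theorem mem_conjI {I : Ideal (𝓞 K)} {x : 𝓞 K} : x ∈ conjI I ↔ conjO K x ∈ I := by
  rw [conjI, Ideal.mem_map_iff_of_surjective _ (conjO K).surjective]
  constructor
  · rintro ⟨y, hy, rfl⟩
    rwa [conjO_conjO]
  · intro h
    exact ⟨_, h, conjO_conjO x⟩

@[simp] theorem conjI_conjI (I : Ideal (𝓞 K)) : conjI (conjI I) = I := by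
  ext x
  rw [mem_conjI, mem_conjI, conjO_conjO]

theorem conjI_injective : Function.Injective (conjI (K := K)) :=
  Function.LeftInverse.injective conjI_conjI

theorem conjI_mul (I J : Ideal (𝓞 K)) : conjI (I * J) = conjI I * conjI J := Ideal.map_mul _ _ _

theorem conjI_pow (I : Ideal (𝓞 K)) (n : ℕ) : conjI (I ^ n) = conjI I ^ n := Ideal.map_pow _ _ _

theorem conjI_span (x : 𝓞 K) : conjI (Ideal.span {x}) = Ideal.span {conjO K x} := by
  rw [conjI, Ideal.map_span, Set.image_singleton]

theorem conjI_bot : conjI (⊥ : Ideal (𝓞 K)) = ⊥ := Ideal.map_bot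

theorem conjI_top : conjI (⊤ : Ideal (𝓞 K)) = ⊤ := Ideal.map_top _

theorem conjI_ne_bot {I : Ideal (𝓞 K)} (h : I ≠ ⊥) : conjI I ≠ ⊥ :=
  fun h' => h (conjI_injective (h'.trans conjI_bot.symm))

theorem isCoprime_conjI {I J : Ideal (𝓞 K)} (h : IsCoprime I J) :
    IsCoprime (conjI I) (conjI J) := by
  rw [Ideal.isCoprime_iff_sup_eq] at h ⊢
  rw [conjI, conjI, ← Ideal.map_sup, h, Ideal.map_top]

theorem isPrime_conjI {I : Ideal (𝓞 K)} (h : I.IsPrime) : (conjI I).IsPrime :=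
  Ideal.map_isPrime_of_equiv (conjO K)

theorem exists_pow_eq_span (I : Ideal (𝓞 K)) : ∃ n : ℕ, n ≠ 0 ∧ ∃ x : 𝓞 K, I ^ n = Ideal.span {x} := by
  by_cases h0 : I = ⊥
  · exact ⟨1, one_ne_zero, 0, by simp [h0]⟩
  · refine ⟨Fintype.card (ClassGroup (𝓞 K)), Fintype.card_ne_zero, ?_⟩
    have h := pow_card_eq_one (x := ClassGroup.mk0 (⟨I, mem_nonZeroDivisors_of_ne_zero h0⟩ : (Ideal (𝓞 K))⁰))
    rw [← map_pow, ClassGroup.mk0_eq_one_iff] at h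
    obtain ⟨x, hx⟩ := h
    exact ⟨x, hx⟩

theorem ideal_pow_injective {I J : Ideal (𝓞 K)} {n : ℕ} (hn : n ≠ 0) (h : I ^ n = J ^ n) : I = J := by
  apply dvd_antisymm
  · exact (UniqueFactorizationMonoid.pow_dvd_pow_iff_dvd hn).mp h.dvd
  · exact (UniqueFactorizationMonoid.pow_dvd_pow_iff_dvd hn).mp h.symm.dvd

/-- Some power of `I` is principal, where `mul_conjO` applies, and an ideal is determined by its
`n`-th power. -/
theorem mul_conjI (I : Ideal (𝓞 K)) :
    I * conjI I = Ideal.span {(Ideal.absNorm I : 𝓞 K)} := by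
  obtain ⟨n, hn, x, hx⟩ := exists_pow_eq_span I
  apply ideal_pow_injective hn
  rw [mul_pow, ← conjI_pow, hx, conjI_span, Ideal.span_singleton_mul_span_singleton, mul_conjO, ← hx,
    map_pow, Nat.cast_pow, Ideal.span_singleton_pow]

theorem absNorm_conjI (I : Ideal (𝓞 K)) : Ideal.absNorm (conjI I) = Ideal.absNorm I := by
  have h1 := mul_conjI I
  have h2 := mul_conjI (conjI I)
  rw [conjI_conjI, mul_comm, h1, Ideal.span_singleton_eq_span_singleton] at h2
  have h3 := congrArg Ideal.absNorm (Ideal.span_singleton_eq_span_singleton.mpr h2)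
  rw [Ideal.absNorm_span_natCast, Ideal.absNorm_span_natCast, RingOfIntegers.rank, finrank_eq_two] at h3
  exact (Nat.pow_left_injective two_ne_zero h3).symm

/-- Every ideal class contains an integral ideal which is prime to a given nonzero ideal. -/
theorem exists_isCoprime_mk0_eq {M : Ideal (𝓞 K)} (hM : M ≠ ⊥) (c : ClassGroup (𝓞 K)) :
    ∃ a : (Ideal (𝓞 K))⁰, IsCoprime (a : Ideal (𝓞 K)) M ∧ ClassGroup.mk0 a = c := by
  obtain ⟨b, hb⟩ := ClassGroup.mk0_surjective c⁻¹
  have hb0 : (b : Ideal (𝓞 K)) ≠ ⊥ := nonZeroDivisors.coe_ne_zero b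
  -- Since `x` generates `b` modulo `b * M`, the cofactor `a` in `(x) = b * a` is prime to `M`, and
  -- its class is inverse to that of `b`. The case `x = 0` can occur only for `M = ⊤`.
  obtain ⟨x, hx⟩ := IsDedekindDomain.exists_sup_span_eq (I := (b : Ideal (𝓞 K)) * M) (J := b)
    Ideal.mul_le_left (mul_ne_zero hb0 hM)
  have hxb : (b : Ideal (𝓞 K)) ∣ Ideal.span {x} := by
    rw [Ideal.dvd_iff_le]
    conv_rhs => rw [← hx]
    exact le_sup_right
  obtain ⟨a, ha⟩ := hxb
  have hcop : IsCoprime a M := by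
    rw [Ideal.isCoprime_iff_sup_eq, sup_comm, ← Ideal.one_eq_top]
    apply mul_left_cancel₀ hb0
    rw [Ideal.mul_sup, ← ha, hx, mul_one]
  by_cases hx0 : x = 0
  · have ha0 : a = ⊥ := by
      rw [hx0, Ideal.span_singleton_zero, eq_comm, Ideal.mul_eq_bot] at ha
      exact ha.resolve_left hb0
    have hM1 : M = ⊤ := by
      rw [ha0, Ideal.isCoprime_iff_sup_eq, bot_sup_eq] at hcop
      exact hcop
    obtain ⟨a, ha⟩ := ClassGroup.mk0_surjective c
    exact ⟨a, by rw [hM1, ← Ideal.one_eq_top]; exact isCoprime_one_right, ha⟩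
  · have ha0 : a ≠ ⊥ := by
      rintro rfl
      rw [Ideal.mul_bot, Ideal.span_singleton_eq_bot] at ha
      exact hx0 ha
    refine ⟨⟨a, mem_nonZeroDivisors_of_ne_zero ha0⟩, hcop, ?_⟩
    rw [← inv_inj, ← hb, eq_comm, ← mul_eq_one_iff_eq_inv, ← map_mul, ClassGroup.mk0_eq_one_iff]
    exact ⟨x, ha.symm⟩

/-- The class exponent kills ideals. -/
theorem exists_pow_eq_span_of_exponent_dvd {l : ℕ} (h : Monoid.exponent (ClassGroup (𝓞 K)) ∣ l)
    (a : Ideal (𝓞 K)) (hl : l ≠ 0) : ∃ x : 𝓞 K, a ^ l = Ideal.span {x} := by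
  by_cases h0 : a = ⊥
  · exact ⟨0, by simp [h0, hl]⟩
  have h := Monoid.exponent_dvd_iff_forall_pow_eq_one.mp h
    (ClassGroup.mk0 (⟨a, mem_nonZeroDivisors_of_ne_zero h0⟩ : (Ideal (𝓞 K))⁰))
  rw [← map_pow, ClassGroup.mk0_eq_one_iff] at h
  obtain ⟨x, hx⟩ := h
  exact ⟨x, hx⟩

theorem exists_int_of_conjO_eq {x : 𝓞 K} (h : conjO K x = x) : ∃ n : ℤ, (n : 𝓞 K) = x := by
  obtain ⟨q, hq⟩ := exists_rat_of_conj_eq (x := (x : K)) (congrArg (algebraMap (𝓞 K) K) h)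
  have hi : IsIntegral ℤ (q : K) := hq ▸ x.isIntegral_coe
  have hi' : IsIntegral ℤ q := by
    have : IsIntegral ℤ (algebraMap ℚ K q) := by simpa using hi
    exact (isIntegral_algebraMap_iff (algebraMap ℚ K).injective).mp this
  obtain ⟨n, hn⟩ := IsIntegrallyClosed.isIntegral_iff.mp hi'
  refine ⟨n, RingOfIntegers.ext ?_⟩
  rw [← hq, ← hn]
  simp

theorem exists_trace (x : 𝓞 K) : ∃ n : ℤ, (n : 𝓞 K) = x + conjO K x :=
  exists_int_of_conjO_eq (by rw [map_add, conjO_conjO, add_comm])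

/-- Since |u| = 1, the unit is a root of X² - tX + 1 with an integer |t| ≤ 2. The values t = ±2 give
±1; in the other cases 2u - t is a square root of t² - 4, which is -4 or -3. -/
theorem eq_one_or_neg_one_or (u : (𝓞 K)ˣ) : u = 1 ∨ u = -1 ∨
    (u ^ 4 = 1 ∧ ∃ x : K, x ^ 2 = -1) ∨ (u ^ 6 = 1 ∧ ∃ x : K, x ^ 2 = -3) := by
  obtain ⟨t, ht⟩ := exists_trace (u : 𝓞 K)
  have hn : (u : 𝓞 K) * conjO K u = 1 := by
    rw [mul_conjO, Ideal.span_singleton_eq_top.mpr u.isUnit]; simp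
  have hq : (u : 𝓞 K) ^ 2 - t * u + 1 = 0 := by
    rw [ht]; linear_combination -hn
  have hbound : |t| ≤ 2 := by
    have h1 : algebraMap K ℂ (u : 𝓞 K) * starRingEnd ℂ (algebraMap K ℂ (u : 𝓞 K)) = 1 := by
      rw [← algebraMap_conj, ← coe_conjO, ← map_mul, ← map_mul, hn]; simp
    have h2 : ((t : ℤ) : ℂ) = algebraMap K ℂ (u : 𝓞 K) + starRingEnd ℂ (algebraMap K ℂ (u : 𝓞 K)) := by
      rw [← algebraMap_conj, ← coe_conjO, ← map_add, ← map_add, ← ht]; simp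
    rw [Complex.mul_conj] at h1
    have h1' : Complex.normSq (algebraMap K ℂ (u : 𝓞 K)) = 1 := by exact_mod_cast h1
    rw [Complex.add_conj] at h2
    have h2' : (t : ℝ) = 2 * (algebraMap K ℂ (u : 𝓞 K)).re := by exact_mod_cast h2
    rw [Complex.normSq_apply] at h1'
    have h3 : (t : ℝ) ^ 2 ≤ 2 ^ 2 := by
      rw [h2']; nlinarith [mul_self_nonneg (algebraMap K ℂ (u : 𝓞 K)).im]
    have h4 : |(t : ℝ)| ≤ |2| := sq_le_sq.mp h3
    rw [abs_two] at h4
    exact_mod_cast h4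
  have hqK : ((u : 𝓞 K) : K) ^ 2 - t * ((u : 𝓞 K) : K) + 1 = 0 := by
    have := congrArg (algebraMap (𝓞 K) K) hq
    simpa using this
  rw [abs_le] at hbound
  obtain ⟨h1, h2⟩ := hbound
  interval_cases t
  · right; left
    apply Units.ext
    have : ((u : 𝓞 K) + 1) ^ 2 = 0 := by push_cast at hq; linear_combination hq
    rw [Units.val_neg, Units.val_one]
    linear_combination pow_eq_zero_iff two_ne_zero |>.mp this
  · right; right; right
    push_cast at hq hqK
    refine ⟨Units.ext ?_, 2 * ((u : 𝓞 K) : K) + 1, by linear_combination 4 * hqK⟩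
    push_cast
    linear_combination ((u : 𝓞 K) ^ 4 - (u : 𝓞 K) ^ 3 + (u : 𝓞 K) - 1) * hq
  · right; right; left
    push_cast at hq hqK
    refine ⟨Units.ext ?_, ((u : 𝓞 K) : K), by linear_combination hqK⟩
    push_cast
    linear_combination ((u : 𝓞 K) ^ 2 - 1) * hq
  · right; right; right
    push_cast at hq hqK
    refine ⟨Units.ext ?_, 2 * ((u : 𝓞 K) : K) - 1, by linear_combination 4 * hqK⟩
    push_cast
    linear_combination ((u : 𝓞 K) ^ 4 + (u : 𝓞 K) ^ 3 - (u : 𝓞 K) - 1) * hq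
  · left
    apply Units.ext
    have : ((u : 𝓞 K) - 1) ^ 2 = 0 := by push_cast at hq; linear_combination hq
    rw [Units.val_one]
    linear_combination pow_eq_zero_iff two_ne_zero |>.mp this

/-- An element whose square is a negative rational number is conjugate to its negative. -/
theorem conj_eq_neg_of_sq {x : K} {q : ℚ} (hq : 0 < q) (h : x ^ 2 = -(q : K)) : conj K x = -x := by
  have h1 : (conj K x) ^ 2 = x ^ 2 := by rw [← map_pow, h]; simp
  rcases sq_eq_sq_iff_eq_or_eq_neg.mp h1 with h2 | h2
  · obtain ⟨r, hr⟩ := exists_rat_of_conj_eq h2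
    rw [← hr] at h
    have : r ^ 2 = -q := by exact_mod_cast h
    nlinarith [sq_nonneg r]
  · exact h2

/-- Both elements are negated by conjugation, so their product is rational. This keeps K from
containing the square roots of two essentially different negative numbers. -/
theorem rat_mul_sq {x y : K} {q r : ℚ} (hq : 0 < q) (hr : 0 < r) (hx : x ^ 2 = -(q : K))
    (hy : y ^ 2 = -(r : K)) : ∃ s : ℚ, s ^ 2 = q * r := by
  obtain ⟨s, hs⟩ := exists_rat_of_conj_eq (x := x * y)
    (by rw [map_mul, conj_eq_neg_of_sq hq hx, conj_eq_neg_of_sq hr hy, neg_mul_neg])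
  refine ⟨s, ?_⟩
  have : (s : K) ^ 2 = q * r := by rw [hs, mul_pow, hx, hy, neg_mul_neg]
  exact_mod_cast this

end IsImagQuad

/-! ### Multiplicativity of Hecke characters and their values at principal ideals -/

namespace HeckeCharacter

section General

variable {K : Type*} [Field K] [NumberField K] [Algebra K ℂ] {l : ℕ}

theorem val_top (ψ : HeckeCharacter K l) : ψ.val ⊤ = 1 := by
  have h0 : (⊤ : Ideal (𝓞 K)) ∈ (Ideal (𝓞 K))⁰ := mem_nonZeroDivisors_of_ne_zero top_ne_bot
  have h1 : IsCoprime (⊤ : Ideal (𝓞 K)) ψ.modulus := by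
    rw [← Ideal.one_eq_top]; exact isCoprime_one_left
  rw [val_of_coprime ψ h0 h1]
  have : (⟨FractionalIdeal.mk0 K ⟨⊤, h0⟩, mk0_mem_idealsPrimeTo ⟨⊤, h0⟩ h1⟩ :
      idealsPrimeTo K ψ.modulus) = 1 := by
    apply Subtype.ext
    exact (congrArg (FractionalIdeal.mk0 (R := 𝓞 K) K) (Subtype.ext Ideal.one_eq_top.symm)).trans
      (FractionalIdeal.mk0 (R := 𝓞 K) K).map_one
  rw [this, map_one, Units.val_one]

theorem val_mul (ψ : HeckeCharacter K l) {a b : Ideal (𝓞 K)} (ha : IsCoprime a ψ.modulus)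
    (hb : IsCoprime b ψ.modulus) : ψ.val (a * b) = ψ.val a * ψ.val b := by
  by_cases ha0 : a ∈ (Ideal (𝓞 K))⁰
  · by_cases hb0 : b ∈ (Ideal (𝓞 K))⁰
    · have h : (⟨FractionalIdeal.mk0 K ⟨a * b, mul_mem ha0 hb0⟩,
            mk0_mem_idealsPrimeTo ⟨a * b, mul_mem ha0 hb0⟩ (ha.mul_left hb)⟩ :
            idealsPrimeTo K ψ.modulus) =
          ⟨FractionalIdeal.mk0 K ⟨a, ha0⟩, mk0_mem_idealsPrimeTo ⟨a, ha0⟩ ha⟩ *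
          ⟨FractionalIdeal.mk0 K ⟨b, hb0⟩, mk0_mem_idealsPrimeTo ⟨b, hb0⟩ hb⟩ :=
        Subtype.ext ((FractionalIdeal.mk0 (R := 𝓞 K) K).map_mul ⟨a, ha0⟩ ⟨b, hb0⟩)
      rw [val_of_coprime ψ ha0 ha, val_of_coprime ψ hb0 hb,
        val_of_coprime ψ (mul_mem ha0 hb0) (ha.mul_left hb), h, ψ.toHom.map_mul, Units.val_mul]
    · rw [val_of_not_mem _ hb0, mul_zero, val_of_not_mem]
      simp only [mem_nonZeroDivisors_iff_ne_zero, not_not] at hb0 ⊢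
      rw [hb0, mul_zero]
  · rw [val_of_not_mem _ ha0, zero_mul, val_of_not_mem]
    simp only [mem_nonZeroDivisors_iff_ne_zero, not_not] at ha0 ⊢
    rw [ha0, zero_mul]

theorem val_pow (ψ : HeckeCharacter K l) {a : Ideal (𝓞 K)} (ha : IsCoprime a ψ.modulus) (n : ℕ) :
    ψ.val (a ^ n) = ψ.val a ^ n := by
  induction n with
  | zero => rw [pow_zero, pow_zero, Ideal.one_eq_top, val_top]
  | succ n ih => rw [pow_succ, val_mul ψ ha.pow_left ha, ih, pow_succ]

theorem val_ne_zero (ψ : HeckeCharacter K l) {a : Ideal (𝓞 K)} (h0 : a ≠ ⊥)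
    (ha : IsCoprime a ψ.modulus) : ψ.val a ≠ 0 := by
  rw [val_of_coprime ψ (mem_nonZeroDivisors_of_ne_zero h0) ha]
  exact Units.ne_zero _

theorem val_of_not_coprime (ψ : HeckeCharacter K l) {a : Ideal (𝓞 K)}
    (h : ¬ IsCoprime a ψ.modulus) : ψ.val a = 0 := by
  rw [val, dif_neg (fun h' => h h'.2)]

/-- An element which is congruent to an element prime to `m` is prime to `m`. -/
theorem isCoprime_span_of_sub_mem {m : Ideal (𝓞 K)} {b c : 𝓞 K}
    (hc : IsCoprime (Ideal.span {c}) m) (h : b - c ∈ m) : IsCoprime (Ideal.span {b}) m := by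
  rw [Ideal.isCoprime_iff_exists] at hc ⊢
  obtain ⟨u, hu, v, hv, huv⟩ := hc
  obtain ⟨w, rfl⟩ := Ideal.mem_span_singleton.mp hu
  exact ⟨b * w, Ideal.mem_span_singleton.mpr ⟨w, rfl⟩, v - (b - c) * w,
    m.sub_mem hv (m.mul_mem_right _ h), by linear_combination huv⟩

/-- This is the ∞-type condition for b/c with denominators cleared, so that only integral ideals
appear. -/
theorem val_span_mul (ψ : HeckeCharacter K l) {b c : 𝓞 K} (hb : b ≠ 0) (hc : c ≠ 0)
    (hcop : IsCoprime (Ideal.span {c}) ψ.modulus) (h : b - c ∈ ψ.modulus) :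
    ψ.val (Ideal.span {b}) * (algebraMap K ℂ c) ^ l =
      ψ.val (Ideal.span {c}) * (algebraMap K ℂ b) ^ l := by
  have hbcop := isCoprime_span_of_sub_mem hcop h
  have hb' : (b : K) ≠ 0 := by simpa using hb
  have hc' : (c : K) ≠ 0 := by simpa using hc
  have hb0 : Ideal.span {b} ∈ (Ideal (𝓞 K))⁰ :=
    mem_nonZeroDivisors_of_ne_zero (by simpa using hb)
  have hc0 : Ideal.span {c} ∈ (Ideal (𝓞 K))⁰ :=
    mem_nonZeroDivisors_of_ne_zero (by simpa using hc)
  let α : Kˣ := Units.mk0 (b : K) hb' / Units.mk0 (c : K) hc'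
  have hα : MulCongrOne ψ.modulus α := by
    refine ⟨b, c, hc, hcop, h, ?_⟩
    simp only [α, Units.val_div_eq_div_val, Units.val_mk0]
    field_simp
  let I : idealsPrimeTo K ψ.modulus :=
    ⟨FractionalIdeal.mk0 K ⟨_, hb0⟩, mk0_mem_idealsPrimeTo ⟨_, hb0⟩ hbcop⟩ /
    ⟨FractionalIdeal.mk0 K ⟨_, hc0⟩, mk0_mem_idealsPrimeTo ⟨_, hc0⟩ hcop⟩
  have hI : (I : (FractionalIdeal (𝓞 K)⁰ K)ˣ) = toPrincipalIdeal (𝓞 K) K α := by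
    simp only [I, α, map_div, Subgroup.coe_div]
    congr 1
    · apply Units.ext; simp
    · apply Units.ext; simp
  have key := ψ.map_principal I α hI hα
  rw [map_div, Units.val_div_eq_div_val, ← val_of_coprime ψ hb0 hbcop,
    ← val_of_coprime ψ hc0 hcop] at key
  have hcC : algebraMap K ℂ c ≠ 0 := by simpa using hc'
  have hv := val_ne_zero ψ (a := Ideal.span {c}) (by simpa using hc) hcop
  simp only [α, Units.val_div_eq_div_val, Units.val_mk0, map_div₀, div_pow] at key
  field_simp at key
  linear_combination key

theorem val_span_of_sub_one_mem (ψ : HeckeCharacter K l) {b : 𝓞 K} (hb : b ≠ 0)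
    (h : b - 1 ∈ ψ.modulus) : ψ.val (Ideal.span {b}) = (algebraMap K ℂ b) ^ l := by
  have h1 : Ideal.span {(1 : 𝓞 K)} = ⊤ := Ideal.span_singleton_one
  have hcop : IsCoprime (Ideal.span {(1 : 𝓞 K)}) ψ.modulus := by
    rw [h1, ← Ideal.one_eq_top]; exact isCoprime_one_left
  have := val_span_mul ψ hb one_ne_zero hcop h
  rw [h1, val_top] at this
  simpa using this

end General

end HeckeCharacter

/-! ### Rational coefficients force values in K and e_K ∣ l -/

namespace IsImagQuad

variable {K : Type*} [Field K] [NumberField K] [Algebra K ℂ] [IsImagQuad K] {l : ℕ}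

theorem isUnit_mk_of_isCoprime {m : Ideal (𝓞 K)} {y : 𝓞 K} (h : IsCoprime (Ideal.span {y}) m) :
    IsUnit (Ideal.Quotient.mk m y) := by
  rw [Ideal.isCoprime_iff_exists] at h
  obtain ⟨u, hu, v, hv, huv⟩ := h
  obtain ⟨w, rfl⟩ := Ideal.mem_span_singleton.mp hu
  apply IsUnit.of_mul_eq_one (Ideal.Quotient.mk m w)
  rw [← map_mul, ← map_one (Ideal.Quotient.mk m), Ideal.Quotient.eq]
  have : y * w - 1 = -v := by linear_combination huv
  rw [this]
  exact m.neg_mem hv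

/-- The ray class group is torsion. -/
theorem exists_pow_eq_span_sub_one_mem {m a : Ideal (𝓞 K)} (hm : m ≠ ⊥) (ha : IsCoprime a m) :
    ∃ n : ℕ, n ≠ 0 ∧ ∃ x : 𝓞 K, a ^ n = Ideal.span {x} ∧ x - 1 ∈ m := by
  obtain ⟨h, hh, y, hy⟩ := exists_pow_eq_span a
  have hcop : IsCoprime (Ideal.span {y}) m := hy ▸ ha.pow_left
  have : Finite (𝓞 K ⧸ m) := Ideal.finiteQuotientOfFreeOfNeBot m hm
  obtain ⟨u, hu⟩ := isUnit_mk_of_isCoprime hcop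
  refine ⟨h * orderOf u, mul_ne_zero hh (orderOf_pos u).ne', y ^ orderOf u, ?_, ?_⟩
  · rw [pow_mul, hy, Ideal.span_singleton_pow]
  · rw [← Ideal.Quotient.eq, map_pow, ← hu, ← Units.val_pow_eq_pow_val, pow_orderOf_eq_one,
      Units.val_one, map_one]

/-- The prime `P` divides `I * conjI I = P * conjI P`, hence `I` or its conjugate, and a divisor of
the same nonzero norm is the whole ideal. -/
theorem eq_or_eq_conjI_of_absNorm_eq {P I : Ideal (𝓞 K)} (hP : Prime P)
    (h : Ideal.absNorm I = Ideal.absNorm P) : I = P ∨ I = conjI P := by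
  have key : ∀ I : Ideal (𝓞 K), Ideal.absNorm I = Ideal.absNorm P → P ∣ I → I = P := by
    rintro I h ⟨J, rfl⟩
    have hN : Ideal.absNorm P ≠ 0 := by
      rw [Ne, Ideal.absNorm_eq_zero_iff]; exact hP.ne_zero
    rw [map_mul, Nat.mul_eq_left hN, Ideal.absNorm_eq_one_iff] at h
    rw [h, ← Ideal.one_eq_top, mul_one]
  have h1 : P ∣ I * conjI I := by
    rw [mul_conjI, h, ← mul_conjI]; exact dvd_mul_right _ _
  rcases hP.dvd_or_dvd h1 with h2 | h2
  · exact Or.inl (key I h h2)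
  · right
    rw [← key _ ((absNorm_conjI I).trans h) h2, conjI_conjI]

theorem prime_conjI {P : Ideal (𝓞 K)} (hP : Prime P) : Prime (conjI P) :=
  Ideal.prime_of_isPrime (conjI_ne_bot hP.ne_zero) (isPrime_conjI (Ideal.isPrime_of_prime hP))

theorem eq_of_absNorm_eq_sq {P I : Ideal (𝓞 K)} (hP : Prime P)
    (h : Ideal.absNorm I = Ideal.absNorm P ^ 2) :
    I = P ^ 2 ∨ I = P * conjI P ∨ I = conjI P ^ 2 := by
  have key : ∀ P I : Ideal (𝓞 K), Prime P → Ideal.absNorm I = Ideal.absNorm P ^ 2 → P ∣ I →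
      I = P ^ 2 ∨ I = P * conjI P := by
    rintro P I hP h ⟨J, rfl⟩
    have hN : Ideal.absNorm P ≠ 0 := by
      rw [Ne, Ideal.absNorm_eq_zero_iff]; exact hP.ne_zero
    rw [map_mul, sq, mul_right_inj' hN] at h
    rcases eq_or_eq_conjI_of_absNorm_eq hP h with rfl | rfl
    · exact Or.inl (sq _).symm
    · exact Or.inr rfl
  have h1 : P ∣ I * conjI I := by
    rw [mul_conjI, h, Nat.cast_pow, ← Ideal.span_singleton_pow, ← mul_conjI]
    exact dvd_pow (dvd_mul_right _ _) two_ne_zero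
  rcases hP.dvd_or_dvd h1 with h2 | h2
  · rcases key P I hP h h2 with h3 | h3
    · exact Or.inl h3
    · exact Or.inr (Or.inl h3)
  · rcases key P (conjI I) hP ((absNorm_conjI I).trans h) h2 with h3 | h3
    · right; right
      rw [← conjI_pow, ← h3, conjI_conjI]
    · right; left
      rw [← conjI_conjI I, h3, conjI_mul, conjI_conjI, mul_comm]

theorem coeff_absNorm_of_conjI_eq (ψ : HeckeCharacter K l) {P : Ideal (𝓞 K)} (hP : Prime P)
    (h : conjI P = P) : ψ.coeff (Ideal.absNorm P) = ψ.val P := by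
  have : ∀ a : Ideal (𝓞 K), Ideal.absNorm a = Ideal.absNorm P ↔ a ∈ ({P} : Set (Ideal (𝓞 K))) := by
    intro a
    refine ⟨fun ha => ?_, fun ha => congrArg _ ha⟩
    have := eq_or_eq_conjI_of_absNorm_eq hP ha
    rwa [h, or_self] at this
  unfold HeckeCharacter.coeff
  simp only [this]
  exact finsum_mem_singleton

theorem coeff_absNorm (ψ : HeckeCharacter K l) {P : Ideal (𝓞 K)} (hP : Prime P)
    (h : conjI P ≠ P) : ψ.coeff (Ideal.absNorm P) = ψ.val P + ψ.val (conjI P) := by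
  have : ∀ a : Ideal (𝓞 K), Ideal.absNorm a = Ideal.absNorm P ↔
      a ∈ ({P, conjI P} : Set (Ideal (𝓞 K))) := by
    intro a
    refine ⟨fun ha => eq_or_eq_conjI_of_absNorm_eq hP ha, ?_⟩
    rintro (rfl | rfl)
    · rfl
    · exact absNorm_conjI P
  unfold HeckeCharacter.coeff
  simp only [this]
  exact finsum_mem_pair h.symm

theorem coeff_absNorm_sq (ψ : HeckeCharacter K l) {P : Ideal (𝓞 K)} (hP : Prime P)
    (h : conjI P ≠ P) : ψ.coeff (Ideal.absNorm P ^ 2) =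
      ψ.val (P ^ 2) + (ψ.val (P * conjI P) + ψ.val (conjI P ^ 2)) := by
  have : ∀ a : Ideal (𝓞 K), Ideal.absNorm a = Ideal.absNorm P ^ 2 ↔
      a ∈ ({P ^ 2, P * conjI P, conjI P ^ 2} : Set (Ideal (𝓞 K))) := by
    intro a
    refine ⟨fun ha => eq_of_absNorm_eq_sq hP ha, ?_⟩
    rintro (rfl | rfl | rfl)
    · rw [map_pow]
    · rw [map_mul, absNorm_conjI, sq]
    · rw [map_pow, absNorm_conjI]
  unfold HeckeCharacter.coeff
  simp only [this]
  have h0 := hP.ne_zero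
  have h1 : conjI P ≠ 0 := (prime_conjI hP).ne_zero
  have h2 : P * conjI P ≠ conjI P ^ 2 := by
    rw [sq, Ne, mul_left_inj' h1]; exact h.symm
  have h3 : P ^ 2 ∉ ({P * conjI P, conjI P ^ 2} : Set (Ideal (𝓞 K))) := by
    rintro (h3 | h3)
    · rw [sq, mul_right_inj' h0] at h3; exact h h3.symm
    · exact h (ideal_pow_injective two_ne_zero h3).symm
  rw [finsum_mem_insert _ h3 (Set.toFinite _), finsum_mem_pair h2]

/-- Powers of `z` are reduced modulo X² - sX + q, of which `z` is a root. -/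
theorem exists_linear_pow {z w : ℂ} {s q : ℚ} (hs : z + w = s) (hq : z * w = q) (n : ℕ) :
    ∃ A B : ℚ, z ^ n = A * z + B := by
  induction n with
  | zero => exact ⟨0, 1, by simp⟩
  | succ n ih =>
    obtain ⟨A, B, h⟩ := ih
    refine ⟨A * s + B, -(A * q), ?_⟩
    push_cast
    rw [pow_succ, h, ← hs, ← hq]
    ring

/-- The values of a character with rational coefficients at primes. -/
theorem exists_generator_of_prime (ψ : HeckeCharacter K l) (hψ : ψ.HasRationalCoefficients)
    (hl : l ≠ 0) {P : Ideal (𝓞 K)} (hP : Prime P) (hcop : IsCoprime P ψ.modulus)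
    (hcop' : IsCoprime (conjI P) ψ.modulus) :
    ∃ β : 𝓞 K, Ideal.span {β} = P ^ l ∧ ψ.val P = algebraMap K ℂ β ∧
      ψ.val (conjI P) = algebraMap K ℂ (conjO K β) := by
  obtain ⟨n, hn, α, hα, hα1⟩ := exists_pow_eq_span_sub_one_mem ψ.modulus_ne_bot hcop
  have hα0 : α ≠ 0 := by
    rintro rfl
    rw [Ideal.span_singleton_zero, ← Ideal.zero_eq_bot, pow_eq_zero_iff hn] at hα
    exact hP.ne_zero hα
  have hz : ψ.val P ^ n = algebraMap K ℂ ((α : K) ^ l) := by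
    rw [← HeckeCharacter.val_pow ψ hcop, hα, HeckeCharacter.val_span_of_sub_one_mem ψ hα0 hα1, map_pow]
  have hN : 1 ≤ Ideal.absNorm P := by
    rw [Nat.one_le_iff_ne_zero, Ne, Ideal.absNorm_eq_zero_iff]; exact hP.ne_zero
  -- it suffices to find the value in `K`
  have main : ∀ ζ : K, ψ.val P = algebraMap K ℂ ζ → ∃ β : 𝓞 K, (β : K) = ζ ∧ Ideal.span {β} = P ^ l := by
    intro ζ hζ
    have h1 : ζ ^ n = (α : K) ^ l := by
      apply (algebraMap K ℂ).injective
      rw [map_pow, ← hζ, hz]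
    have hi : IsIntegral ℤ ζ := by
      apply IsIntegral.of_pow (Nat.pos_of_ne_zero hn)
      rw [h1]
      exact α.isIntegral_coe.pow l
    obtain ⟨β, rfl⟩ : ∃ β : 𝓞 K, (β : K) = ζ := ⟨⟨ζ, hi⟩, rfl⟩
    refine ⟨β, rfl, ?_⟩
    apply ideal_pow_injective hn
    rw [Ideal.span_singleton_pow, ← pow_mul, mul_comm, pow_mul, hα, Ideal.span_singleton_pow]
    rw [RingOfIntegers.ext (x := β ^ n) (y := α ^ l) (by simpa using h1)]
  -- If `P` is its own conjugate, it is the only ideal of its norm, and its value is itself a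
  -- rational Fourier coefficient.
  by_cases h : conjI P = P
  · obtain ⟨q, hq⟩ := hψ _ hN
    rw [coeff_absNorm_of_conjI_eq ψ hP h] at hq
    have hq' : ψ.val P = algebraMap K ℂ (q : K) := by rw [hq, map_ratCast]
    obtain ⟨β, hβ, hβs⟩ := main q hq'
    refine ⟨β, hβs, by rw [hβ, hq'], ?_⟩
    rw [h, coe_conjO, hβ, hq', map_ratCast (conj K)]
  · obtain ⟨s, hs⟩ := hψ _ hN
    obtain ⟨r, hr⟩ := hψ _ (Nat.one_le_pow 2 _ hN)
    rw [coeff_absNorm ψ hP h] at hs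
    rw [coeff_absNorm_sq ψ hP h, HeckeCharacter.val_pow ψ hcop, HeckeCharacter.val_pow ψ hcop',
      HeckeCharacter.val_mul ψ hcop hcop'] at hr
    -- Here s = z + w and r = z² + zw + w² for the two values z, w, so s² - r = zw.
    have hq : ψ.val P * ψ.val (conjI P) = ((s ^ 2 - r : ℚ) : ℂ) := by
      push_cast
      rw [← hs, ← hr]
      ring
    obtain ⟨A, B, hAB⟩ := exists_linear_pow hs hq n
    -- A conjugation invariant α^l would make P^(nl) equal to its conjugate. So the coefficient `A`
    -- in α^l = A ψ(P) + B is nonzero, and the relation can be solved for ψ(P) inside K.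
    have hirr : conj K ((α : K) ^ l) ≠ (α : K) ^ l := by
      intro h1
      apply h
      have h2 : conjO K (α ^ l) = α ^ l := RingOfIntegers.ext (by
        rw [coe_conjO]; simpa using h1)
      apply ideal_pow_injective (mul_ne_zero hn hl)
      rw [← conjI_pow, pow_mul, hα, Ideal.span_singleton_pow, conjI_span, h2]
    have hA : A ≠ 0 := by
      rintro rfl
      apply hirr
      apply (algebraMap K ℂ).injective
      rw [algebraMap_conj, ← hz, hAB]
      simp
    have hζ : ψ.val P = algebraMap K ℂ (((α : K) ^ l - B) / A) := by
      have hA' : (A : ℂ) ≠ 0 := by exact_mod_cast hA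
      rw [map_div₀, map_sub, ← hz, hAB, map_ratCast, map_ratCast]
      field_simp
      ring
    obtain ⟨β, hβ, hβs⟩ := main _ hζ
    rw [← hβ] at hζ
    refine ⟨β, hβs, hζ, ?_⟩
    rw [coe_conjO, algebraMap_conj, ← hζ]
    -- The complex conjugate of ψ(P) is a root of the same rational quadratic, and it is not ψ(P)
    -- itself by `hirr`.
    have hroot : (starRingEnd ℂ (ψ.val P) - ψ.val P) *
        (starRingEnd ℂ (ψ.val P) - ψ.val (conjI P)) = 0 := by
      have e1 : starRingEnd ℂ (ψ.val P) + starRingEnd ℂ (ψ.val (conjI P)) = s := by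
        rw [← map_add, hs, map_ratCast]
      have e2 : starRingEnd ℂ (ψ.val P) * starRingEnd ℂ (ψ.val (conjI P)) = ((s ^ 2 - r : ℚ) : ℂ) := by
        rw [← map_mul, hq, map_ratCast]
      linear_combination (-starRingEnd ℂ (ψ.val P)) * hs + hq + starRingEnd ℂ (ψ.val P) * e1 - e2
    rcases mul_eq_zero.mp hroot with h1 | h1
    · exfalso
      apply hirr
      apply (algebraMap K ℂ).injective
      rw [algebraMap_conj, ← hz, map_pow, sub_eq_zero.mp h1]
    · exact (sub_eq_zero.mp h1).symm

theorem exists_generator (ψ : HeckeCharacter K l) (hψ : ψ.HasRationalCoefficients)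
    (hl : l ≠ 0) (a : Ideal (𝓞 K)) (ha : a ≠ ⊥) (hcop : IsCoprime a ψ.modulus)
    (hcop' : IsCoprime (conjI a) ψ.modulus) :
    ∃ β : 𝓞 K, Ideal.span {β} = a ^ l ∧ ψ.val a = algebraMap K ℂ β ∧
      ψ.val (conjI a) = algebraMap K ℂ (conjO K β) := by
  induction a using UniqueFactorizationMonoid.induction_on_prime with
  | h₁ => exact absurd rfl ha
  | h₂ a h =>
    obtain rfl := Ideal.isUnit_iff.mp h
    exact ⟨1, by simp [← Ideal.one_eq_top], by simp [HeckeCharacter.val_top],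
      by simp [conjI_top, HeckeCharacter.val_top]⟩
  | h₃ a P ha0 hP ih =>
    rw [conjI_mul] at hcop'
    obtain ⟨β, h1, h2, h3⟩ := ih ha0 hcop.of_mul_left_right hcop'.of_mul_left_right
    obtain ⟨γ, k1, k2, k3⟩ := exists_generator_of_prime ψ hψ hl hP hcop.of_mul_left_left
      hcop'.of_mul_left_left
    refine ⟨γ * β, ?_, ?_, ?_⟩
    · rw [← Ideal.span_singleton_mul_span_singleton, h1, k1, mul_pow]
    · rw [HeckeCharacter.val_mul ψ hcop.of_mul_left_left hcop.of_mul_left_right, h2, k2]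
      simp
    · rw [conjI_mul, HeckeCharacter.val_mul ψ hcop'.of_mul_left_left hcop'.of_mul_left_right, h3, k3]
      simp

/-- The class exponent divides the `∞`-type of a character with rational coefficients. -/
theorem exponent_dvd (ψ : HeckeCharacter K l) (hψ : ψ.HasRationalCoefficients) (hl : l ≠ 0) :
    Monoid.exponent (ClassGroup (𝓞 K)) ∣ l := by
  rw [Monoid.exponent_dvd_iff_forall_pow_eq_one]
  intro c
  obtain ⟨a, ha, rfl⟩ := exists_isCoprime_mk0_eq
    (mul_ne_zero ψ.modulus_ne_bot (conjI_ne_bot ψ.modulus_ne_bot)) c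
  have h2 := isCoprime_conjI ha.of_mul_right_right
  rw [conjI_conjI] at h2
  obtain ⟨β, h, -⟩ := exists_generator ψ hψ hl a (nonZeroDivisors.coe_ne_zero a)
    ha.of_mul_right_left h2
  rw [← map_pow, ClassGroup.mk0_eq_one_iff]
  exact ⟨β, h.symm⟩

end IsImagQuad

/-! ### Ideal norms as norms of elements congruent to 1 -/

namespace IsImagQuad

variable {K : Type*} [Field K] [NumberField K] [Algebra K ℂ] [IsImagQuad K] {l : ℕ}

-- For integral `y` not fixed by conjugation, δ = y - ȳ is negated by conjugation, so δ² = -N(δ). No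
-- squarefreeness of `d` is claimed.
variable (K) in
theorem exists_sq_eq_neg : ∃ (d : ℕ) (δ : 𝓞 K), 0 < d ∧ δ ^ 2 = -(d : 𝓞 K) := by
  obtain ⟨x, hx⟩ := not_real (K := K)
  obtain ⟨n, hn, hx'⟩ := IsAlgebraic.exists_integral_multiple (R := ℤ) (z := x)
    ((IsFractionRing.isAlgebraic_iff ℤ ℚ K).mpr (Algebra.IsAlgebraic.isAlgebraic x))
  obtain ⟨y, hy⟩ : ∃ y : 𝓞 K, (y : K) = n • x := ⟨⟨n • x, hx'⟩, rfl⟩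
  have hδ : y - conjO K y ≠ 0 := by
    intro h
    rw [sub_eq_zero] at h
    have h1 : conj K (n • x) = n • x := by rw [← hy, ← coe_conjO, ← h]
    rw [map_zsmul, smul_right_inj hn] at h1
    have h2 := algebraMap_conj x
    rw [h1, eq_comm, Complex.conj_eq_iff_im] at h2
    exact hx h2
  refine ⟨Ideal.absNorm (Ideal.span {y - conjO K y}), y - conjO K y, ?_, ?_⟩
  · rw [Nat.pos_iff_ne_zero, Ne, Ideal.absNorm_eq_zero_iff, Ideal.span_singleton_eq_bot]
    exact hδ
  · rw [← mul_conjO, map_sub, conjO_conjO]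
    ring

theorem conjO_eq_neg {d : ℕ} {δ : 𝓞 K} (hd : 0 < d) (hδ : δ ^ 2 = -(d : 𝓞 K)) : conjO K δ = -δ := by
  apply RingOfIntegers.ext
  rw [coe_conjO]
  have h : (δ : K) ^ 2 = -((d : ℚ) : K) := by
    have := congrArg (algebraMap (𝓞 K) K) hδ
    simpa using this
  rw [conj_eq_neg_of_sq (by exact_mod_cast hd) h]
  simp

theorem absNorm_span_add_mul {d : ℕ} {δ : 𝓞 K} (hd : 0 < d) (hδ : δ ^ 2 = -(d : 𝓞 K)) (x y : ℤ) :
    (Ideal.absNorm (Ideal.span {(x : 𝓞 K) + (y : 𝓞 K) * δ}) : ℤ) = x ^ 2 + (d : ℤ) * y ^ 2 := by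
  have h := mul_conjO ((x : 𝓞 K) + (y : 𝓞 K) * δ)
  rw [map_add, map_mul, map_intCast, map_intCast, conjO_eq_neg hd hδ] at h
  have h2 : ((Ideal.absNorm (Ideal.span {(x : 𝓞 K) + (y : 𝓞 K) * δ}) : ℤ) : 𝓞 K) =
      ((x ^ 2 + d * y ^ 2 : ℤ) : 𝓞 K) := by
    push_cast
    rw [← h]
    linear_combination (-(y : 𝓞 K) ^ 2) * hδ
  exact_mod_cast h2

/-- This is the count for the pigeonhole argument: the box has more points than the `n * d` classes.
-/
theorem lt_sqrt_mul (n d : ℕ) :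
    n * d < (Nat.sqrt (n * d) + 1) * ((Nat.sqrt n + 1) * (Nat.sqrt d + 1)) := by
  have h1 := Nat.lt_succ_sqrt (n * d)
  have h2 := Nat.lt_succ_sqrt n
  have h3 := Nat.lt_succ_sqrt d
  apply lt_of_pow_lt_pow_left₀ 2 (Nat.zero_le _)
  calc (n * d) ^ 2 = (n * d) * (n * d) := sq _
    _ < ((Nat.sqrt (n * d)).succ * (Nat.sqrt (n * d)).succ) *
        (((Nat.sqrt n).succ * (Nat.sqrt n).succ) * ((Nat.sqrt d).succ * (Nat.sqrt d).succ)) :=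
        Nat.mul_lt_mul'' h1 (Nat.mul_lt_mul'' h2 h3)
    _ = _ := by simp only [Nat.succ_eq_add_one]; ring

theorem sq_sub_le_of_le_sqrt {m : ℕ} {a b : ℕ} (ha : a < Nat.sqrt m + 1) (hb : b < Nat.sqrt m + 1) :
    ((a : ℤ) - b) ^ 2 ≤ m := by
  have h1 : ((Nat.sqrt m : ℕ) : ℤ) * (Nat.sqrt m : ℕ) ≤ m := by exact_mod_cast Nat.sqrt_le m
  have h2 : |(a : ℤ) - b| ≤ |((Nat.sqrt m : ℕ) : ℤ)| := by
    rw [abs_le, abs_of_nonneg (by positivity)]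
    constructor <;> omega
  have := sq_le_sq.mpr h2
  linarith

/-- An ideal norm which is `1` modulo `d` is the norm of an element of `K`, which has a
denominator of norm at most `2 d`. -/
theorem exists_norm_eq_absNorm_mul {d : ℕ} {δ : 𝓞 K} (hd : 0 < d) (hδ : δ ^ 2 = -(d : 𝓞 K))
    (hsq : ¬ IsSquare d) {a : Ideal (𝓞 K)} (ha : a ≠ ⊥)
    (h : (d : ℤ) ∣ (Ideal.absNorm a : ℤ) - 1) :
    ∃ α ζ : 𝓞 K, ζ ≠ 0 ∧ α * conjO K α = (Ideal.absNorm a : 𝓞 K) * (ζ * conjO K ζ) ∧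
      Ideal.absNorm (Ideal.span {ζ}) ≤ 2 * d := by
  classical
  set n := Ideal.absNorm a with hn
  have hn0 : 0 < n := by
    rw [Nat.pos_iff_ne_zero, hn, Ne, Ideal.absNorm_eq_zero_iff]; exact ha
  by_cases hns : IsSquare n
  -- A square norm is the norm of an integer. Below, `n` and `d` are both nonsquares, which makes
  -- the bounds on y² and z² strict.
  · obtain ⟨s, hs⟩ := hns
    refine ⟨s, 1, one_ne_zero, by rw [hs]; simp, ?_⟩
    rw [Ideal.span_singleton_one, Ideal.absNorm_top]
    omega
  have : Finite (𝓞 K ⧸ a) := Ideal.finiteQuotientOfFreeOfNeBot a ha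
  have : NeZero d := ⟨hd.ne'⟩
  have : Fintype (𝓞 K ⧸ a) := Fintype.ofFinite _
  -- For a difference (x, y, z) of two points with the same image, the first component gives n ∣ x²
  -- + dy² and the second x ≡ z mod d. As n ≡ 1 mod d, the product nd divides x² + dy² - nz².
  let f : ℕ × ℕ × ℕ → (𝓞 K ⧸ a) × ZMod d := fun p =>
    (Ideal.Quotient.mk a ((p.1 : 𝓞 K) + p.2.1 * δ), (p.1 : ZMod d) - p.2.2)
  have hcard : (Finset.univ : Finset ((𝓞 K ⧸ a) × ZMod d)).card <
      (Finset.range (Nat.sqrt (n * d) + 1) ×ˢ (Finset.range (Nat.sqrt n + 1) ×ˢ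
        Finset.range (Nat.sqrt d + 1))).card := by
    rw [Finset.card_univ, Fintype.card_prod, ZMod.card, ← Nat.card_eq_fintype_card,
      ← Submodule.cardQuot_apply, ← Ideal.absNorm_apply, ← hn, Finset.card_product,
      Finset.card_product, Finset.card_range, Finset.card_range, Finset.card_range]
    exact lt_sqrt_mul n d
  obtain ⟨⟨x₁, y₁, z₁⟩, h1, ⟨x₂, y₂, z₂⟩, h2, hne, heq⟩ :=
    Finset.exists_ne_map_eq_of_card_lt_of_maps_to hcard (f := f) (fun p _ => Finset.mem_univ _)
  simp only [Finset.mem_product, Finset.mem_range] at h1 h2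
  have hx := sq_sub_le_of_le_sqrt h1.1 h2.1
  have hy := sq_sub_le_of_le_sqrt h1.2.1 h2.2.1
  have hz := sq_sub_le_of_le_sqrt h1.2.2 h2.2.2
  simp only [f, Prod.mk.injEq] at heq
  obtain ⟨heq1, heq2⟩ := heq
  have hne' : ¬ ((x₁ : ℤ) - x₂ = 0 ∧ (y₁ : ℤ) - y₂ = 0 ∧ (z₁ : ℤ) - z₂ = 0) := by
    rintro ⟨e1, e2, e3⟩
    apply hne
    simp only [Prod.mk.injEq]
    omega
  rw [Ideal.Quotient.eq] at heq1
  have hξ : (((x₁ : ℤ) - x₂ : ℤ) : 𝓞 K) + (((y₁ : ℤ) - y₂ : ℤ) : 𝓞 K) * δ ∈ a := by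
    convert heq1 using 1
    push_cast
    ring
  have hxz : (d : ℤ) ∣ ((x₁ : ℤ) - x₂) - ((z₁ : ℤ) - z₂) := by
    rw [← ZMod.intCast_zmod_eq_zero_iff_dvd]
    push_cast
    linear_combination heq2
  clear heq1 heq2 hne h1 h2
  generalize (x₁ : ℤ) - x₂ = x at *
  generalize (y₁ : ℤ) - y₂ = y at *
  generalize (z₁ : ℤ) - z₂ = z at *
  have hN := absNorm_span_add_mul hd hδ x y
  have hdvd1 : (n : ℤ) ∣ x ^ 2 + d * y ^ 2 - n * z ^ 2 := by
    apply dvd_sub _ (dvd_mul_right _ _)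
    rw [← hN]
    exact_mod_cast Ideal.absNorm_dvd_absNorm_of_le ((Ideal.span_singleton_le_iff_mem a).mpr hξ)
  have hdvd2 : (d : ℤ) ∣ x ^ 2 + d * y ^ 2 - n * z ^ 2 := by
    obtain ⟨u, hu⟩ := h
    obtain ⟨v, hv⟩ := hxz
    refine ⟨v * (x + z) + y ^ 2 - u * z ^ 2, ?_⟩
    linear_combination (x + z) * hv - z ^ 2 * hu
  have hcop : IsCoprime (n : ℤ) d := by
    obtain ⟨u, hu⟩ := h
    exact ⟨1, -u, by linear_combination hu⟩
  obtain ⟨k, hk⟩ := hcop.mul_dvd hdvd1 hdvd2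
  have hy' : y ^ 2 < n := by
    apply lt_of_le_of_ne hy
    intro e
    apply hns
    refine ⟨y.natAbs, ?_⟩
    zify
    rw [abs_mul_abs_self, ← e, sq]
  have hz' : z ^ 2 < d := by
    apply lt_of_le_of_ne hz
    intro e
    apply hsq
    refine ⟨z.natAbs, ?_⟩
    zify
    rw [abs_mul_abs_self, ← e, sq]
  have hnz : (0 : ℤ) < n := by exact_mod_cast hn0
  have hdz : (0 : ℤ) < d := by exact_mod_cast hd
  have hnd : (0 : ℤ) < n * d := mul_pos hnz hdz
  push_cast at hx
  -- The sizes give -nd < x² + dy² - nz² < 2nd, so this multiple of nd is 0 or nd. Accordingly N(x +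
  -- yδ) is n times N(z) = z² or n times N(z + δ) = z² + d.
  have hk1 : k < 2 := by
    have : (n : ℤ) * d * k < n * d * 2 := by
      rw [← hk]
      nlinarith [mul_lt_mul_of_pos_left hy' hdz, mul_nonneg hnz.le (sq_nonneg z)]
    exact lt_of_mul_lt_mul_left this hnd.le
  have hk2 : -1 < k := by
    have : (n : ℤ) * d * (-1) < n * d * k := by
      rw [← hk]
      nlinarith [mul_lt_mul_of_pos_left hz' hnz, mul_nonneg hdz.le (sq_nonneg y), sq_nonneg x]
    exact lt_of_mul_lt_mul_left this hnd.le
  obtain rfl | rfl : k = 0 ∨ k = 1 := by omega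
  · have hz0 : z ≠ 0 := by
      rintro rfl
      apply hne'
      have hy0 : y ^ 2 = 0 := by nlinarith [sq_nonneg x, sq_nonneg y]
      have hx0 : x ^ 2 = 0 := by nlinarith [sq_nonneg x, sq_nonneg y]
      exact ⟨pow_eq_zero_iff two_ne_zero |>.mp hx0, pow_eq_zero_iff two_ne_zero |>.mp hy0, rfl⟩
    have hN2 := absNorm_span_add_mul hd hδ z 0
    rw [Int.cast_zero, zero_mul, add_zero] at hN2
    refine ⟨x + y * δ, z, by exact_mod_cast hz0, ?_, ?_⟩
    · rw [mul_conjO, mul_conjO]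
      have : (Ideal.absNorm (Ideal.span {(x : 𝓞 K) + (y : 𝓞 K) * δ}) : ℤ) =
          n * (Ideal.absNorm (Ideal.span {(z : 𝓞 K)}) : ℤ) := by
        rw [hN, hN2]; linear_combination hk
      exact_mod_cast this
    · zify; rw [hN2]; linarith
  · have hN2 := absNorm_span_add_mul hd hδ z 1
    rw [Int.cast_one, one_mul] at hN2
    refine ⟨x + y * δ, z + δ, ?_, ?_, ?_⟩
    · intro e
      rw [e, Ideal.span_singleton_zero, Ideal.absNorm_bot] at hN2
      push_cast at hN2
      nlinarith [sq_nonneg z]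
    · rw [mul_conjO, mul_conjO]
      have : (Ideal.absNorm (Ideal.span {(x : 𝓞 K) + (y : 𝓞 K) * δ}) : ℤ) =
          n * (Ideal.absNorm (Ideal.span {(z : 𝓞 K) + δ}) : ℤ) := by
        rw [hN, hN2]; linear_combination hk
      exact_mod_cast this
    · zify; rw [hN2]; linarith

/-- If `Y` is not too divisible by the primes over `M`, then `M ^ s` is a multiple of `Y` modulo
`M ^ (s + 1)`. -/
theorem pow_mem_span_sup {M Y : 𝓞 K} (hM : M ≠ 0) {s : ℕ}
    (hY : ∀ P : Ideal (𝓞 K), Prime P → P ∣ Ideal.span {M} → Y ∉ P ^ (s + 1)) :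
    ∃ w v : 𝓞 K, M ^ s = Y * w + M ^ (s + 1) * v := by
  have hM' : Ideal.span {M} ≠ ⊥ := by simpa using hM
  -- Multiplicities are compared prime by prime: at a prime over `M` the sum has multiplicity at
  -- most `s` by `hY`, and at any other prime it has multiplicity 0 because it divides a power of
  -- `M`.
  have key : Ideal.span {Y} ⊔ Ideal.span {M} ^ (s + 1) ∣ Ideal.span {M} ^ s := by
    have hJ : Ideal.span {Y} ⊔ Ideal.span {M} ^ (s + 1) ∣ Ideal.span {M} ^ (s + 1) := by
      rw [Ideal.dvd_iff_le]; exact le_sup_right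
    have hJ0 : Ideal.span {Y} ⊔ Ideal.span {M} ^ (s + 1) ≠ 0 :=
      ne_zero_of_dvd_ne_zero (pow_ne_zero _ hM') hJ
    rw [UniqueFactorizationMonoid.dvd_iff_emultiplicity_le hJ0]
    intro P hP
    by_cases hPM : P ∣ Ideal.span {M}
    · have h1 : (s : ℕ∞) ≤ emultiplicity P (Ideal.span {M} ^ s) :=
        le_emultiplicity_of_pow_dvd (pow_dvd_pow_of_dvd hPM s)
      have h2 : emultiplicity P (Ideal.span {Y} ⊔ Ideal.span {M} ^ (s + 1)) < (s + 1 : ℕ) := by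
        rw [emultiplicity_lt_iff_not_dvd]
        intro h
        apply hY P hP hPM
        rw [Ideal.dvd_iff_le] at h
        exact h (le_sup_left (a := Ideal.span {Y}) (Ideal.mem_span_singleton_self Y))
      refine le_trans ?_ h1
      rw [Nat.cast_add, Nat.cast_one] at h2
      exact Order.le_of_lt_add_one h2
    · rw [emultiplicity_eq_zero.mpr (fun h => hPM (hP.dvd_of_dvd_pow (h.trans hJ)))]
      exact zero_le
  rw [Ideal.dvd_iff_le, Ideal.span_singleton_pow, Ideal.span_singleton_pow,
    Ideal.span_singleton_le_iff_mem, Submodule.mem_sup] at key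
  obtain ⟨y, hy, z, hz, h⟩ := key
  obtain ⟨w, rfl⟩ := Ideal.mem_span_singleton.mp hy
  obtain ⟨v, rfl⟩ := Ideal.mem_span_singleton.mp hz
  exact ⟨w, v, h.symm⟩

/-- An ideal norm which is `1` modulo a suitable integer is the norm of an element congruent to `1`
modulo a given integer. -/
theorem exists_modulus_norm {d : ℕ} {δ : 𝓞 K} (hd : 0 < d) (hδ : δ ^ 2 = -(d : 𝓞 K))
    (hsq : ¬ IsSquare d) {M : ℕ} (hM : 2 ≤ M) :
    ∃ N : ℕ, N ≠ 0 ∧ M ∣ N ∧ ∀ a : Ideal (𝓞 K), a ≠ ⊥ → (N : ℤ) ∣ (Ideal.absNorm a : ℤ) - 1 →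
      ∃ b c : 𝓞 K, c ≠ 0 ∧ IsCoprime (Ideal.span {c}) (Ideal.span {(M : 𝓞 K)}) ∧
        b - c ∈ Ideal.span {(M : 𝓞 K)} ∧
        b * conjO K b = (Ideal.absNorm a : 𝓞 K) * (c * conjO K c) := by
  classical
  have hM0 : (M : 𝓞 K) ≠ 0 := by
    have : M ≠ 0 := by omega
    exact_mod_cast this
  have hMs : Ideal.span {(M : 𝓞 K)} ≠ ⊥ := by simpa using hM0
  set S := (UniqueFactorizationMonoid.normalizedFactors (Ideal.span {(M : 𝓞 K)})).toFinset
  set r := S.card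
  -- This bounds N(2(k - k')) N(δ) N(ζ) for 0 ≤ k, k' ≤ r, where N(ζ) ≤ 2d.
  set s := (2 * r) ^ 2 * d * (2 * d) with hs
  refine ⟨M ^ (s + 1) * d, by positivity, Dvd.dvd.mul_right (dvd_pow_self M s.succ_ne_zero) _, ?_⟩
  intro a ha hN
  obtain ⟨α, ζ, hζ, hα, hbound⟩ := exists_norm_eq_absNorm_mul hd hδ hsq ha
    ((dvd_mul_left (d : ℤ) ((M : ℤ) ^ (s + 1))).trans (by push_cast at hN; exact hN))
  set n := Ideal.absNorm a
  obtain ⟨f, hf⟩ : ∃ f : 𝓞 K, (n : 𝓞 K) - 1 = (M : 𝓞 K) ^ (s + 1) * f := by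
    obtain ⟨g, hg⟩ := hN
    refine ⟨d * g, ?_⟩
    have := congrArg (Int.cast : ℤ → 𝓞 K) hg
    push_cast at this
    rw [this]; ring
  -- Put x = (α/ζ)(k - δ)/(k + δ), which has norm n, so that Y k = ζ(k + δ)(1 + x). The quotient b/c
  -- below is (n + x)/(1 + x) = x(1 + x̄)/(1 + x), again of norm n. It differs from 1 by (n - 1)/(1
  -- + x), which stays divisible by M if Y k is not too divisible by the primes over M.
  let Y : ℕ → 𝓞 K := fun k => ζ * (k + δ) + α * (k - δ)
  obtain ⟨k, hk⟩ : ∃ k : ℕ, ∀ P : Ideal (𝓞 K), Prime P → P ∣ Ideal.span {(M : 𝓞 K)} →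
      Y k ∉ P ^ (s + 1) := by
    by_contra! hno
    choose P hP hPM hPY using hno
    obtain ⟨k, hk, k', hk', hne, heq⟩ := Finset.exists_ne_map_eq_of_card_lt_of_maps_to
      (s := Finset.range (r + 1)) (t := S) (f := P) (by rw [Finset.card_range]; omega) (by
        intro k _
        simp only [S, Finset.mem_coe, Multiset.mem_toFinset]
        exact (UniqueFactorizationMonoid.mem_normalizedFactors_iff hMs).mpr ⟨hP k, hPM k⟩)
    have h1 := hPY k
    have h2 := hPY k'
    rw [← heq] at h2
    -- If every k ≤ r failed, two of them would share a prime. Eliminating α leaves a nonzero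
    -- element of P^(s+1) of norm at most s, whereas P^(s+1) has norm at least 2^(s+1).
    have h3 : ((((k : ℤ) - k') * 2 : ℤ) : 𝓞 K) * (δ * ζ) ∈ P k ^ (s + 1) := by
      have : ((((k : ℤ) - k') * 2 : ℤ) : 𝓞 K) * (δ * ζ) = (δ - k') * Y k + (k - δ) * Y k' := by
        simp only [Y]
        push_cast
        ring
      rw [this]
      exact add_mem (Ideal.mul_mem_left _ _ h1) (Ideal.mul_mem_left _ _ h2)
    obtain ⟨j, hj⟩ : ∃ j : ℤ, j = ((k : ℤ) - k') * 2 := ⟨_, rfl⟩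
    rw [← hj] at h3
    rw [Finset.mem_range] at hk hk'
    rw [← Ideal.span_singleton_le_iff_mem] at h3
    have h4 := Ideal.absNorm_dvd_absNorm_of_le h3
    rw [← Ideal.span_singleton_mul_span_singleton, ← Ideal.span_singleton_mul_span_singleton, map_mul,
      map_mul, map_pow] at h4
    have e1 := absNorm_span_add_mul hd hδ j 0
    have e2 := absNorm_span_add_mul hd hδ 0 1
    rw [Int.cast_zero, zero_mul, add_zero] at e1
    rw [Int.cast_zero, Int.cast_one, zero_add, one_mul] at e2
    have e2' : Ideal.absNorm (Ideal.span {δ}) = d := by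
      zify; rw [e2]; ring
    have e1' : Ideal.absNorm (Ideal.span {(j : 𝓞 K)}) ≤ (2 * r) ^ 2 := by
      zify; rw [e1]
      have : |j| ≤ |2 * (r : ℤ)| := by
        rw [abs_of_nonneg (a := 2 * (r : ℤ)) (by omega), abs_le]
        constructor <;> omega
      have := sq_le_sq.mpr this
      linarith
    have e1'' : Ideal.absNorm (Ideal.span {(j : 𝓞 K)}) ≠ 0 := by
      zify; rw [e1]
      have : j ≠ 0 := by omega
      have := pow_ne_zero 2 this
      simpa using this
    have e3 : Ideal.absNorm (Ideal.span {ζ}) ≠ 0 := by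
      rw [Ne, Ideal.absNorm_eq_zero_iff, Ideal.span_singleton_eq_bot]; exact hζ
    rw [e2'] at h4
    have h5 := Nat.le_of_dvd (Nat.pos_of_ne_zero (mul_ne_zero e1'' (mul_ne_zero hd.ne' e3))) h4
    have h6 : Ideal.absNorm (Ideal.span {(j : 𝓞 K)}) *
        (d * Ideal.absNorm (Ideal.span {ζ})) ≤ s := by
      rw [hs, mul_assoc]
      exact Nat.mul_le_mul e1' (Nat.mul_le_mul le_rfl hbound)
    have h7 : 2 ≤ Ideal.absNorm (P k) := by
      have g0 : Ideal.absNorm (P k) ≠ 0 := by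
        rw [Ne, Ideal.absNorm_eq_zero_iff]; exact (hP k).ne_zero
      have g1 : Ideal.absNorm (P k) ≠ 1 := by
        rw [Ne, Ideal.absNorm_eq_one_iff]
        exact (Ideal.isPrime_of_prime (hP k)).ne_top
      omega
    have h8 := Nat.pow_le_pow_left h7 (s + 1)
    have h9 := Nat.lt_two_pow_self (n := s + 1)
    omega
  obtain ⟨w, v, hwv⟩ := pow_mem_span_sup hM0 hk
  have hMpow : (M : 𝓞 K) ^ s ≠ 0 := pow_ne_zero _ hM0
  have hc : (M : 𝓞 K) ^ s * (1 - M * v) = Y k * w := by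
    linear_combination hwv
  have hcop : IsCoprime (Ideal.span {(1 - M * v : 𝓞 K)}) (Ideal.span {(M : 𝓞 K)}) := by
    rw [Ideal.isCoprime_iff_exists]
    exact ⟨_, Ideal.mem_span_singleton_self _, M * v, Ideal.mul_mem_right _ _
      (Ideal.mem_span_singleton_self _), by ring⟩
  refine ⟨1 - M * v + M * (f * ζ * (k + δ) * w), 1 - M * v, ?_, hcop, ?_, ?_⟩
  · intro h
    rw [h, Ideal.span_singleton_zero, Ideal.isCoprime_iff_sup_eq, bot_sup_eq] at hcop
    have := congrArg Ideal.absNorm hcop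
    rw [Ideal.absNorm_span_natCast, Ideal.absNorm_top, RingOfIntegers.rank, finrank_eq_two] at this
    nlinarith
  · rw [add_sub_cancel_left]
    exact Ideal.mul_mem_right _ _ (Ideal.mem_span_singleton_self _)
  · have hb : (M : 𝓞 K) ^ s * (1 - M * v + M * (f * ζ * (k + δ) * w)) =
        w * (α * (k - δ) + n * ζ * (k + δ)) := by
      have : (M : 𝓞 K) ^ s * (M * (f * ζ * (k + δ) * w)) = (n - 1) * (ζ * (k + δ) * w) := by
        rw [hf]; ring
      rw [mul_add, hc, this]
      simp only [Y]
      ring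
    generalize 1 - M * v + M * (f * ζ * (k + δ) * w) = b at *
    generalize (1 - M * v : 𝓞 K) = c at *
    have hb' := congrArg (conjO K) hb
    have hc' := congrArg (conjO K) hc
    simp only [Y, map_mul, map_pow, map_natCast, map_add, map_sub, conjO_eq_neg hd hδ] at hb' hc'
    have hζ' : conjO K ζ ≠ 0 := by simpa using hζ
    have hne : ζ * conjO K ζ * ((M : 𝓞 K) ^ s * (M : 𝓞 K) ^ s) ≠ 0 := by
      refine mul_ne_zero (mul_ne_zero hζ hζ') (mul_ne_zero hMpow hMpow)
    apply mul_left_cancel₀ hne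
    simp only [Y] at hc
    have e1 : ζ * conjO K ζ * ((M : 𝓞 K) ^ s * (M : 𝓞 K) ^ s) * (b * conjO K b) =
        ζ * conjO K ζ * ((M : 𝓞 K) ^ s * b) * ((M : 𝓞 K) ^ s * conjO K b) := by ring
    have e2 : ζ * conjO K ζ * ((M : 𝓞 K) ^ s * (M : 𝓞 K) ^ s) * (n * (c * conjO K c)) =
        n * (ζ * conjO K ζ) * ((M : 𝓞 K) ^ s * c) * ((M : 𝓞 K) ^ s * conjO K c) := by ring
    rw [e1, e2, hb, hb', hc, hc']
    linear_combination (w * conjO K w * ((ζ * (k + δ) + α * (k - δ)) *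
      (conjO K ζ * (k - δ) + conjO K α * (k + δ)) - α * (conjO K ζ * (k - δ) + conjO K α * (k + δ)) *
      (k - δ) - conjO K α * (ζ * (k + δ) + α * (k - δ)) * (k + δ) -
      (k + δ) * (k - δ) * (n * (ζ * conjO K ζ) - α * conjO K α))) * hα

/-- Ideals of the same norm are conjugate up to a common factor. -/
theorem exists_mul_conjI_of_absNorm_eq {A B : Ideal (𝓞 K)} (hA : A ≠ ⊥)
    (h : Ideal.absNorm A = Ideal.absNorm B) : ∃ g C, A = g * C ∧ B = g * conjI C := by
  have hg : A ⊔ B ≠ ⊥ := fun h => hA (sup_eq_bot_iff.mp h).1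
  -- With the gcd removed, the cofactors are coprime of equal norm. So A' divides B' times its
  -- conjugate, hence the conjugate, and equal norms give equality.
  obtain ⟨A', hA'⟩ : A ⊔ B ∣ A := Ideal.dvd_iff_le.mpr le_sup_left
  obtain ⟨B', hB'⟩ : A ⊔ B ∣ B := Ideal.dvd_iff_le.mpr le_sup_right
  have hsup : (A ⊔ B) * (A' ⊔ B') = (A ⊔ B) * 1 := by
    rw [Ideal.mul_sup, ← hA', ← hB', mul_one]
  have hcop : IsCoprime A' B' := by
    rw [Ideal.isCoprime_iff_sup_eq, ← Ideal.one_eq_top]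
    exact mul_left_cancel₀ hg hsup
  clear hsup
  generalize A ⊔ B = g at *
  subst hA' hB'
  have hA0 : Ideal.absNorm A' ≠ 0 := by
    rw [Ne, Ideal.absNorm_eq_zero_iff]
    rintro rfl
    exact hA (Ideal.mul_bot g)
  have hg0 : Ideal.absNorm g ≠ 0 := by
    rw [Ne, Ideal.absNorm_eq_zero_iff]; exact hg
  rw [map_mul, map_mul, mul_right_inj' hg0] at h
  have h1 : A' ∣ B' * conjI B' := by
    rw [mul_conjI, ← h, ← mul_conjI]; exact dvd_mul_right _ _
  obtain ⟨E, hE⟩ := hcop.dvd_of_dvd_mul_left h1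
  have h2 := congrArg Ideal.absNorm hE
  rw [absNorm_conjI, map_mul, ← h, eq_comm, Nat.mul_eq_left hA0, Ideal.absNorm_eq_one_iff] at h2
  rw [h2, ← Ideal.one_eq_top, mul_one] at hE
  exact ⟨g, A', rfl, by rw [← hE, conjI_conjI]⟩

end IsImagQuad

/-! ### Quotients of characters and descent along a homomorphism -/

theorem idealsPrimeTo_mono {K : Type*} [Field K] [NumberField K] {m m' : Ideal (𝓞 K)} (h : m ≤ m') :
    idealsPrimeTo K m ≤ idealsPrimeTo K m' := by
  rintro _ ⟨a, b, ha, hb, rfl⟩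
  exact ⟨a, b, ha.of_isCoprime_of_dvd_right (Ideal.dvd_iff_le.mpr h),
    hb.of_isCoprime_of_dvd_right (Ideal.dvd_iff_le.mpr h), rfl⟩

theorem MulCongrOne.mono {K : Type*} [Field K] [NumberField K] {m m' : Ideal (𝓞 K)} (h : m ≤ m')
    {α : Kˣ} (hα : MulCongrOne m α) : MulCongrOne m' α := by
  obtain ⟨b, c, hc, hcop, hbc, e⟩ := hα
  exact ⟨b, c, hc, hcop.of_isCoprime_of_dvd_right (Ideal.dvd_iff_le.mpr h), h hbc, e⟩

/-- A character of a monoid which is trivial on the kernel of a homomorphism to a finite abelian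
group is the restriction of a character of that group. -/
theorem exists_hom_comp_eq {A G : Type*} [CommMonoid A] [CommGroup G] [Finite G] (ν : A →* G)
    (ρ : A →* ℂˣ) (h : ∀ a, ν a = 1 → ρ a = 1) : ∃ φ : G →* ℂˣ, ∀ a, φ (ν a) = ρ a := by
  have hcard : Nat.card G ≠ 0 := Nat.card_pos.ne'
  obtain ⟨k, hk⟩ := Nat.exists_eq_succ_of_ne_zero hcard
  have hpow : ∀ x : G, x ^ k * x = 1 := fun x => by
    rw [← pow_succ, ← Nat.succ_eq_add_one, ← hk, pow_card_eq_one']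
  have heq : ∀ a b, ν a = ν b → ρ a = ρ b := by
    intro a b hab
    have h1 := h (b ^ k * a) (by rw [map_mul, map_pow, hab, hpow])
    have h2 := h (b ^ k * b) (by rw [map_mul, map_pow, hpow])
    rw [map_mul] at h1 h2
    exact mul_left_cancel (h1.trans h2.symm)
  -- In a finite group inverses are powers, so the image of a monoid is a subgroup. The character
  -- induced on it extends to all of `G`.
  let S : Subgroup G :=
    { MonoidHom.mrange ν with
      inv_mem' := by
        rintro _ ⟨a, rfl⟩
        exact ⟨a ^ k, by rw [map_pow]; exact eq_inv_of_mul_eq_one_left (hpow _)⟩ }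
  have hS : ∀ x : S, ∃ a, ν a = x := fun x => x.2
  choose s hs using hS
  let φ₀ : S →* ℂˣ := MonoidHom.mk' (fun x => ρ (s x)) (by
    intro x y
    rw [← map_mul]
    apply heq
    rw [map_mul, hs, hs, hs, Subgroup.coe_mul])
  obtain ⟨φ, hφ⟩ := MonoidHom.domRestrict_surjective ℂ S φ₀
  refine ⟨φ, fun a => ?_⟩
  have h1 : φ (ν a) = φ₀ ⟨ν a, a, rfl⟩ := by rw [← hφ]; rfl
  rw [h1]
  exact heq _ _ (hs _)

namespace HeckeCharacter

variable {K : Type*} [Field K] [NumberField K] [Algebra K ℂ] {l : ℕ}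

/-- The quotient of two characters with the same `∞`-type as a homomorphism on the ideals which are
prime to a common multiple of the moduli. -/
noncomputable def ratioHom (ψ ψ' : HeckeCharacter K l) {M : Ideal (𝓞 K)}
    (h : M ≤ ψ.modulus) (h' : M ≤ ψ'.modulus) : idealsPrimeTo K M →* ℂˣ :=
  ψ'.toHom.comp (Subgroup.inclusion (idealsPrimeTo_mono h')) *
    (ψ.toHom.comp (Subgroup.inclusion (idealsPrimeTo_mono h)))⁻¹

theorem ratioHom_apply (ψ ψ' : HeckeCharacter K l) {M : Ideal (𝓞 K)}
    (h : M ≤ ψ.modulus) (h' : M ≤ ψ'.modulus) (I : idealsPrimeTo K M) :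
    ratioHom ψ ψ' h h' I = ψ'.toHom ⟨I.1, idealsPrimeTo_mono h' I.2⟩ *
      (ψ.toHom ⟨I.1, idealsPrimeTo_mono h I.2⟩)⁻¹ := rfl

/-- The quotient of two characters with the same `∞`-type, as a ray class character. -/
noncomputable def ratio (ψ ψ' : HeckeCharacter K l) (M : Ideal (𝓞 K)) (hM : M ≠ ⊥)
    (h : M ≤ ψ.modulus) (h' : M ≤ ψ'.modulus) : HeckeCharacter K 0 where
  modulus := M
  modulus_ne_bot := hM
  toHom := ratioHom ψ ψ' h h'
  map_principal := by
    intro I α hI hα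
    have h1 := ψ.map_principal ⟨I.1, idealsPrimeTo_mono h I.2⟩ α hI (hα.mono h)
    have h2 := ψ'.map_principal ⟨I.1, idealsPrimeTo_mono h' I.2⟩ α hI (hα.mono h')
    have h3 := Units.ext (h1.trans h2.symm)
    rw [pow_zero, ratioHom_apply, h3, mul_inv_cancel, Units.val_one]

theorem val_ratio (ψ ψ' : HeckeCharacter K l) (M : Ideal (𝓞 K)) (hM : M ≠ ⊥)
    (h : M ≤ ψ.modulus) (h' : M ≤ ψ'.modulus) {a : Ideal (𝓞 K)} (ha : IsCoprime a M) :
    (ratio ψ ψ' M hM h h').val a = ψ'.val a / ψ.val a := by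
  by_cases h0 : a ∈ (Ideal (𝓞 K))⁰
  · rw [val_of_coprime (ratio ψ ψ' M hM h h') h0 ha,
      val_of_coprime ψ h0 (ha.of_isCoprime_of_dvd_right (Ideal.dvd_iff_le.mpr h)),
      val_of_coprime ψ' h0 (ha.of_isCoprime_of_dvd_right (Ideal.dvd_iff_le.mpr h')),
      div_eq_mul_inv, ← Units.val_inv_eq_inv_val, ← Units.val_mul]
    exact congrArg Units.val (ratioHom_apply ψ ψ' h h' _)
  · rw [val_of_not_mem _ h0, val_of_not_mem _ h0, val_of_not_mem _ h0, div_zero]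

theorem pow_eq_one_of_val_pow_eq_one (ω : HeckeCharacter K l) {n : ℕ}
    (h : ∀ a : Ideal (𝓞 K), a ≠ ⊥ → IsCoprime a ω.modulus → ω.val a ^ n = 1)
    (I : idealsPrimeTo K ω.modulus) : ω.toHom I ^ n = 1 := by
  obtain ⟨_, a, b, ha, hb, rfl⟩ := I
  have h1 : (⟨FractionalIdeal.mk0 K a / FractionalIdeal.mk0 K b, ⟨a, b, ha, hb, rfl⟩⟩ :
      idealsPrimeTo K ω.modulus) = ⟨FractionalIdeal.mk0 K a, mk0_mem_idealsPrimeTo a ha⟩ /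
        ⟨FractionalIdeal.mk0 K b, mk0_mem_idealsPrimeTo b hb⟩ := rfl
  rw [h1, map_div, div_pow]
  have ha' := h a (nonZeroDivisors.coe_ne_zero a) ha
  have hb' := h b (nonZeroDivisors.coe_ne_zero b) hb
  rw [val_of_coprime ω a.2 ha, ← Units.val_pow_eq_pow_val, Units.val_eq_one] at ha'
  rw [val_of_coprime ω b.2 hb, ← Units.val_pow_eq_pow_val, Units.val_eq_one] at hb'
  exact (congrArg₂ (· / ·) ha' hb').trans (div_one 1)

end HeckeCharacter

/-! ### Uniqueness up to twisting -/

namespace IsImagQuad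

variable {K : Type*} [Field K] [NumberField K] [Algebra K ℂ] [IsImagQuad K] {l : ℕ}

-- K cannot contain both √-1 and √-3, as 3 is not a rational square; so the order of the tests in
-- `extraTwistOrder` does not matter. The unit -1 is killed because 4 and 6 are even.
open Classical in
theorem unit_pow_extraTwistOrder (h : (∃ x : K, x ^ 2 = -1) ∨ ∃ x : K, x ^ 2 = -3) (u : (𝓞 K)ˣ) :
    u ^ HeckeCharacter.extraTwistOrder K = 1 := by
  have hno : (∃ x : K, x ^ 2 = -1) → ¬ ∃ x : K, x ^ 2 = -3 := by
    rintro ⟨x, hx⟩ ⟨y, hy⟩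
    obtain ⟨s, hs⟩ := rat_mul_sq (q := 1) (r := 3) one_pos three_pos (by simpa using hx)
      (by simpa using hy)
    have : IsSquare (3 : ℚ) := ⟨s, by rw [← sq, hs]; norm_num⟩
    exact absurd this (by norm_num)
  unfold HeckeCharacter.extraTwistOrder
  rcases eq_one_or_neg_one_or u with rfl | rfl | ⟨h1, h2⟩ | ⟨h1, h2⟩
  · exact one_pow _
  · split_ifs with h3 h4
    · exact Even.neg_one_pow (by decide)
    · exact Even.neg_one_pow (by decide)
    · exact absurd h (not_or.mpr ⟨h3, h4⟩)
  · rw [if_pos h2, h1]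
  · rw [if_neg (fun h3 => hno h3 h2), if_pos h2, h1]

theorem unit_sq_eq_one (h1 : ¬ ∃ x : K, x ^ 2 = -1) (h3 : ¬ ∃ x : K, x ^ 2 = -3) (u : (𝓞 K)ˣ) :
    u = 1 ∨ u = -1 := by
  rcases eq_one_or_neg_one_or u with h | h | ⟨-, h⟩ | ⟨-, h⟩
  · exact Or.inl h
  · exact Or.inr h
  · exact absurd h h1
  · exact absurd h h3

variable (K) in
theorem exists_sq_eq_neg_not_isSquare (h1 : ¬ ∃ x : K, x ^ 2 = -1) :
    ∃ (d : ℕ) (δ : 𝓞 K), 0 < d ∧ δ ^ 2 = -(d : 𝓞 K) ∧ ¬ IsSquare d := by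
  obtain ⟨d, δ, hd, hδ⟩ := exists_sq_eq_neg K
  refine ⟨d, δ, hd, hδ, ?_⟩
  rintro ⟨s, rfl⟩
  apply h1
  have hs : (s : K) ≠ 0 := by
    rintro hs
    simp only [Nat.cast_eq_zero] at hs
    simp [hs] at hd
  refine ⟨(δ : K) / s, ?_⟩
  have : (δ : K) ^ 2 = -((s : K) * s) := by
    simpa using congrArg (algebraMap (𝓞 K) K) hδ
  rw [div_pow, this]
  field_simp

/-- Two characters with rational coefficients differ by units. -/
theorem exists_unit_mul (ψ ψ' : HeckeCharacter K l) (hψ : ψ.HasRationalCoefficients)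
    (hψ' : ψ'.HasRationalCoefficients) (hl : l ≠ 0) {M : ℕ}
    (h : Ideal.span {(M : 𝓞 K)} ≤ ψ.modulus) (h' : Ideal.span {(M : 𝓞 K)} ≤ ψ'.modulus)
    {a : Ideal (𝓞 K)} (ha : a ≠ ⊥) (hcop : IsCoprime a (Ideal.span {(M : 𝓞 K)})) :
    ∃ u : (𝓞 K)ˣ, ψ'.val a / ψ.val a = algebraMap K ℂ (u : 𝓞 K) ∧
      ψ'.val (conjI a) / ψ.val (conjI a) = starRingEnd ℂ (algebraMap K ℂ (u : 𝓞 K)) := by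
  have hcop' : IsCoprime (conjI a) (Ideal.span {(M : 𝓞 K)}) := by
    have := isCoprime_conjI hcop
    rwa [conjI_span, map_natCast] at this
  obtain ⟨β, h1, h2, h3⟩ := exists_generator ψ hψ hl a ha
    (hcop.of_isCoprime_of_dvd_right (Ideal.dvd_iff_le.mpr h))
    (hcop'.of_isCoprime_of_dvd_right (Ideal.dvd_iff_le.mpr h))
  obtain ⟨β', k1, k2, k3⟩ := exists_generator ψ' hψ' hl a ha
    (hcop.of_isCoprime_of_dvd_right (Ideal.dvd_iff_le.mpr h'))
    (hcop'.of_isCoprime_of_dvd_right (Ideal.dvd_iff_le.mpr h'))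
  rw [← h1, Ideal.span_singleton_eq_span_singleton] at k1
  obtain ⟨u, hu⟩ := k1.symm
  have hβ : algebraMap K ℂ (β : K) ≠ 0 := by
    rw [← h2]
    exact HeckeCharacter.val_ne_zero ψ ha (hcop.of_isCoprime_of_dvd_right (Ideal.dvd_iff_le.mpr h))
  have hβ' : starRingEnd ℂ (algebraMap K ℂ (β : K)) ≠ 0 := by simpa using hβ
  have hmul : algebraMap K ℂ ((β * (u : 𝓞 K) : 𝓞 K) : K) =
      algebraMap K ℂ (β : K) * algebraMap K ℂ ((u : 𝓞 K) : K) := by simp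
  refine ⟨u, ?_, ?_⟩
  · rw [h2, k2, ← hu, hmul]
    field_simp
  · rw [h3, k3, ← hu, coe_conjO, coe_conjO, algebraMap_conj, algebraMap_conj, hmul, map_mul]
    field_simp

/-- A conjugation invariant ray class character is trivial at the ideals whose norm is the norm of an
element which is `1` modulo its modulus. -/
theorem val_eq_one_of_norm (ω : HeckeCharacter K 0)
    (hconj : ∀ a : Ideal (𝓞 K), a ≠ ⊥ → IsCoprime a ω.modulus → ω.val (conjI a) = ω.val a)
    {a : Ideal (𝓞 K)} (ha : a ≠ ⊥) (hcop : IsCoprime a ω.modulus) {b c : 𝓞 K} (hc : c ≠ 0)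
    (hccop : IsCoprime (Ideal.span {c}) ω.modulus) (hbc : b - c ∈ ω.modulus)
    (hN : b * conjO K b = (Ideal.absNorm a : 𝓞 K) * (c * conjO K c)) : ω.val a = 1 := by
  have hbcop := HeckeCharacter.isCoprime_span_of_sub_mem hccop hbc
  have hcs : Ideal.span {c} ≠ ⊥ := by simpa using hc
  have hN' : Ideal.absNorm (a * Ideal.span {c}) = Ideal.absNorm (Ideal.span {b}) := by
    rw [mul_conjO, mul_conjO] at hN
    rw [map_mul]
    exact_mod_cast hN.symm
  have hb : b ≠ 0 := by
    rintro rfl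
    rw [Ideal.span_singleton_zero, Ideal.absNorm_bot, Ideal.absNorm_eq_zero_iff, Ideal.mul_eq_bot] at hN'
    exact hN'.elim ha hcs
  -- Now a(c) = gC and (b) = gC̄, so invariance under conjugation yields ω(a)ω(c) = ω(b), while b ≡
  -- c yields ω(b) = ω(c).
  obtain ⟨g, C, h1, h2⟩ := exists_mul_conjI_of_absNorm_eq (mul_ne_zero ha hcs) hN'
  have hcop1 : IsCoprime (g * C) ω.modulus := h1 ▸ hcop.mul_left hccop
  have hcop2 : IsCoprime (g * conjI C) ω.modulus := h2 ▸ hbcop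
  have hC : C ≠ ⊥ := by
    rintro rfl
    rw [Ideal.mul_bot] at h1
    exact mul_ne_zero ha hcs h1
  have e1 := HeckeCharacter.val_mul ω hcop hccop
  rw [h1, HeckeCharacter.val_mul ω hcop1.of_mul_left_left hcop1.of_mul_left_right,
    ← hconj C hC hcop1.of_mul_left_right,
    ← HeckeCharacter.val_mul ω hcop2.of_mul_left_left hcop2.of_mul_left_right, ← h2] at e1
  have e2 := HeckeCharacter.val_span_mul ω hb hc hccop hbc
  rw [pow_zero, pow_zero, mul_one, mul_one] at e2
  rw [e2] at e1
  exact (mul_eq_right₀ (HeckeCharacter.val_ne_zero ω hcs hccop)).mp e1.symm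

/-- A conjugation invariant ray class character factors through the norm. -/
theorem exists_dirichletCharacter (h1 : ¬ ∃ x : K, x ^ 2 = -1) (ω : HeckeCharacter K 0) {M : ℕ}
    (hM : 2 ≤ M) (hω : ω.modulus = Ideal.span {(M : 𝓞 K)})
    (hconj : ∀ a : Ideal (𝓞 K), a ≠ ⊥ → IsCoprime a ω.modulus → ω.val (conjI a) = ω.val a) :
    ∃ (N : ℕ) (φ : DirichletCharacter ℂ N), N ≠ 0 ∧ M ∣ N ∧ ∀ a : Ideal (𝓞 K), a ≠ ⊥ →
      IsCoprime a (Ideal.span {(N : 𝓞 K)}) → ω.val a = φ (Ideal.absNorm a : ZMod N) := by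
  obtain ⟨d, δ, hd, hδ, hsq⟩ := exists_sq_eq_neg_not_isSquare K h1
  obtain ⟨N, hN0, hMN, hN⟩ := exists_modulus_norm hd hδ hsq hM
  have : NeZero N := ⟨hN0⟩
  have hle : Ideal.span {(N : 𝓞 K)} ≤ ω.modulus := by
    rw [hω, Ideal.span_singleton_le_span_singleton]
    exact Nat.cast_dvd_cast hMN
  have hcop : ∀ a : Ideal (𝓞 K), IsCoprime a (Ideal.span {(N : 𝓞 K)}) → IsCoprime a ω.modulus :=
    fun a ha => ha.of_isCoprime_of_dvd_right (Ideal.dvd_iff_le.mpr hle)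
  let A : Submonoid (Ideal (𝓞 K)) :=
    { carrier := {a | a ≠ ⊥ ∧ IsCoprime a (Ideal.span {(N : 𝓞 K)})}
      one_mem' := ⟨one_ne_zero, isCoprime_one_left⟩
      mul_mem' := fun ha hb => ⟨mul_ne_zero ha.1 hb.1, ha.2.mul_left hb.2⟩ }
  let ν : A →* (ZMod N)ˣ :=
    { toFun := fun a => (isUnit_absNorm a.2.2).unit
      map_one' := by
        apply Units.ext
        simp
      map_mul' := by
        intro a b
        apply Units.ext
        simp }
  let ρ : A →* ℂˣ :=
    { toFun := fun a => Units.mk0 (ω.val a) (HeckeCharacter.val_ne_zero ω a.2.1 (hcop _ a.2.2))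
      map_one' := by
        apply Units.ext
        simp [Ideal.one_eq_top, HeckeCharacter.val_top]
      map_mul' := by
        intro a b
        apply Units.ext
        simp [HeckeCharacter.val_mul ω (hcop _ a.2.2) (hcop _ b.2.2)] }
  obtain ⟨φ, hφ⟩ := exists_hom_comp_eq ν ρ (by
    intro a ha
    have ha' := congrArg Units.val ha
    apply Units.ext
    change ω.val a = 1
    have hdvd : (N : ℤ) ∣ (Ideal.absNorm (a : Ideal (𝓞 K)) : ℤ) - 1 := by
      rw [← ZMod.intCast_zmod_eq_zero_iff_dvd]
      push_cast
      rw [sub_eq_zero]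
      exact ha'
    obtain ⟨b, c, hc, hccop, hbc, e⟩ := hN a a.2.1 hdvd
    rw [← hω] at hccop hbc
    exact val_eq_one_of_norm ω hconj a.2.1 (hcop _ a.2.2) hc hccop hbc e)
  refine ⟨N, MulChar.ofUnitHom φ, hN0, hMN, ?_⟩
  intro a ha hacop
  have h2 := congrArg Units.val (hφ ⟨a, ha, hacop⟩)
  rw [← (isUnit_absNorm hacop).unit_spec, MulChar.ofUnitHom_coe]
  exact h2.symm

/-- Two characters with rational coefficients and the same `∞`-type are equal up to twisting. -/
theorem isTwist (ψ ψ' : HeckeCharacter K l) (hψ : ψ.HasRationalCoefficients)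
    (hψ' : ψ'.HasRationalCoefficients) (hl : l ≠ 0) : HeckeCharacter.IsTwist ψ ψ' := by
  classical
  -- A rational integer generates a conjugation stable modulus; the factor 2 ensures `2 ≤ M`, as
  -- required by `exists_dirichletCharacter`.
  set M := 2 * Ideal.absNorm (ψ.modulus * ψ'.modulus) with hMdef
  have hM0 : Ideal.absNorm (ψ.modulus * ψ'.modulus) ≠ 0 := by
    rw [Ne, Ideal.absNorm_eq_zero_iff]
    exact mul_ne_zero ψ.modulus_ne_bot ψ'.modulus_ne_bot
  have hM : 2 ≤ M := by omega
  have hMbot : Ideal.span {(M : 𝓞 K)} ≠ ⊥ := by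
    rw [Ne, Ideal.span_singleton_eq_bot]
    have : M ≠ 0 := by omega
    exact_mod_cast this
  have hle : Ideal.span {(M : 𝓞 K)} ≤ ψ.modulus * ψ'.modulus := by
    rw [Ideal.span_singleton_le_iff_mem, hMdef, Nat.cast_mul]
    exact Ideal.mul_mem_left _ _ (Ideal.absNorm_mem _)
  have h := hle.trans Ideal.mul_le_left
  have h' := hle.trans Ideal.mul_le_right
  have hcop {a : Ideal (𝓞 K)} (ha : IsCoprime a (Ideal.span {(M : 𝓞 K)})) : IsCoprime a ψ.modulus :=
    ha.of_isCoprime_of_dvd_right (Ideal.dvd_iff_le.mpr h)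
  set ω := HeckeCharacter.ratio ψ ψ' _ hMbot h h' 
  have hωval {a : Ideal (𝓞 K)} (ha : IsCoprime a (Ideal.span {(M : 𝓞 K)})) :
      ω.val a = ψ'.val a / ψ.val a := HeckeCharacter.val_ratio ψ ψ' _ hMbot h h' ha
  have hmul {a : Ideal (𝓞 K)} (ha0 : a ≠ ⊥) (ha : IsCoprime a (Ideal.span {(M : 𝓞 K)})) :
      ψ'.val a = ψ.val a * ω.val a := by
    rw [hωval ha]
    have := HeckeCharacter.val_ne_zero ψ ha0 (hcop ha)
    field_simp
  have hval_bot (χ : HeckeCharacter K l) : χ.val ⊥ = 0 :=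
    HeckeCharacter.val_of_not_mem _ (by simp)
  by_cases hex : (∃ x : K, x ^ 2 = -1) ∨ ∃ x : K, x ^ 2 = -3
  · refine ⟨1, 1, ω, Ideal.span {(M : 𝓞 K)}, one_ne_zero, ?_, hMbot, ?_⟩
    · apply HeckeCharacter.pow_eq_one_of_val_pow_eq_one
      intro a ha hacop
      obtain ⟨u, hu, -⟩ := exists_unit_mul ψ ψ' hψ hψ' hl h h' ha hacop
      rw [hωval hacop, hu, ← map_pow, ← map_pow, ← Units.val_pow_eq_pow_val,
        unit_pow_extraTwistOrder hex]
      simp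
    · intro a ha
      by_cases ha0 : a = ⊥
      · rw [ha0, hval_bot, hval_bot]; simp
      · rw [hmul ha0 ha, MulChar.one_apply (isUnit_of_subsingleton _), mul_one]
  · rw [not_or] at hex
    obtain ⟨N, φ, hN, hMN, hφ⟩ := exists_dirichletCharacter hex.1 ω hM rfl (by
      intro a ha hacop
      have hcop' : IsCoprime (conjI a) (Ideal.span {(M : 𝓞 K)}) := by
        have := isCoprime_conjI hacop
        change IsCoprime (conjI a) (conjI (Ideal.span {(M : 𝓞 K)})) at this
        rwa [conjI_span, map_natCast] at this
      obtain ⟨u, hu, hu'⟩ := exists_unit_mul ψ ψ' hψ hψ' hl h h' ha hacop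
      rw [hωval hcop', hωval hacop, hu, hu']
      -- The units ±1 are real, so the values at `a` and at its conjugate coincide.
      rcases unit_sq_eq_one hex.1 hex.2 u with rfl | rfl <;> simp)
    have hNbot : Ideal.span {(N : 𝓞 K)} ≠ ⊥ := by
      rw [Ne, Ideal.span_singleton_eq_bot]
      exact_mod_cast hN
    have hNM : Ideal.span {(N : 𝓞 K)} ≤ Ideal.span {(M : 𝓞 K)} := by
      rw [Ideal.span_singleton_le_span_singleton]
      exact Nat.cast_dvd_cast hMN
    refine ⟨N, φ, HeckeCharacter.trivialChar K, Ideal.span {(N : 𝓞 K)}, hN, fun _ => one_pow _,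
      hNbot, ?_⟩
    intro a ha
    by_cases ha0 : a = ⊥
    · rw [ha0, hval_bot, hval_bot]; simp
    · rw [hmul ha0 (ha.of_isCoprime_of_dvd_right (Ideal.dvd_iff_le.mpr hNM)), hφ a ha0 ha,
        HeckeCharacter.val_trivialChar (mem_nonZeroDivisors_of_ne_zero ha0), mul_one]

end IsImagQuad

/-! ### Characters from compatible generators of l-th powers -/

namespace IsImagQuad

variable {K : Type*} [Field K] [NumberField K] [Algebra K ℂ] [IsImagQuad K] {l : ℕ}

/-- A character with values in `K` which commutes with conjugation has rational coefficients. -/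
theorem hasRationalCoefficients_of_conj (ψ : HeckeCharacter K l)
    (h : ∀ a : Ideal (𝓞 K), ∃ κ : K, ψ.val a = algebraMap K ℂ κ ∧
      ψ.val (conjI a) = algebraMap K ℂ (conj K κ)) : ψ.HasRationalCoefficients := by
  intro n _
  choose κ h1 h2 using h
  have h3 : ∀ a, κ (conjI a) = conj K (κ a) := fun a =>
    (algebraMap K ℂ).injective ((h1 _).symm.trans (h2 a))
  have hfin : {a : Ideal (𝓞 K) | Ideal.absNorm a = n}.Finite := Ideal.finite_setOfPred_absNorm_eq n
  have hcoeff : ψ.coeff n = algebraMap K ℂ (∑ᶠ a ∈ {a : Ideal (𝓞 K) | Ideal.absNorm a = n}, κ a) := by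
    change (∑ᶠ a ∈ {a : Ideal (𝓞 K) | Ideal.absNorm a = n}, ψ.val a) = _
    exact (finsum_mem_congr rfl (fun a _ => h1 a)).trans
      ((algebraMap K ℂ : K →+ ℂ).map_finsum_mem κ hfin).symm
  have hconj : conj K (∑ᶠ a ∈ {a : Ideal (𝓞 K) | Ideal.absNorm a = n}, κ a) =
      ∑ᶠ a ∈ {a : Ideal (𝓞 K) | Ideal.absNorm a = n}, κ a := by
    have : conj K (∑ᶠ a ∈ {a : Ideal (𝓞 K) | Ideal.absNorm a = n}, κ a) =
        ∑ᶠ a ∈ {a : Ideal (𝓞 K) | Ideal.absNorm a = n}, conj K (κ a) :=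
      ((conj K : K →+* K) : K →+ K).map_finsum_mem κ hfin
    rw [this]
    -- Conjugation permutes the ideals of norm `n`, so it fixes the sum, which is therefore
    -- rational.
    refine finsum_mem_eq_of_bijOn conjI ⟨?_, conjI_injective.injOn, ?_⟩ (fun a _ => (h3 a).symm)
    · intro a ha
      exact (absNorm_conjI a).trans ha
    · intro a ha
      exact ⟨conjI a, (absNorm_conjI a).trans ha, conjI_conjI a⟩
  obtain ⟨q, hq⟩ := exists_rat_of_conj_eq hconj
  exact ⟨q, by rw [hcoeff, ← hq, map_ratCast]⟩

theorem exists_eq_of_toPrincipalIdeal_eq {β : Kˣ} {a : (Ideal (𝓞 K))⁰}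
    (h : toPrincipalIdeal (𝓞 K) K β = FractionalIdeal.mk0 K a) :
    ∃ b : 𝓞 K, (b : K) = β ∧ Ideal.span {b} = a := by
  have h1 := congrArg Units.val h
  rw [coe_toPrincipalIdeal, FractionalIdeal.coe_mk0] at h1
  have h2 : (β : K) ∈ ((a : Ideal (𝓞 K)) : FractionalIdeal (𝓞 K)⁰ K) := by
    rw [← h1]; exact FractionalIdeal.mem_spanSingleton_self _ _
  obtain ⟨b, -, hb⟩ := (FractionalIdeal.mem_coeIdeal _).mp h2
  refine ⟨b, hb, ?_⟩
  rw [← hb, ← FractionalIdeal.coeIdeal_span_singleton] at h1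
  exact FractionalIdeal.coeIdeal_injective h1

theorem toPrincipalIdeal_eq_mk0 {β : Kˣ} {b : 𝓞 K} {a : (Ideal (𝓞 K))⁰} (hb : (b : K) = β)
    (h : Ideal.span {b} = a) : toPrincipalIdeal (𝓞 K) K β = FractionalIdeal.mk0 K a := by
  apply Units.ext
  rw [coe_toPrincipalIdeal, FractionalIdeal.coe_mk0, ← h, FractionalIdeal.coeIdeal_span_singleton]
  exact congrArg _ hb.symm

theorem exists_unit_of_toPrincipalIdeal_eq_one {β : Kˣ} (h : toPrincipalIdeal (𝓞 K) K β = 1) :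
    ∃ u : (𝓞 K)ˣ, ((u : 𝓞 K) : K) = β := by
  rw [← (FractionalIdeal.mk0 (R := 𝓞 K) K).map_one] at h
  obtain ⟨b, hb, hs⟩ := exists_eq_of_toPrincipalIdeal_eq h
  have : IsUnit b := by
    rw [← Ideal.span_singleton_eq_top, hs]; exact Ideal.one_eq_top
  exact ⟨this.unit, hb⟩

/-- A compatible choice of generators of the `l`-th powers of ideals defines a character with
rational coefficients. -/
theorem exists_character_of_subgroup {M : Ideal (𝓞 K)} (hM : M ≠ ⊥) (hMc : conjI M = M)
    (Γ : Subgroup (idealsPrimeTo K M × Kˣ))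
    (h1 : ∀ I β, (I, β) ∈ Γ → toPrincipalIdeal (𝓞 K) K β = (I : (FractionalIdeal (𝓞 K)⁰ K)ˣ) ^ l)
    (h2 : ∀ I, ∃ β, (I, β) ∈ Γ) (h3 : ∀ β, (1, β) ∈ Γ → β = 1)
    (h4 : ∀ (a : Ideal (𝓞 K)) (I : idealsPrimeTo K M) (β : Kˣ), IsCoprime a M →
      (β : K) = Ideal.absNorm a → (I : (FractionalIdeal (𝓞 K)⁰ K)ˣ) = toPrincipalIdeal (𝓞 K) K β →
      (I, β ^ l) ∈ Γ)
    (h5 : ∀ (I : idealsPrimeTo K M) (α : Kˣ),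
      (I : (FractionalIdeal (𝓞 K)⁰ K)ˣ) = toPrincipalIdeal (𝓞 K) K α → MulCongrOne M α →
      (I, α ^ l) ∈ Γ) :
    ∃ ψ : HeckeCharacter K l, ψ.HasRationalCoefficients := by
  -- By `h2` and `h3`, `Γ` is the graph of a homomorphism, the character sought.
  choose β hβ using h2
  have huniq : ∀ I γ, (I, γ) ∈ Γ → β I = γ := by
    intro I γ h
    have h6 : (1, β I * γ⁻¹) ∈ Γ := by
      have := Γ.mul_mem (hβ I) (Γ.inv_mem h)
      rwa [Prod.inv_mk, Prod.mk_mul_mk, mul_inv_cancel] at this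
    exact mul_inv_eq_one.mp (h3 _ h6)
  let f : idealsPrimeTo K M →* Kˣ := MonoidHom.mk' β (fun I J =>
    huniq _ _ (Γ.mul_mem (hβ I) (hβ J)))
  let g : idealsPrimeTo K M →* ℂˣ := (Units.map (algebraMap K ℂ).toMonoidHom).comp f
  have hg : ∀ I, (g I : ℂ) = algebraMap K ℂ (β I) := fun I => rfl
  let ψ : HeckeCharacter K l :=
    { modulus := M
      modulus_ne_bot := hM
      toHom := g
      map_principal := by
        intro I α hI hα
        rw [hg, huniq _ _ (h5 I α hI hα), Units.val_pow_eq_pow_val, map_pow] }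
  refine ⟨ψ, hasRationalCoefficients_of_conj ψ ?_⟩
  intro a
  by_cases hcop : IsCoprime a M
  · by_cases h0 : a = ⊥
    · refine ⟨0, ?_, ?_⟩
      · rw [map_zero, h0]; exact HeckeCharacter.val_of_not_mem _ (by simp)
      · rw [map_zero, map_zero, h0, conjI_bot]; exact HeckeCharacter.val_of_not_mem _ (by simp)
    have hcop' : IsCoprime (conjI a) M := by
      have := isCoprime_conjI hcop
      rwa [hMc] at this
    have ha : a ∈ (Ideal (𝓞 K))⁰ := mem_nonZeroDivisors_of_ne_zero h0
    have ha' : conjI a ∈ (Ideal (𝓞 K))⁰ := mem_nonZeroDivisors_of_ne_zero (conjI_ne_bot h0)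
    have e1 : ψ.val a = algebraMap K ℂ
        (β ⟨FractionalIdeal.mk0 K ⟨a, ha⟩, mk0_mem_idealsPrimeTo ⟨a, ha⟩ hcop⟩) :=
      HeckeCharacter.val_of_coprime ψ ha hcop
    have e2 : ψ.val (conjI a) = algebraMap K ℂ
        (β ⟨FractionalIdeal.mk0 K ⟨conjI a, ha'⟩, mk0_mem_idealsPrimeTo ⟨conjI a, ha'⟩ hcop'⟩) :=
      HeckeCharacter.val_of_coprime ψ ha' hcop'
    refine ⟨_, e1, ?_⟩
    rw [e2]
    have k1 := hβ ⟨FractionalIdeal.mk0 K ⟨a, ha⟩, mk0_mem_idealsPrimeTo ⟨a, ha⟩ hcop⟩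
    generalize β ⟨FractionalIdeal.mk0 K ⟨a, ha⟩, mk0_mem_idealsPrimeTo ⟨a, ha⟩ hcop⟩ = γ at k1
    have k2 := h1 _ _ k1
    have k3 : (FractionalIdeal.mk0 (R := 𝓞 K) K ⟨a, ha⟩) ^ l =
        FractionalIdeal.mk0 K (⟨a, ha⟩ ^ l) := ((FractionalIdeal.mk0 (R := 𝓞 K) K).map_pow _ _).symm
    obtain ⟨b, hb, hbs⟩ := exists_eq_of_toPrincipalIdeal_eq (k2.trans k3)
    have hN0 : (Ideal.absNorm a : K) ≠ 0 := by
      rw [Nat.cast_ne_zero, Ne, Ideal.absNorm_eq_zero_iff]; exact h0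
    -- The chosen γ has norm N(a)^l, which by `h4` is also the value at aā = (N(a)). Dividing by γ,
    -- the value at ā is the conjugate of γ.
    have k4 : (γ : K) * conj K γ = (Ideal.absNorm a : K) ^ l := by
      have := congrArg (algebraMap (𝓞 K) K) (mul_conjO b)
      rw [map_natCast, hbs] at this
      change (b : K) * conj K b = ((Ideal.absNorm (a ^ l) : ℕ) : K) at this
      rw [← hb, this, map_pow, Nat.cast_pow]
    have k5 : ((⟨FractionalIdeal.mk0 K ⟨a, ha⟩, mk0_mem_idealsPrimeTo ⟨a, ha⟩ hcop⟩ *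
        ⟨FractionalIdeal.mk0 K ⟨conjI a, ha'⟩, mk0_mem_idealsPrimeTo ⟨conjI a, ha'⟩ hcop'⟩ :
        idealsPrimeTo K M) : (FractionalIdeal (𝓞 K)⁰ K)ˣ) =
        toPrincipalIdeal (𝓞 K) K (Units.mk0 _ hN0) := by
      have := (FractionalIdeal.mk0 (R := 𝓞 K) K).map_mul ⟨a, ha⟩ ⟨conjI a, ha'⟩
      refine this.symm.trans (toPrincipalIdeal_eq_mk0 (b := (Ideal.absNorm a : 𝓞 K)) ?_ ?_).symm
      · simp
      · exact (mul_conjI a).symm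
    have k6 := h4 a _ _ hcop (Units.val_mk0 hN0) k5
    have k7 := Γ.mul_mem (Γ.inv_mem k1) k6
    rw [Prod.inv_mk, Prod.mk_mul_mk, inv_mul_cancel_left] at k7
    rw [huniq _ _ k7, Units.val_mul, Units.val_inv_eq_inv_val, Units.val_pow_eq_pow_val, Units.val_mk0,
      ← k4, inv_mul_cancel_left₀ γ.ne_zero]
  · have hcop' : ¬ IsCoprime (conjI a) M := by
      intro h
      apply hcop
      have := isCoprime_conjI h
      rwa [hMc, conjI_conjI] at this
    refine ⟨0, ?_, ?_⟩
    · rw [map_zero]; exact HeckeCharacter.val_of_not_coprime _ hcop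
    · rw [map_zero, map_zero]; exact HeckeCharacter.val_of_not_coprime _ hcop'

theorem isCoprime_span_one (M : Ideal (𝓞 K)) : IsCoprime (Ideal.span {(1 : 𝓞 K)}) M := by
  rw [Ideal.span_singleton_one, ← Ideal.one_eq_top]
  exact isCoprime_one_left

theorem isCoprime_span_mul {M : Ideal (𝓞 K)} {x y : 𝓞 K} (hx : IsCoprime (Ideal.span {x}) M)
    (hy : IsCoprime (Ideal.span {y}) M) : IsCoprime (Ideal.span {x * y}) M := by
  rw [← Ideal.span_singleton_mul_span_singleton]
  exact hx.mul_left hy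

theorem mul_sub_mul_mem {M : Ideal (𝓞 K)} {b c b' c' : 𝓞 K} (h : b - c ∈ M) (h' : b' - c' ∈ M) :
    b * b' - c * c' ∈ M := by
  have : b * b' - c * c' = b' * (b - c) + c * (b' - c') := by ring
  rw [this]
  exact add_mem (M.mul_mem_left _ h) (M.mul_mem_left _ h')

/-- The group of elements which are congruent to `1`, multiplicatively. -/
def mulCongrSubgroup (M : Ideal (𝓞 K)) : Subgroup Kˣ where
  carrier := {α | MulCongrOne M α}
  one_mem' := ⟨1, 1, one_ne_zero, isCoprime_span_one M, by simp, by simp⟩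
  mul_mem' := by
    rintro α α' ⟨b, c, hc, hcop, h, e⟩ ⟨b', c', hc', hcop', h', e'⟩
    refine ⟨b * b', c * c', mul_ne_zero hc hc', isCoprime_span_mul hcop hcop', mul_sub_mul_mem h h', ?_⟩
    rw [map_mul, map_mul, ← e, ← e', Units.val_mul]
    ring
  inv_mem' := by
    rintro α ⟨b, c, hc, hcop, h, e⟩
    refine ⟨c, b, ?_, HeckeCharacter.isCoprime_span_of_sub_mem hcop h, ?_, ?_⟩
    · rintro rfl
      rw [map_zero, mul_eq_zero] at e
      exact e.elim α.ne_zero (by simpa using hc)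
    · rw [← neg_sub]; exact M.neg_mem h
    · rw [← e, Units.val_inv_eq_inv_val, inv_mul_cancel_left₀ α.ne_zero]

theorem exists_pow_mk0_eq (hl : l ≠ 0) (hexp : Monoid.exponent (ClassGroup (𝓞 K)) ∣ l)
    (a : (Ideal (𝓞 K))⁰) : ∃ x : 𝓞 K, x ≠ 0 ∧ Ideal.span {x} = (a : Ideal (𝓞 K)) ^ l := by
  obtain ⟨x, hx⟩ := exists_pow_eq_span_of_exponent_dvd hexp (a : Ideal (𝓞 K)) hl
  refine ⟨x, ?_, hx.symm⟩
  rintro rfl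
  rw [Ideal.span_singleton_zero] at hx
  exact pow_ne_zero l (nonZeroDivisors.coe_ne_zero a) hx

theorem toPrincipalIdeal_eq_mk0_pow {a : (Ideal (𝓞 K))⁰} {x : 𝓞 K} {β : Kˣ} (hβ : (x : K) = β)
    (h : Ideal.span {x} = (a : Ideal (𝓞 K)) ^ l) :
    toPrincipalIdeal (𝓞 K) K β = FractionalIdeal.mk0 K a ^ l :=
  (toPrincipalIdeal_eq_mk0 (a := a ^ l) hβ h).trans ((FractionalIdeal.mk0 (R := 𝓞 K) K).map_pow a l)

/-- The pairs of an ideal prime to `M` and a generator of its `l`-th power. -/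
noncomputable def generatorPairs (M : Ideal (𝓞 K)) (l : ℕ) : Subgroup (idealsPrimeTo K M × Kˣ) where
  carrier := {x | toPrincipalIdeal (𝓞 K) K x.2 = (x.1 : (FractionalIdeal (𝓞 K)⁰ K)ˣ) ^ l}
  one_mem' := (map_one (toPrincipalIdeal (𝓞 K) K)).trans (one_pow l).symm
  mul_mem' := by
    intro x y hx hy
    exact ((map_mul (toPrincipalIdeal (𝓞 K) K) x.2 y.2).trans (congrArg₂ (· * ·) hx hy)).trans
      (mul_pow _ _ l).symm
  inv_mem' := by
    intro x hx
    exact ((map_inv (toPrincipalIdeal (𝓞 K) K) x.2).trans (congrArg (·⁻¹) hx)).trans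
      (inv_pow _ l).symm

theorem pow_mem_generatorPairs {M : Ideal (𝓞 K)} {I : idealsPrimeTo K M} {α : Kˣ}
    (h : (I : (FractionalIdeal (𝓞 K)⁰ K)ˣ) = toPrincipalIdeal (𝓞 K) K α) :
    (I, α ^ l) ∈ generatorPairs M l :=
  (map_pow (toPrincipalIdeal (𝓞 K) K) α l).trans (congrArg (· ^ l) h.symm)

/-- If the units represent each invertible residue class exactly once, then there is a character,
given by the normalized generators. -/
theorem exists_character_of_units {M : Ideal (𝓞 K)} (hM : M ≠ ⊥) (hMc : conjI M = M) (hl : l ≠ 0)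
    (hexp : Monoid.exponent (ClassGroup (𝓞 K)) ∣ l)
    (hex : ∀ x : 𝓞 K, IsCoprime (Ideal.span {x}) M → ∃ u : (𝓞 K)ˣ, x * u - 1 ∈ M)
    (huniq : ∀ u : (𝓞 K)ˣ, (u : 𝓞 K) - 1 ∈ M → u = 1) :
    ∃ ψ : HeckeCharacter K l, ψ.HasRationalCoefficients := by
  have hgen : ∀ a : (Ideal (𝓞 K))⁰, IsCoprime (a : Ideal (𝓞 K)) M → ∃ x : 𝓞 K, x ≠ 0 ∧
      Ideal.span {x} = (a : Ideal (𝓞 K)) ^ l ∧ x - 1 ∈ M := by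
    intro a ha
    obtain ⟨x, hx0, hx⟩ := exists_pow_mk0_eq hl hexp a
    obtain ⟨u, hu⟩ := hex x (hx ▸ ha.pow_left)
    refine ⟨x * u, mul_ne_zero hx0 u.ne_zero, ?_, hu⟩
    rw [Ideal.span_singleton_mul_right_unit u.isUnit, hx]
  refine exists_character_of_subgroup hM hMc
    (generatorPairs M l ⊓ (mulCongrSubgroup M).comap (MonoidHom.snd _ _)) ?_ ?_ ?_ ?_ ?_
  · rintro I β ⟨h, -⟩
    exact h
  · rintro ⟨_, a, b, ha, hb, rfl⟩
    obtain ⟨x, hx0, hx, hx1⟩ := hgen a ha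
    obtain ⟨y, hy0, hy, hy1⟩ := hgen b hb
    have hx0' : (x : K) ≠ 0 := by simpa using hx0
    have hy0' : (y : K) ≠ 0 := by simpa using hy0
    refine ⟨Units.mk0 (x : K) hx0' / Units.mk0 (y : K) hy0', ?_, ?_⟩
    · exact ((map_div (toPrincipalIdeal (𝓞 K) K) _ _).trans (congrArg₂ (· / ·)
        (toPrincipalIdeal_eq_mk0_pow rfl hx) (toPrincipalIdeal_eq_mk0_pow rfl hy))).trans
        (div_pow _ _ l).symm
    · refine ⟨x, y, hy0, ?_, ?_, ?_⟩
      · exact HeckeCharacter.isCoprime_span_of_sub_mem (isCoprime_span_one M) hy1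
      · have := sub_mem hx1 hy1
        rwa [sub_sub_sub_cancel_right] at this
      · rw [MonoidHom.coe_snd, Units.val_div_eq_div_val, Units.val_mk0, Units.val_mk0]
        exact div_mul_cancel₀ _ hy0'
  · rintro β ⟨h, b, c, hc, hcop, hbc, e⟩
    obtain ⟨u, hu⟩ := exists_unit_of_toPrincipalIdeal_eq_one (h.trans (one_pow l))
    have e' : (u : 𝓞 K) * c = b := by
      apply RingOfIntegers.ext
      exact (congrArg (· * (c : K)) hu).trans e
    -- Over the trivial ideal only units remain, and a unit which is multiplicatively congruent to 1
    -- is congruent to 1 in the ordinary sense.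
    have hu1 : (u : 𝓞 K) - 1 ∈ M := by
      rw [← Ideal.Quotient.eq]
      apply (isUnit_mk_of_isCoprime hcop).mul_right_cancel
      rw [← map_mul, ← map_mul, e', one_mul, Ideal.Quotient.eq]
      exact hbc
    rw [huniq u hu1] at hu
    apply Units.ext
    rw [← hu]
    simp
  · intro a I β ha hβ hI
    refine ⟨pow_mem_generatorPairs hI, (Ideal.absNorm a : 𝓞 K) ^ l, 1, one_ne_zero,
      isCoprime_span_one M, ?_, ?_⟩
    · have ha0 : a ≠ ⊥ := by
        rintro rfl
        rw [Ideal.absNorm_bot, Nat.cast_zero] at hβ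
        exact β.ne_zero hβ
      -- N(a)^l is the norm of the normalized generator x of a^l; as M is conjugation stable, x and
      -- x̄ are both 1 modulo M.
      obtain ⟨x, hx0, hx, hx1⟩ := hgen ⟨a, mem_nonZeroDivisors_of_ne_zero ha0⟩ ha
      have h1 : conjO K x - 1 ∈ M := by
        have : conjO K (conjO K x - 1) ∈ M := by
          rw [map_sub, conjO_conjO, map_one]; exact hx1
        rw [← mem_conjI, hMc] at this
        exact this
      have h2 := mul_sub_mul_mem hx1 h1
      rw [mul_conjO, hx, one_mul] at h2
      change ((Ideal.absNorm (a ^ l) : ℕ) : 𝓞 K) - 1 ∈ M at h2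
      rwa [map_pow, Nat.cast_pow] at h2
    · rw [MonoidHom.coe_snd, Units.val_pow_eq_pow_val, hβ]
      simp
  · intro I α hI hα
    exact ⟨pow_mem_generatorPairs hI, (mulCongrSubgroup M).pow_mem hα l⟩

end IsImagQuad

/-! ### Subgroups of index two and fields with units ±1 -/

/-- An element outside of a subgroup which contains the squares is outside of a subgroup of
index two. -/
theorem exists_subgroup_index_two {A : Type*} [CommGroup A] {G S : Subgroup A} {z : A}
    (hSG : S ≤ G) (hsq : ∀ g ∈ G, g ^ 2 ∈ S) (hzS : z ∉ S) :
    ∃ Γ : Subgroup A, S ≤ Γ ∧ Γ ≤ G ∧ z ∉ Γ ∧ ∀ g ∈ G, g ∈ Γ ∨ g * z ∈ Γ := by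
  obtain ⟨Γ, hSΓ, hmax⟩ := zorn_le_nonempty₀ {Γ : Subgroup A | Γ ≤ G ∧ z ∉ Γ} (by
    intro c hc hchain Γ hΓ
    refine ⟨sSup c, ⟨sSup_le fun H hH => (hc hH).1, ?_⟩, fun H hH => le_sSup hH⟩
    rw [Subgroup.mem_sSup_of_directedOn ⟨Γ, hΓ⟩ hchain.directedOn]
    rintro ⟨H, hH, hzH⟩
    exact (hc hH).2 hzH) S ⟨hSG, hzS⟩
  refine ⟨Γ, hSΓ, hmax.1.1, hmax.1.2, ?_⟩
  intro g hg
  by_contra! hno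
  -- By maximality, adjoining `g` captures `z`, so z = y g^k with y in `Γ`. As g² lies in `Γ`, even
  -- k would put `z` in `Γ`, and odd k puts `g * z` there.
  have hlt : z ∈ Γ ⊔ Subgroup.zpowers g := by
    by_contra hz'
    have hle := hmax.2 (y := Γ ⊔ Subgroup.zpowers g)
      ⟨sup_le hmax.1.1 ((Subgroup.zpowers_le).mpr hg), hz'⟩ le_sup_left
    exact hno.1 (hle (le_sup_right (a := Γ) (Subgroup.mem_zpowers g)))
  obtain ⟨y, hy, w, ⟨k, rfl⟩, h⟩ := Subgroup.mem_sup.mp hlt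
  have hg2 : g ^ 2 ∈ Γ := hSΓ (hsq g hg)
  rcases Int.even_or_odd' k with ⟨m, rfl | rfl⟩
  · apply hmax.1.2
    rw [← h]
    refine Γ.mul_mem hy ?_
    change g ^ (2 * m) ∈ Γ
    rw [zpow_mul, zpow_ofNat]
    exact Γ.zpow_mem hg2 m
  · apply hno.2
    rw [← h]
    change g * (y * g ^ (2 * m + 1)) ∈ Γ
    have : g * (y * g ^ (2 * m + 1)) = y * ((g ^ 2) ^ m * g ^ 2) := by
      rw [zpow_add, zpow_mul, zpow_one, sq, zpow_ofNat, sq, mul_left_comm g y, mul_left_comm g]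
    rw [this]
    exact Γ.mul_mem hy (Γ.mul_mem (Γ.zpow_mem hg2 m) hg2)

namespace IsImagQuad

variable {K : Type*} [Field K] [NumberField K] [Algebra K ℂ] [IsImagQuad K] {l : ℕ}

/-- The group generated by the elements congruent to `1` and the norms of ideals prime to `M`. -/
def mulCongrNormSubgroup (M : Ideal (𝓞 K)) : Subgroup Kˣ where
  carrier := {α | ∃ (b c : 𝓞 K) (a a' : (Ideal (𝓞 K))⁰), b ≠ 0 ∧ c ≠ 0 ∧ IsCoprime (Ideal.span {c}) M ∧
    b - c ∈ M ∧ IsCoprime (a : Ideal (𝓞 K)) M ∧ IsCoprime (a' : Ideal (𝓞 K)) M ∧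
    (α : K) * c * Ideal.absNorm (a' : Ideal (𝓞 K)) = b * Ideal.absNorm (a : Ideal (𝓞 K))}
  one_mem' := ⟨1, 1, 1, 1, one_ne_zero, one_ne_zero, isCoprime_span_one M, by simp,
    isCoprime_one_left, isCoprime_one_left, by simp⟩
  mul_mem' := by
    rintro α α' ⟨b, c, a, d, hb, hc, hcop, h, ha, hd, e⟩ ⟨b', c', a', d', hb', hc', hcop', h', ha', hd', e'⟩
    refine ⟨b * b', c * c', a * a', d * d', mul_ne_zero hb hb', mul_ne_zero hc hc',
      isCoprime_span_mul hcop hcop', mul_sub_mul_mem h h', ha.mul_left ha', hd.mul_left hd', ?_⟩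
    simp only [Submonoid.coe_mul, map_mul, Units.val_mul, Nat.cast_mul]
    calc _ = ((α : K) * c * Ideal.absNorm (d : Ideal (𝓞 K))) *
        ((α' : K) * c' * Ideal.absNorm (d' : Ideal (𝓞 K))) := by ring
      _ = _ := by rw [e, e']; ring
  inv_mem' := by
    rintro α ⟨b, c, a, d, hb, hc, hcop, h, ha, hd, e⟩
    refine ⟨c, b, d, a, hc, hb, HeckeCharacter.isCoprime_span_of_sub_mem hcop h, ?_, hd, ha, ?_⟩
    · rw [← neg_sub]; exact M.neg_mem h
    · rw [mul_assoc, ← e, Units.val_inv_eq_inv_val]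
      have := α.ne_zero
      field_simp

/-- If the only units are `±1`, then a character exists as soon as `-1` is not the product of a
square and the `l`-th power of an element which is congruent to a norm modulo `M`. -/
theorem exists_character_of_neg_one {M : Ideal (𝓞 K)} (hM : M ≠ ⊥) (hMc : conjI M = M) (hl : l ≠ 0)
    (hexp : Monoid.exponent (ClassGroup (𝓞 K)) ∣ l) (hunits : ∀ u : (𝓞 K)ˣ, u = 1 ∨ u = -1)
    (hneg : ∀ α ∈ mulCongrNormSubgroup M, ∀ γ : Kˣ, γ ^ 2 * α ^ l ≠ -1) :
    ∃ ψ : HeckeCharacter K l, ψ.HasRationalCoefficients := by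
  have hneg_mem : ∀ {I : idealsPrimeTo K M} {β : Kˣ}, (I, β) ∈ generatorPairs M l →
      (I, β) * (1, -1) ∈ generatorPairs M l := by
    intro I β h
    have h1 : toPrincipalIdeal (𝓞 K) K (β * -1) = toPrincipalIdeal (𝓞 K) K β := by
      apply Units.ext
      rw [coe_toPrincipalIdeal, coe_toPrincipalIdeal, FractionalIdeal.spanSingleton_eq_spanSingleton]
      exact ⟨-1, by simp [Units.smul_def]⟩
    have h2 : ((I, β) * (1, -1) : idealsPrimeTo K M × Kˣ) = (I, β * -1) := by
      rw [Prod.mk_mul_mk, mul_one]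
    rw [h2]
    exact h1.trans h
  -- The pairs (α, α^l) are those prescribed by the ∞-type and by compatibility with conjugation;
  -- the squares make a maximal subgroup avoiding (1, -1) have index two in the group of all pairs.
  let S : Subgroup (idealsPrimeTo K M × Kˣ) :=
    { carrier := {x | ∃ g ∈ generatorPairs M l, ∃ α ∈ mulCongrNormSubgroup M, ∃ J : idealsPrimeTo K M,
        (J : (FractionalIdeal (𝓞 K)⁰ K)ˣ) = toPrincipalIdeal (𝓞 K) K α ∧ x = g ^ 2 * (J, α ^ l)}
      one_mem' := ⟨1, one_mem _, 1, one_mem _, 1, (map_one (toPrincipalIdeal (𝓞 K) K)).symm, by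
        rw [one_pow, one_pow, one_mul]; rfl⟩
      mul_mem' := by
        rintro _ _ ⟨g, hg, α, hα, J, hJ, rfl⟩ ⟨g', hg', α', hα', J', hJ', rfl⟩
        refine ⟨g * g', mul_mem hg hg', α * α', mul_mem hα hα', J * J', ?_, ?_⟩
        · exact (congrArg₂ (· * ·) hJ hJ').trans (map_mul (toPrincipalIdeal (𝓞 K) K) α α').symm
        · rw [mul_pow g, mul_pow α, ← Prod.mk_mul_mk, mul_mul_mul_comm]
      inv_mem' := by
        rintro _ ⟨g, hg, α, hα, J, hJ, rfl⟩
        refine ⟨g⁻¹, inv_mem hg, α⁻¹, inv_mem hα, J⁻¹, ?_, ?_⟩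
        · exact (congrArg (·⁻¹) hJ).trans (map_inv (toPrincipalIdeal (𝓞 K) K) α).symm
        · rw [mul_inv, inv_pow g, inv_pow α, Prod.inv_mk J] }
  have hS : ∀ (α : Kˣ) (J : idealsPrimeTo K M), α ∈ mulCongrNormSubgroup M →
      (J : (FractionalIdeal (𝓞 K)⁰ K)ˣ) = toPrincipalIdeal (𝓞 K) K α → (J, α ^ l) ∈ S := by
    intro α J hα hJ
    exact ⟨1, one_mem _, α, hα, J, hJ, by rw [one_pow, one_mul]⟩
  obtain ⟨Γ, hSΓ, hΓ, hz, hor⟩ := exists_subgroup_index_two (G := generatorPairs M l) (S := S)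
    (z := (1, -1))
    (by
      rintro _ ⟨g, hg, α, hα, J, hJ, rfl⟩
      exact mul_mem (pow_mem hg 2) (pow_mem_generatorPairs hJ))
    (by
      intro g hg
      exact ⟨g, hg, 1, one_mem _, 1, (map_one (toPrincipalIdeal (𝓞 K) K)).symm, by
        rw [one_pow]; exact (mul_one _).symm⟩)
    (by
      rintro ⟨g, hg, α, hα, J, hJ, e⟩
      exact hneg α hα g.2 (congrArg Prod.snd e).symm)
  refine exists_character_of_subgroup hM hMc Γ (fun I β h => hΓ h) ?_ ?_ ?_ ?_
  · rintro ⟨_, a, b, ha, hb, rfl⟩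
    obtain ⟨x, hx0, hx⟩ := exists_pow_mk0_eq hl hexp a
    obtain ⟨y, hy0, hy⟩ := exists_pow_mk0_eq hl hexp b
    have hx0' : (x : K) ≠ 0 := by simpa using hx0
    have hy0' : (y : K) ≠ 0 := by simpa using hy0
    rcases hor (⟨_, a, b, ha, hb, rfl⟩, Units.mk0 (x : K) hx0' / Units.mk0 (y : K) hy0')
      (((map_div (toPrincipalIdeal (𝓞 K) K) _ _).trans (congrArg₂ (· / ·)
        (toPrincipalIdeal_eq_mk0_pow rfl hx) (toPrincipalIdeal_eq_mk0_pow rfl hy))).trans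
        (div_pow _ _ l).symm) with h | h
    · exact ⟨_, h⟩
    · rw [Prod.mk_mul_mk, mul_one] at h
      exact ⟨_, h⟩
  · intro β h
    obtain ⟨u, hu⟩ := exists_unit_of_toPrincipalIdeal_eq_one ((hΓ h).trans (one_pow l))
    rcases hunits u with rfl | rfl
    · apply Units.ext
      rw [← hu]; simp
    · exfalso
      apply hz
      have : β = -1 := by
        apply Units.ext
        rw [← hu]; simp
      rwa [this] at h
  · intro a I β ha hβ hI
    refine hSΓ (hS β I ?_ hI)
    have ha0 : a ≠ ⊥ := by
      rintro rfl
      rw [Ideal.absNorm_bot, Nat.cast_zero] at hβ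
      exact β.ne_zero hβ
    exact ⟨1, 1, ⟨a, mem_nonZeroDivisors_of_ne_zero ha0⟩, 1, one_ne_zero, one_ne_zero,
      isCoprime_span_one M, by simp, ha, isCoprime_one_left, by simp [hβ]⟩
  · intro I α hI hα
    refine hSΓ (hS α I ?_ hI)
    obtain ⟨b, c, hc, hcop, hbc, e⟩ := hα
    refine ⟨b, c, 1, 1, ?_, hc, hcop, hbc, isCoprime_one_left, isCoprime_one_left, by simp [e]⟩
    rintro rfl
    rw [map_zero, mul_eq_zero] at e
    exact e.elim α.ne_zero (by simpa using hc)

end IsImagQuad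

/-! ### Excluding the obstruction from -1; the fields ℚ(√-1) and ℚ(√-3) -/

namespace IsImagQuad

variable {K : Type*} [Field K] [NumberField K] [Algebra K ℂ] [IsImagQuad K] {l : ℕ}

theorem sq_mul_pow_ne_neg_one_of_even (h1 : ¬ ∃ x : K, x ^ 2 = -1) (hl : Even l) (α γ : Kˣ) :
    γ ^ 2 * α ^ l ≠ -1 := by
  obtain ⟨k, rfl⟩ := hl
  intro h
  apply h1
  refine ⟨(γ * α ^ k : Kˣ), ?_⟩
  have h2 : (γ * α ^ k) ^ 2 = -1 := by rw [← h, mul_pow, ← pow_mul, mul_two]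
  simpa using congrArg Units.val h2

theorem mul_conjO_eq_pow {a : Ideal (𝓞 K)} {x : 𝓞 K} (h : Ideal.span {x} = a ^ l) :
    x * conjO K x = (Ideal.absNorm a : 𝓞 K) ^ l := by
  rw [mul_conjO, h, map_pow, Nat.cast_pow]

/-- The l-th power of an ideal norm is the norm of an element, because a^l is principal. So γ²α^l =
-1 would make minus such a norm a square modulo `M`, which `hM` forbids. -/
theorem sq_mul_pow_ne_neg_one_of_norm {M : Ideal (𝓞 K)} (hl : l ≠ 0)
    (hexp : Monoid.exponent (ClassGroup (𝓞 K)) ∣ l)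
    (hM : ∀ v w : 𝓞 K, IsCoprime (Ideal.span {v}) M → v * conjO K v + w ^ 2 ∉ M) {α : Kˣ}
    (hα : α ∈ mulCongrNormSubgroup M) (γ : Kˣ) : γ ^ 2 * α ^ l ≠ -1 := by
  intro h
  obtain ⟨b, c, a, a', hb, hc, hcop, hbc, ha, ha', e⟩ := hα
  obtain ⟨x, hx0, hx⟩ := exists_pow_mk0_eq hl hexp a
  obtain ⟨y, hy0, hy⟩ := exists_pow_mk0_eq hl hexp a'
  have hxN := congrArg (algebraMap (𝓞 K) K) (mul_conjO_eq_pow hx)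
  have hyN := congrArg (algebraMap (𝓞 K) K) (mul_conjO_eq_pow hy)
  simp only [map_mul, map_pow, map_natCast] at hxN hyN
  have hγ := γ.ne_zero
  have h' : (γ : K) ^ 2 * (α : K) ^ l = -1 := by simpa using congrArg Units.val h
  -- The witness is c^l N(y)/γ, which is integral because its square is. Modulo `M` the factor
  -- (bc)^l is the square of c^l, which is removed by the inverse `c'` of `c`.
  obtain ⟨w, hw⟩ : ∃ w : 𝓞 K, w ^ 2 = -((b * c) ^ l * ((x * y) * conjO K (x * y))) := by
    have hsq : ((c : K) ^ l * (y * algebraMap (𝓞 K) K (conjO K y)) / γ) ^ 2 =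
        algebraMap (𝓞 K) K (-((b * c) ^ l * ((x * y) * conjO K (x * y)))) := by
      simp only [map_mul, map_pow, map_neg]
      rw [div_pow, div_eq_iff (pow_ne_zero 2 hγ)]
      have e' := congrArg (· ^ l) e
      simp only [mul_pow] at e'
      have e2 : (γ : K) ^ 2 * ((b : K) ^ l * (x * algebraMap (𝓞 K) K (conjO K x))) =
          -((c : K) ^ l * (y * algebraMap (𝓞 K) K (conjO K y))) := by
        rw [hxN, hyN, ← e']
        linear_combination (c : K) ^ l * (Ideal.absNorm (a' : Ideal (𝓞 K)) : K) ^ l * h'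
      linear_combination ((c : K) ^ l * (y * algebraMap (𝓞 K) K (conjO K y))) * e2
    have hi : IsIntegral ℤ ((c : K) ^ l * (y * algebraMap (𝓞 K) K (conjO K y)) / γ) := by
      apply IsIntegral.of_pow two_pos
      rw [hsq]
      exact RingOfIntegers.isIntegral_coe _
    obtain ⟨w, hw⟩ : ∃ w : 𝓞 K, (w : K) = (c : K) ^ l * (y * algebraMap (𝓞 K) K (conjO K y)) / γ :=
      ⟨⟨_, hi⟩, rfl⟩
    refine ⟨w, RingOfIntegers.ext ?_⟩
    refine Eq.trans ?_ hsq
    rw [← hw]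
    exact map_pow _ _ _
  obtain ⟨c', hc'⟩ : ∃ c' : 𝓞 K, c * c' - 1 ∈ M := by
    obtain ⟨q, hq⟩ := (isUnit_mk_of_isCoprime hcop).exists_right_inv
    obtain ⟨c', rfl⟩ := Ideal.Quotient.mk_surjective q
    exact ⟨c', by rw [← Ideal.Quotient.eq, map_mul, hq, map_one]⟩
  have ht : (b * c * c' ^ 2) ^ l - 1 ∈ M := by
    rw [← Ideal.Quotient.eq] at hbc hc' ⊢
    simp only [map_mul, map_pow, map_one] at hc' ⊢
    rw [hbc]
    have : Ideal.Quotient.mk M c * Ideal.Quotient.mk M c * Ideal.Quotient.mk M c' ^ 2 =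
        (Ideal.Quotient.mk M c * Ideal.Quotient.mk M c') ^ 2 := by ring
    rw [this, hc', one_pow, one_pow]
  apply hM (x * y) (w * c' ^ l) (isCoprime_span_mul (hx ▸ ha.pow_left) (hy ▸ ha'.pow_left))
  have : x * y * conjO K (x * y) + (w * c' ^ l) ^ 2 =
      -(x * y * conjO K (x * y)) * ((b * c * c' ^ 2) ^ l - 1) := by
    rw [mul_pow w, hw]
    simp only [mul_pow, ← pow_mul]
    rw [mul_comm 2 l]
    ring
  rw [this]
  exact M.mul_mem_left _ ht

/-- The integers represent all residue classes modulo an element of prime norm. -/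
theorem exists_int_add_mul {π : 𝓞 K} {p : ℕ} (hp : p.Prime)
    (hπ : Ideal.absNorm (Ideal.span {π}) = p) (x : 𝓞 K) : ∃ (n : ℤ) (y : 𝓞 K), x = n + π * y := by
  have hcard : Nat.card (𝓞 K ⧸ Ideal.span {π}) = p := hπ
  have : Finite (𝓞 K ⧸ Ideal.span {π}) := Nat.finite_of_card_ne_zero (by rw [hcard]; exact hp.ne_zero)
  have : Fintype (𝓞 K ⧸ Ideal.span {π}) := Fintype.ofFinite _
  rw [Nat.card_eq_fintype_card] at hcard
  let e := ZMod.ringEquivOfPrime (𝓞 K ⧸ Ideal.span {π}) hp hcard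
  obtain ⟨n, hn⟩ := ZMod.intCast_surjective (e.symm (Ideal.Quotient.mk _ x))
  have h1 : Ideal.Quotient.mk (Ideal.span {π}) x = Ideal.Quotient.mk (Ideal.span {π}) (n : 𝓞 K) := by
    rw [map_intCast, ← map_intCast e, hn, e.apply_symm_apply]
  rw [Ideal.Quotient.eq, Ideal.mem_span_singleton] at h1
  obtain ⟨y, hy⟩ := h1
  exact ⟨n, y, by linear_combination hy⟩

/-- Residue classes modulo powers of `m`, given that they are represented by `ℤ + ℤ δ` modulo `m`. -/
theorem exists_int_add_int_mul_pow {δ : 𝓞 K} {m : ℤ}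
    (h : ∀ x : 𝓞 K, ∃ (a b : ℤ) (y : 𝓞 K), x = a + b * δ + m * y) (k : ℕ) (x : 𝓞 K) :
    ∃ (a b : ℤ) (y : 𝓞 K), x = a + b * δ + m ^ k * y := by
  induction k with
  | zero => exact ⟨0, 0, x, by simp⟩
  | succ k ih =>
    obtain ⟨a, b, y, rfl⟩ := ih
    obtain ⟨a', b', y', rfl⟩ := h y
    exact ⟨a + m ^ k * a', b + m ^ k * b', y', by push_cast; ring⟩

theorem not_isUnit_natCast {n : ℕ} (hn : 2 ≤ n) : ¬ IsUnit (n : 𝓞 K) := by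
  rw [← Ideal.span_singleton_eq_top, ← Ideal.absNorm_eq_one_iff, Ideal.absNorm_span_natCast,
    RingOfIntegers.rank, finrank_eq_two]
  nlinarith

theorem not_isCoprime_of_mem {M : Ideal (𝓞 K)} {π v : 𝓞 K} (hπ : ¬ IsUnit π)
    (hM : M ≤ Ideal.span {π}) (hv : v ∈ Ideal.span {π}) : ¬ IsCoprime (Ideal.span {v}) M := by
  intro h
  rw [Ideal.isCoprime_iff_sup_eq] at h
  apply hπ
  rw [← Ideal.span_singleton_eq_top, eq_top_iff, ← h]
  exact sup_le ((Ideal.span_singleton_le_iff_mem _).mpr hv) hM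

theorem mem_span_of_mul {π x y : 𝓞 K} (h : x = π * y) : x ∈ Ideal.span {π} :=
  Ideal.mem_span_singleton.mpr ⟨y, h⟩

/-- Characters of the Gaussian field. -/
theorem exists_character_of_sq_eq_neg_one (h1 : ∃ x : K, x ^ 2 = -1) (hl : l ≠ 0)
    (hexp : Monoid.exponent (ClassGroup (𝓞 K)) ∣ l) :
    ∃ ψ : HeckeCharacter K l, ψ.HasRationalCoefficients := by
  obtain ⟨ι, hι⟩ : ∃ ι : 𝓞 K, ι ^ 2 = -1 := by
    obtain ⟨x, hx⟩ := h1
    have hi : IsIntegral ℤ x := IsIntegral.of_pow two_pos (by rw [hx]; exact isIntegral_one.neg)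
    exact ⟨⟨x, hi⟩, RingOfIntegers.ext hx⟩
  have hι' : ι ^ 2 = -((1 : ℕ) : 𝓞 K) := by rw [hι]; simp
  have hconj : conjO K ι = -ι := conjO_eq_neg one_pos hι'
  have hιu : IsUnit ι := IsUnit.of_mul_eq_one (-ι) (by linear_combination -hι)
  have hN : Ideal.absNorm (Ideal.span {1 + ι}) = 2 := by
    have := absNorm_span_add_mul one_pos hι' 1 1
    rw [Int.cast_one, one_mul] at this
    zify; rw [this]; norm_num
  have h2 : ¬ IsUnit (2 : 𝓞 K) := by exact_mod_cast not_isUnit_natCast (K := K) le_rfl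
  have h1ι : ¬ IsUnit (1 + ι) := fun h => h2 (by
    have : (2 : 𝓞 K) = (1 + ι) * (1 + ι) * (-ι) := by linear_combination (2 + ι) * hι
    rw [this]; exact (h.mul h).mul hιu.neg)
  have hrep : ∀ x : 𝓞 K, ∃ (a b : ℤ) (y : 𝓞 K), x = a + b * ι + (2 : ℤ) ^ 2 * y := by
    apply exists_int_add_int_mul_pow
    intro x
    obtain ⟨n, y, rfl⟩ := exists_int_add_mul Nat.prime_two hN x
    obtain ⟨m, z, rfl⟩ := exists_int_add_mul Nat.prime_two hN y
    refine ⟨n + m, m, ι * z, ?_⟩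
    push_cast
    linear_combination z * hι
  have hmem : ∀ a b : ℤ, 2 ∣ a → 4 ∣ a + b → (a : 𝓞 K) + b * ι ∈ Ideal.span {2 + 2 * ι} := by
    rintro a b ⟨k, rfl⟩ ⟨j, hj⟩
    obtain rfl : b = 4 * j - 2 * k := by omega
    apply mem_span_of_mul (y := (j : 𝓞 K) + (j - k : 𝓞 K) * ι)
    push_cast
    linear_combination (-2 * (j - k : 𝓞 K)) * hι
  have h4 : (4 : 𝓞 K) ∈ Ideal.span {2 + 2 * ι} :=
    mem_span_of_mul (y := 1 - ι) (by linear_combination 2 * hι)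
  -- This modulus has norm 8 and four invertible classes, one for each unit.
  refine exists_character_of_units (M := Ideal.span {2 + 2 * ι}) ?_ ?_ hl hexp ?_ ?_
  · rw [Ne, Ideal.span_singleton_eq_bot]
    intro h
    have : (1 + ι) = 0 := by
      have h' : (2 : 𝓞 K) * (1 + ι) = 0 := by linear_combination h
      exact (mul_eq_zero.mp h').resolve_left two_ne_zero
    rw [this, Ideal.span_singleton_zero, Ideal.absNorm_bot] at hN
    omega
  · rw [conjI_span, map_add, map_mul, hconj, map_ofNat, Ideal.span_singleton_eq_span_singleton]
    refine ⟨hιu.unit, ?_⟩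
    rw [IsUnit.unit_spec]
    linear_combination (-2) * hι
  · intro x hx
    obtain ⟨a, b, y, rfl⟩ := hrep x
    have hle : Ideal.span {2 + 2 * ι} ≤ Ideal.span {1 + ι} := by
      rw [Ideal.span_singleton_le_iff_mem]
      exact mem_span_of_mul (y := 2) (by ring)
    have hodd : ¬ 2 ∣ a + b := by
      rintro ⟨k, hk⟩
      refine not_isCoprime_of_mem h1ι hle (mem_span_of_mul (y := b + (1 - ι) * (k - b) +
        (1 - ι) * 2 * y) ?_) hx
      have hk' : (a : 𝓞 K) = 2 * k - b := by
        have : a = 2 * k - b := by omega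
        rw [this]; push_cast; ring
      rw [hk']
      push_cast
      linear_combination (k - b + 2 * y : 𝓞 K) * hι
    have key : ∀ (u : (𝓞 K)ˣ) (a' b' : ℤ), ((a : 𝓞 K) + b * ι) * u = a' + b' * ι → 2 ∣ a' - 1 →
        4 ∣ a' - 1 + b' → ((a : 𝓞 K) + b * ι + (2 : ℤ) ^ 2 * y) * u - 1 ∈ Ideal.span {2 + 2 * ι} := by
      intro u a' b' h h3 h5
      have := add_mem (hmem (a' - 1) b' h3 h5) (Ideal.mul_mem_left _ (y * u) h4)
      convert this using 1
      push_cast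
      linear_combination h
    by_cases ha : 2 ∣ a
    · by_cases h5 : 4 ∣ b - 1 - a
      · refine ⟨-hιu.unit, key _ b (-a) ?_ (by omega) (by omega)⟩
        rw [Units.val_neg, IsUnit.unit_spec]
        push_cast
        linear_combination (-b : 𝓞 K) * hι
      · refine ⟨hιu.unit, key _ (-b) a ?_ (by omega) (by omega)⟩
        rw [IsUnit.unit_spec]
        push_cast
        linear_combination (b : 𝓞 K) * hι
    · by_cases h5 : 4 ∣ a - 1 + b
      · exact ⟨1, key _ a b (by simp) (by omega) h5⟩
      · refine ⟨-1, key _ (-a) (-b) ?_ (by omega) (by omega)⟩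
        push_cast
        ring
  · intro u hu
    obtain ⟨y, hy⟩ := Ideal.mem_span_singleton.mp hu
    have h2' : ∀ z : 𝓞 K, 2 * z ≠ ι := fun z hz => h2 (isUnit_of_mul_isUnit_left (hz ▸ hιu))
    have h1' : ∀ z : 𝓞 K, 2 * z ≠ -1 := fun z hz =>
      h2 (isUnit_of_mul_isUnit_left (hz ▸ isUnit_one.neg))
    have hlam : (1 + ι) ≠ 0 := by
      intro h
      rw [h, Ideal.span_singleton_zero, Ideal.absNorm_bot] at hN
      omega
    have hno_neg : (u : 𝓞 K) ≠ -1 := by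
      intro h
      rw [h] at hy
      apply h1ι
      apply isUnit_of_mul_isUnit_left (y := -y)
      have h6 : (2 : 𝓞 K) * ((1 + ι) * -y) = 2 * 1 := by linear_combination hy
      rw [mul_left_cancel₀ two_ne_zero h6]
      exact isUnit_one
    have hno_sq : (u : 𝓞 K) ^ 2 ≠ -1 := by
      intro h
      have h7 : ((u : 𝓞 K) - ι) * ((u : 𝓞 K) + ι) = 0 := by linear_combination h - hι
      rcases mul_eq_zero.mp h7 with h8 | h8
      · refine h2' y (mul_left_cancel₀ hlam ?_)
        linear_combination -hy + h8 - hι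
      · refine h1' y (mul_left_cancel₀ hlam ?_)
        linear_combination -hy + h8
    have h := unit_pow_extraTwistOrder (Or.inl h1) u
    rw [HeckeCharacter.extraTwistOrder, if_pos h1] at h
    have h' : (u : 𝓞 K) ^ 4 = 1 := by simpa using congrArg Units.val h
    have h7 : ((u : 𝓞 K) - 1) * (((u : 𝓞 K) + 1) * ((u : 𝓞 K) ^ 2 + 1)) = 0 := by
      linear_combination h'
    rcases mul_eq_zero.mp h7 with h8 | h8
    · exact Units.ext (sub_eq_zero.mp h8)
    · rcases mul_eq_zero.mp h8 with h9 | h9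
      · exact absurd (eq_neg_of_add_eq_zero_left h9) hno_neg
      · exact absurd (eq_neg_of_add_eq_zero_left h9) hno_sq

/-- Characters of the field of third roots of unity. -/
theorem exists_character_of_sq_eq_neg_three (h3 : ∃ x : K, x ^ 2 = -3) (hl : l ≠ 0)
    (hexp : Monoid.exponent (ClassGroup (𝓞 K)) ∣ l) :
    ∃ ψ : HeckeCharacter K l, ψ.HasRationalCoefficients := by
  obtain ⟨η, hη⟩ : ∃ η : 𝓞 K, η ^ 2 - η + 1 = 0 := by
    obtain ⟨x, hx⟩ := h3
    have hz : ((1 + x) / 2) ^ 2 - (1 + x) / 2 + 1 = 0 := by linear_combination hx / 4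
    have hi : IsIntegral ℤ ((1 + x) / 2) := by
      apply IsIntegral.of_pow three_pos
      have : ((1 + x) / 2) ^ 3 = -1 := by linear_combination ((1 + x) / 2 + 1) * hz
      rw [this]
      exact isIntegral_one.neg
    exact ⟨⟨_, hi⟩, RingOfIntegers.ext hz⟩
  obtain ⟨v, rfl⟩ : IsUnit η := IsUnit.of_mul_eq_one (1 - η) (by linear_combination -hη)
  obtain ⟨v', hv'⟩ : IsUnit (1 - (v : 𝓞 K)) :=
    IsUnit.of_mul_eq_one (v : 𝓞 K) (by linear_combination -hη)
  obtain ⟨θ, hθ⟩ : ∃ θ : 𝓞 K, θ = 2 * v - 1 := ⟨_, rfl⟩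
  have hθ2 : θ ^ 2 = -((3 : ℕ) : 𝓞 K) := by
    rw [hθ]; push_cast; linear_combination 4 * hη
  have hN : Ideal.absNorm (Ideal.span {θ}) = 3 := by
    have := absNorm_span_add_mul three_pos hθ2 0 1
    rw [Int.cast_one, one_mul, Int.cast_zero, zero_add] at this
    zify; rw [this]; norm_num
  have h3u : ¬ IsUnit (3 : 𝓞 K) := by exact_mod_cast not_isUnit_natCast (K := K) (n := 3) (by norm_num)
  have hθu : ¬ IsUnit θ := by
    intro h
    rw [Ideal.span_singleton_eq_top.mpr h, Ideal.absNorm_top] at hN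
    omega
  have h30 : (3 : 𝓞 K) ≠ 0 := OfNat.ofNat_ne_zero 3
  push_cast at hθ2
  -- The six units represent the six invertible classes modulo 3.
  refine exists_character_of_units (M := Ideal.span {3}) ?_ ?_ hl hexp ?_ ?_
  · rw [Ne, Ideal.span_singleton_eq_bot]
    exact h30
  · rw [conjI_span, map_ofNat]
  · intro x hx
    obtain ⟨a, y, rfl⟩ := exists_int_add_mul Nat.prime_three hN x
    obtain ⟨b, z, rfl⟩ := exists_int_add_mul Nat.prime_three hN y
    have hle : Ideal.span {(3 : 𝓞 K)} ≤ Ideal.span {θ} := by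
      rw [Ideal.span_singleton_le_iff_mem]
      exact mem_span_of_mul (y := -θ) (by linear_combination hθ2)
    have ha : ¬ (3 : ℤ) ∣ a := by
      rintro ⟨k, rfl⟩
      refine not_isCoprime_of_mem hθu hle (mem_span_of_mul (y := -θ * k + (b + θ * z)) ?_) hx
      push_cast
      linear_combination (k : 𝓞 K) * hθ2
    obtain ⟨ε, hε, a', ha'⟩ : ∃ ε : (𝓞 K)ˣ, (ε : 𝓞 K) * ε = 1 ∧ ∃ a' : 𝓞 K, (a : 𝓞 K) = ε + 3 * a' := by
      obtain ⟨k, hk | hk⟩ : ∃ k, a = 1 + 3 * k ∨ a = -1 + 3 * k := by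
        obtain h | h : a % 3 = 1 ∨ a % 3 = 2 := by omega
        · exact ⟨a / 3, Or.inl (by omega)⟩
        · exact ⟨a / 3 + 1, Or.inr (by omega)⟩
      · exact ⟨1, by simp, k, by rw [hk]; push_cast; ring⟩
      · exact ⟨-1, by simp, k, by rw [hk]; push_cast; ring⟩
    -- Modulo 3 the element is a, a(1 + θ) or a(1 - θ). Since 1 + θ = 2v ≡ -v, 1 - θ = 2(1 - v) ≡
    -- -(1 - v) and v(1 - v) = 1, the inverse is a unit in each case.
    obtain ⟨k, hk⟩ : ∃ k, b = 3 * k ∨ b = a + 3 * k ∨ b = -a + 3 * k := by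
      obtain h | h | h : b % 3 = 0 ∨ (b - a) % 3 = 0 ∨ (b + a) % 3 = 0 := by
        clear ha' hx
        have h1 : a % 3 = 1 ∨ a % 3 = 2 := by omega
        have h2 : b % 3 = 0 ∨ b % 3 = 1 ∨ b % 3 = 2 := by omega
        omega
      · exact ⟨b / 3, Or.inl (by omega)⟩
      · exact ⟨(b - a) / 3, Or.inr (Or.inl (by omega))⟩
      · exact ⟨(b + a) / 3, Or.inr (Or.inr (by omega))⟩
    rcases hk with rfl | rfl | rfl
    · refine ⟨ε, mem_span_of_mul (y := (a' + θ * k - z) * ε) ?_⟩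
      push_cast
      rw [ha']
      linear_combination hε + z * ε * hθ2
    · refine ⟨-ε * v', mem_span_of_mul (y := -2 * a' * ε - 1 + (k * θ - z) * (-ε * v')) ?_⟩
      rw [Units.val_mul, Units.val_neg]
      push_cast
      rw [ha', hv']
      linear_combination (-2) * hε + z * (-ε * (1 - v)) * hθ2 + (ε + 3 * a') * (-ε * (1 - v)) * hθ +
        2 * (ε + 3 * a') * ε * hη
    · refine ⟨-ε * v, mem_span_of_mul (y := -2 * a' * ε - 1 + (k * θ - z) * (-ε * v)) ?_⟩
      rw [Units.val_mul, Units.val_neg]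
      push_cast
      rw [ha']
      linear_combination (-2) * hε + z * (-ε * v) * hθ2 - (ε + 3 * a') * (-ε * v) * hθ +
        2 * (ε + 3 * a') * ε * hη
  · intro u hu
    obtain ⟨y, hy⟩ := Ideal.mem_span_singleton.mp hu
    have hu' : (u : 𝓞 K) = 1 + 3 * y := by linear_combination hy
    have hno : ∀ z : 𝓞 K, 3 * z ≠ 1 := fun z hz => h3u (IsUnit.of_mul_eq_one z hz)
    rcases eq_one_or_neg_one_or u with h | h | ⟨h, -⟩ | ⟨h, -⟩
    · exact h
    · have h' : (u : 𝓞 K) = -1 := by simpa using congrArg Units.val h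
      exact absurd (by linear_combination h' - hu') (hno (y + 1))
    · have h' : (u : 𝓞 K) ^ 4 = 1 := by simpa using congrArg Units.val h
      have h7 : ((u : 𝓞 K) - 1) * (((u : 𝓞 K) + 1) * ((u : 𝓞 K) ^ 2 + 1)) = 0 := by
        linear_combination h'
      rcases mul_eq_zero.mp h7 with h8 | h8
      · exact Units.ext (sub_eq_zero.mp h8)
      · rw [hu'] at h8
        rcases mul_eq_zero.mp h8 with h9 | h9
        · exact absurd (by linear_combination h9) (hno (y + 1))
        · exact absurd (by linear_combination h9) (hno (1 + 2 * y + 3 * y ^ 2))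
    · have h' : (u : 𝓞 K) ^ 6 = 1 := by simpa using congrArg Units.val h
      have h7 : ((u : 𝓞 K) - 1) * (((u : 𝓞 K) + 1) * (((u : 𝓞 K) ^ 2 + u + 1) *
          ((u : 𝓞 K) ^ 2 - u + 1))) = 0 := by
        linear_combination h'
      rcases mul_eq_zero.mp h7 with h8 | h8
      · exact Units.ext (sub_eq_zero.mp h8)
      · rw [hu'] at h8
        rcases mul_eq_zero.mp h8 with h9 | h9
        · exact absurd (by linear_combination h9) (hno (y + 1))
        · rcases mul_eq_zero.mp h9 with h10 | h10
          · have h11 : 3 * (1 + 3 * y + 3 * y ^ 2) = (3 : 𝓞 K) * 0 := by linear_combination h10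
            have h12 := mul_left_cancel₀ h30 h11
            exact absurd (by linear_combination -h12) (hno (-y - y ^ 2))
          · exact absurd (by linear_combination -h10) (hno (-y - 3 * y ^ 2))

end IsImagQuad

/-! ### Odd l: genus theory and the congruence conditions -/

namespace IsImagQuad

variable {K : Type*} [Field K] [NumberField K] [Algebra K ℂ] [IsImagQuad K] {l : ℕ}

/-- Such a `y` would be conjugate to ±y. With the plus sign it is a rational integer; with the minus
sign y² = -N(y) is not positive. -/
theorem sq_ne_prime {p : ℕ} (hp : p.Prime) (y : 𝓞 K) : y ^ 2 ≠ p := by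
  intro h
  have h1 : (conjO K y) ^ 2 = y ^ 2 := by rw [← map_pow, h, map_natCast]
  rcases sq_eq_sq_iff_eq_or_eq_neg.mp h1 with h2 | h2
  · obtain ⟨n, rfl⟩ := exists_int_of_conjO_eq h2
    have h3 : n ^ 2 = p := by exact_mod_cast h
    have h4 : IsSquare (p : ℤ) := ⟨n, by rw [← h3, sq]⟩
    exact (Nat.prime_iff_prime_int.mp hp).irreducible.not_isSquare h4
  · have h3 := mul_conjO y
    rw [h2] at h3
    have h4 : ((p + Ideal.absNorm (Ideal.span {y}) : ℕ) : 𝓞 K) = 0 := by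
      push_cast
      rw [← h3, ← h]
      ring
    have h5 : p + Ideal.absNorm (Ideal.span {y}) = 0 := by exact_mod_cast h4
    have := hp.pos
    omega

/-- If a square root of `(p)` has a principal odd power, then `-p` is a square. -/
theorem exists_sq_eq_neg_prime (hunits : ∀ u : (𝓞 K)ˣ, u = 1 ∨ u = -1) (hl : Odd l)
    (hexp : Monoid.exponent (ClassGroup (𝓞 K)) ∣ l) {p : ℕ} (hp : p.Prime) {I : Ideal (𝓞 K)}
    (hI : I ^ 2 = Ideal.span {(p : 𝓞 K)}) : ∃ π : 𝓞 K, π ^ 2 = -(p : 𝓞 K) := by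
  obtain ⟨k, rfl⟩ := hl
  obtain ⟨x, hx⟩ := exists_pow_eq_span_of_exponent_dvd hexp I (by omega)
  -- With l = 2k + 1 the principal ideal I^l is p^k I, so `I` itself is principal.
  rw [pow_succ, pow_mul, hI, Ideal.span_singleton_pow] at hx
  have hpk : Ideal.span {(p : 𝓞 K) ^ k} ≠ ⊥ := by
    rw [Ne, Ideal.span_singleton_eq_bot]
    exact pow_ne_zero k (by exact_mod_cast hp.ne_zero)
  obtain ⟨y, rfl⟩ : (p : 𝓞 K) ^ k ∣ x := by
    apply Ideal.span_singleton_le_span_singleton.mp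
    rw [← hx]
    exact Ideal.mul_le_left
  rw [← Ideal.span_singleton_mul_span_singleton] at hx
  have hIy := mul_left_cancel₀ hpk hx
  rw [hIy, Ideal.span_singleton_pow, Ideal.span_singleton_eq_span_singleton] at hI
  obtain ⟨u, hu⟩ := hI
  rcases hunits u with rfl | rfl
  · exact absurd (by simpa using hu) (sq_ne_prime hp y)
  · exact ⟨y, by rw [← hu]; simp⟩

/-- If the class number is odd, then the field is generated by the square root of `-p` for a prime
`p`, which is not `1` modulo `4`. -/
theorem exists_prime_sq_eq_neg (h1 : ¬ ∃ x : K, x ^ 2 = -1)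
    (hunits : ∀ u : (𝓞 K)ˣ, u = 1 ∨ u = -1) (hl : Odd l)
    (hexp : Monoid.exponent (ClassGroup (𝓞 K)) ∣ l) :
    ∃ (p : ℕ) (π : 𝓞 K), p.Prime ∧ π ^ 2 = -(p : 𝓞 K) ∧ p % 4 ≠ 1 := by
  classical
  have hex : ∃ d : ℕ, 0 < d ∧ ∃ δ : 𝓞 K, δ ^ 2 = -(d : 𝓞 K) := by
    obtain ⟨d, δ, hd, hδ⟩ := exists_sq_eq_neg K
    exact ⟨d, hd, δ, hδ⟩
  obtain ⟨hd, δ, hδ⟩ := Nat.find_spec hex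
  have hmin := fun m => Nat.find_min (H := hex) (m := m)
  generalize Nat.find hex = d at *
  have hd1 : d ≠ 1 := by
    rintro rfl
    apply h1
    refine ⟨δ, ?_⟩
    simpa using congrArg (algebraMap (𝓞 K) K) hδ
  have hp := Nat.minFac_prime hd1
  obtain ⟨e, he⟩ := Nat.minFac_dvd d
  generalize d.minFac = p at *
  have hp0 : (p : 𝓞 K) ≠ 0 := by exact_mod_cast hp.ne_zero
  -- If p² divided d, δ/p would be an integral square root of a smaller -f, against the minimality
  -- of d.
  have hpe : Nat.Coprime p e := by
    rw [hp.coprime_iff_not_dvd]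
    rintro ⟨f, rfl⟩
    subst he
    have hpK : (p : K) ≠ 0 := by exact_mod_cast hp.ne_zero
    have hf : 0 < f := by
      rcases Nat.eq_zero_or_pos f with rfl | h
      · simp at hd
      · exact h
    apply hmin f
    · nlinarith [hp.two_le, mul_pos hp.pos hf]
    · refine ⟨hf, ?_⟩
      have hsq : ((δ : K) / p) ^ 2 = -(f : K) := by
        have := congrArg (algebraMap (𝓞 K) K) hδ
        push_cast at this
        rw [div_pow, this]
        field_simp
      have hi : IsIntegral ℤ ((δ : K) / p) := by
        apply IsIntegral.of_pow two_pos
        rw [hsq]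
        exact IsIntegral.neg (by exact_mod_cast isIntegral_algebraMap (A := K) (x := (f : ℤ)))
      refine ⟨⟨_, hi⟩, RingOfIntegers.ext (Eq.trans ?_ (hsq.trans ?_))⟩
      · exact map_pow _ _ _
      · simp
  have hP : (Ideal.span {(p : 𝓞 K), δ}) ^ 2 = Ideal.span {(p : 𝓞 K)} := by
    rw [sq, Ideal.span_pair_mul_span_pair]
    apply le_antisymm
    · rw [Ideal.span_le]
      rintro _ (rfl | rfl | rfl | rfl)
      · exact mem_span_of_mul rfl
      · exact mem_span_of_mul rfl
      · exact mem_span_of_mul (mul_comm _ _)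
      · refine mem_span_of_mul (y := -(e : 𝓞 K)) ?_
        rw [← sq, hδ, he]
        push_cast
        ring
    · rw [Ideal.span_singleton_le_iff_mem]
      obtain ⟨u, v, huv⟩ := Nat.isCoprime_iff_coprime.mpr hpe
      have huv' : (u : 𝓞 K) * p + v * e = 1 := by exact_mod_cast congrArg (Int.cast : ℤ → 𝓞 K) huv
      have : (p : 𝓞 K) = u * (p * p) + (-v) * (δ * δ) := by
        rw [← sq δ, hδ, he]
        push_cast
        linear_combination (-(p : 𝓞 K)) * huv'
      have hmem := add_mem (Ideal.mul_mem_left (Ideal.span {(p : 𝓞 K) * p, p * δ, δ * p, δ * δ}) (u : 𝓞 K)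
        (Ideal.subset_span (by simp : (p : 𝓞 K) * p ∈ _)))
        (Ideal.mul_mem_left _ (-v : 𝓞 K) (Ideal.subset_span (by simp : δ * δ ∈ _)))
      rwa [← this] at hmem
  obtain ⟨π, hπ⟩ := exists_sq_eq_neg_prime hunits hl hexp hp hP
  refine ⟨p, π, hp, hπ, ?_⟩
  intro hp4
  obtain ⟨m, rfl⟩ : ∃ m, p = 4 * m + 1 := ⟨p / 4, by omega⟩
  push_cast at hπ
  -- For p ≡ 1 mod 4 the prime 2 ramifies as well. Then -2 is also a square, which would make 2p a
  -- rational square.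
  have hQ : (Ideal.span {(2 : 𝓞 K), 1 + π}) ^ 2 = Ideal.span {((2 : ℕ) : 𝓞 K)} := by
    rw [sq, Ideal.span_pair_mul_span_pair, Nat.cast_two]
    apply le_antisymm
    · rw [Ideal.span_le]
      rintro _ (rfl | rfl | rfl | rfl)
      · exact mem_span_of_mul rfl
      · exact mem_span_of_mul rfl
      · exact mem_span_of_mul (mul_comm _ _)
      · exact mem_span_of_mul (y := π - 2 * m) (by linear_combination hπ)
    · rw [Ideal.span_singleton_le_iff_mem]
      have : (2 : 𝓞 K) = 2 * (1 + π) + ((-m) * (2 * 2) + (-1) * ((1 + π) * (1 + π))) := by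
        linear_combination hπ
      have hmem := add_mem (s := Ideal.span {2 * 2, 2 * (1 + π), (1 + π) * 2, (1 + π) * (1 + π)})
        (Ideal.subset_span (by simp : 2 * (1 + π) ∈ _)) (add_mem
        (Ideal.mul_mem_left _ (-m : 𝓞 K) (Ideal.subset_span (by simp : (2 * 2 : 𝓞 K) ∈ _)))
        (Ideal.mul_mem_left _ (-1) (Ideal.subset_span (by simp : (1 + π) * (1 + π) ∈ _))))
      rwa [← this] at hmem
  obtain ⟨τ, hτ⟩ := exists_sq_eq_neg_prime hunits hl hexp Nat.prime_two hQ
  obtain ⟨s, hs⟩ := rat_mul_sq (x := (τ : K)) (y := (π : K)) (q := 2) (r := (4 * m + 1 : ℕ)) two_pos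
    (by exact_mod_cast hp.pos) (by
      have h := congrArg (algebraMap (𝓞 K) K) hτ
      simp only [map_pow, map_neg, map_natCast] at h
      push_cast at h ⊢
      exact h)
    (by
      have h := congrArg (algebraMap (𝓞 K) K) hπ
      simp only [map_pow, map_neg, map_add, map_mul, map_natCast, map_ofNat, map_one] at h
      push_cast at h ⊢
      exact h)
  have hsq : IsSquare (2 * (4 * m + 1)) := by
    rw [← Rat.isSquare_natCast_iff]
    exact ⟨s, by rw [← sq, hs]; push_cast; ring⟩
  obtain ⟨t, ht⟩ := hsq
  have h2t : 2 ∣ t := by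
    have : 2 ∣ t * t := ⟨_, ht.symm⟩
    rcases Nat.prime_two.dvd_mul.mp this with h | h <;> exact h
  obtain ⟨r, rfl⟩ := h2t
  have : 2 * (4 * m + 1) = 4 * (r * r) := by rw [ht]; ring
  omega

theorem dvd_of_mem_span {π : 𝓞 K} {p : ℕ} (hp : p.Prime) (hN : Ideal.absNorm (Ideal.span {π}) = p)
    {n : ℤ} (h : (n : 𝓞 K) ∈ Ideal.span {π}) : (p : ℤ) ∣ n := by
  have h1 := Ideal.absNorm_dvd_absNorm_of_le ((Ideal.span_singleton_le_iff_mem _).mpr h)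
  rw [hN, Ideal.absNorm_span_singleton] at h1
  have h2 : Algebra.norm ℤ (n : 𝓞 K) = n ^ 2 := by
    have := Algebra.norm_algebraMap_of_basis (RingOfIntegers.basis K) n
    rw [← Module.finrank_eq_card_basis (RingOfIntegers.basis K), RingOfIntegers.rank,
      finrank_eq_two] at this
    simpa using this
  rw [h2, Int.natAbs_pow] at h1
  exact Int.natCast_dvd.mpr (hp.dvd_of_dvd_pow h1)

/-- The norm condition modulo the square root of `-p` for a prime `p` which is `3` modulo `4`. -/
theorem mul_conjO_add_sq_notMem_of_mod_four_eq_three {p : ℕ} {π : 𝓞 K} (hp : p.Prime)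
    (hπ : π ^ 2 = -(p : 𝓞 K)) (hp4 : p % 4 = 3) (v w : 𝓞 K)
    (hv : IsCoprime (Ideal.span {v}) (Ideal.span {π})) : v * conjO K v + w ^ 2 ∉ Ideal.span {π} := by
  intro h
  have hN : Ideal.absNorm (Ideal.span {π}) = p := by
    have := absNorm_span_add_mul hp.pos hπ 0 1
    rw [Int.cast_one, one_mul, Int.cast_zero, zero_add] at this
    zify; rw [this]; norm_num
  have hπu : ¬ IsUnit π := by
    intro h
    rw [Ideal.span_singleton_eq_top.mpr h, Ideal.absNorm_top] at hN
    exact hp.one_lt.ne hN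
  obtain ⟨a, y, rfl⟩ := exists_int_add_mul hp hN v
  obtain ⟨b, z, rfl⟩ := exists_int_add_mul hp hN w
  -- Modulo π every element is congruent to an integer and conjugation is trivial, so the sum
  -- becomes a² + b²; then -1 would be a square modulo p.
  have h1 : ((a ^ 2 + b ^ 2 : ℤ) : 𝓞 K) ∈ Ideal.span {π} := by
    have h2 : ((a : 𝓞 K) + π * y) * conjO K (a + π * y) + (b + π * z) ^ 2 -
        π * (a * y - a * conjO K y - π * y * conjO K y + 2 * b * z + π * z ^ 2) =
        ((a ^ 2 + b ^ 2 : ℤ) : 𝓞 K) := by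
      rw [map_add, map_mul, map_intCast, conjO_eq_neg hp.pos hπ]
      push_cast
      ring
    rw [← h2]
    exact sub_mem h (mem_span_of_mul rfl)
  have h2 := dvd_of_mem_span hp hN h1
  have : Fact p.Prime := ⟨hp⟩
  rw [← ZMod.intCast_zmod_eq_zero_iff_dvd] at h2
  push_cast at h2
  by_cases ha : (a : ZMod p) = 0
  · rw [ZMod.intCast_zmod_eq_zero_iff_dvd] at ha
    obtain ⟨k, rfl⟩ := ha
    refine not_isCoprime_of_mem hπu le_rfl (mem_span_of_mul (y := -π * k + y) ?_) hv
    push_cast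
    linear_combination (k : 𝓞 K) * hπ
  · exact ZMod.mod_four_ne_three_of_sq_eq_neg_sq' ha
      (x := (b : ZMod p)) (by linear_combination h2) hp4

/-- The norm condition modulo `16` for the square root of `-2`. -/
theorem mul_conjO_add_sq_notMem_of_sq_eq_neg_two {π : 𝓞 K} (hπ : π ^ 2 = -((2 : ℕ) : 𝓞 K))
    (v w : 𝓞 K) (hv : IsCoprime (Ideal.span {v}) (Ideal.span {(16 : 𝓞 K)})) :
    v * conjO K v + w ^ 2 ∉ Ideal.span {(16 : 𝓞 K)} := by
  intro h
  have hN : Ideal.absNorm (Ideal.span {π}) = 2 := by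
    have := absNorm_span_add_mul two_pos hπ 0 1
    rw [Int.cast_one, one_mul, Int.cast_zero, zero_add] at this
    zify; rw [this]; norm_num
  have hπu : ¬ IsUnit π := by
    intro h
    rw [Ideal.span_singleton_eq_top.mpr h, Ideal.absNorm_top] at hN
    omega
  have hconj := conjO_eq_neg two_pos hπ
  push_cast at hπ
  have hrep : ∀ x : 𝓞 K, ∃ (a b : ℤ) (y : 𝓞 K), x = a + b * π + (2 : ℤ) ^ 4 * y := by
    apply exists_int_add_int_mul_pow
    intro x
    obtain ⟨n, y, rfl⟩ := exists_int_add_mul Nat.prime_two hN x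
    obtain ⟨m, z, rfl⟩ := exists_int_add_mul Nat.prime_two hN y
    refine ⟨n, m, -z, ?_⟩
    push_cast
    linear_combination z * hπ
  obtain ⟨a, b, y, rfl⟩ := hrep v
  obtain ⟨c, e, z, rfl⟩ := hrep w
  have ha : ¬ 2 ∣ a := by
    rintro ⟨k, rfl⟩
    have hle : Ideal.span {(16 : 𝓞 K)} ≤ Ideal.span {π} := by
      rw [Ideal.span_singleton_le_iff_mem]
      exact mem_span_of_mul (y := -8 * π) (by linear_combination 8 * hπ)
    refine not_isCoprime_of_mem hπu hle (mem_span_of_mul (y := -π * k + b - 8 * π * y) ?_) hv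
    push_cast
    linear_combination ((k : 𝓞 K) + 8 * y) * hπ
  obtain ⟨f, hf⟩ : ∃ f : 𝓞 K, ((a ^ 2 + 2 * b ^ 2 + c ^ 2 - 2 * e ^ 2 : ℤ) : 𝓞 K) +
      ((2 * c * e : ℤ) : 𝓞 K) * π = 16 * f := by
    obtain ⟨f, hf⟩ := Ideal.mem_span_singleton.mp h
    simp only [map_add, map_mul, map_pow, map_intCast, hconj] at hf
    push_cast at hf ⊢
    refine ⟨f - (a + b * π) * conjO K y - y * (a - b * π) - 16 * y * conjO K y -
      2 * (c + e * π) * z - 16 * z ^ 2, ?_⟩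
    linear_combination hf + (b ^ 2 - e ^ 2 : 𝓞 K) * hπ
  have hf' := congrArg (conjO K) hf
  simp only [map_add, map_mul, map_intCast, hconj, map_ofNat] at hf'
  obtain ⟨t, ht⟩ := exists_trace f
  obtain ⟨t', ht'⟩ := exists_trace (π * f)
  rw [map_mul, hconj] at ht'
  -- Taking the trace of the relation, and of π times it, avoids knowing an integral basis, at the
  -- cost of a factor 2: the rational part is divisible only by 8. With a, c odd and e even this
  -- part is 2 + 2b² modulo 8, that is 2 or 4.
  have e1 : a ^ 2 + 2 * b ^ 2 + c ^ 2 - 2 * e ^ 2 = 8 * t := by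
    have : ((2 * (a ^ 2 + 2 * b ^ 2 + c ^ 2 - 2 * e ^ 2) : ℤ) : 𝓞 K) = ((2 * (8 * t) : ℤ) : 𝓞 K) := by
      push_cast at hf hf' ⊢
      rw [ht]
      linear_combination hf + hf'
    have : 2 * (a ^ 2 + 2 * b ^ 2 + c ^ 2 - 2 * e ^ 2) = 2 * (8 * t) := by exact_mod_cast this
    omega
  have e2 : c * e = -2 * t' := by
    have : ((-8 * (c * e) : ℤ) : 𝓞 K) = ((-8 * (-2 * t') : ℤ) : 𝓞 K) := by
      push_cast at hf hf' ⊢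
      rw [ht']
      linear_combination π * hf - π * hf' - (4 * c * e : 𝓞 K) * hπ
    have : -8 * (c * e) = -8 * (-2 * t') := by exact_mod_cast this
    omega
  obtain ⟨a', rfl⟩ : ∃ a', a = 2 * a' + 1 := ⟨a / 2, by omega⟩
  have hc : ¬ 2 ∣ c := by
    rintro ⟨c', rfl⟩
    have : (2 * a' + 1) ^ 2 + 2 * b ^ 2 + (2 * c') ^ 2 - 2 * e ^ 2 =
      2 * (2 * a' ^ 2 + 2 * a' + b ^ 2 + 2 * c' ^ 2 - e ^ 2) + 1 := by ring
    omega
  have he : 2 ∣ e := by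
    have : (2 : ℤ) ∣ c * e := ⟨-t', by rw [e2]; ring⟩
    exact (Int.prime_two.dvd_mul.mp this).resolve_left hc
  obtain ⟨c', rfl⟩ : ∃ c', c = 2 * c' + 1 := ⟨c / 2, by omega⟩
  obtain ⟨e', rfl⟩ := he
  obtain ⟨r, hr⟩ := (Int.even_mul_succ_self a').two_dvd
  obtain ⟨s, hs⟩ := (Int.even_mul_succ_self c').two_dvd
  rcases Int.even_or_odd' b with ⟨b', rfl | rfl⟩
  · have : (2 * a' + 1) ^ 2 + 2 * (2 * b') ^ 2 + (2 * c' + 1) ^ 2 - 2 * (2 * e') ^ 2 =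
        4 * (a' * (a' + 1)) + 4 * (c' * (c' + 1)) + 8 * (b' ^ 2 - e' ^ 2) + 2 := by ring
    omega
  · obtain ⟨q, hq⟩ := (Int.even_mul_succ_self b').two_dvd
    have : (2 * a' + 1) ^ 2 + 2 * (2 * b' + 1) ^ 2 + (2 * c' + 1) ^ 2 - 2 * (2 * e') ^ 2 =
        4 * (a' * (a' + 1)) + 4 * (c' * (c' + 1)) + 8 * (b' * (b' + 1) - e' ^ 2) + 4 := by ring
    omega

/-- If the class exponent divides `l`, then there is a character with `∞`-type `l` and rational
coefficients. -/
theorem exists_character (hl : l ≠ 0) (hexp : Monoid.exponent (ClassGroup (𝓞 K)) ∣ l) :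
    ∃ ψ : HeckeCharacter K l, ψ.HasRationalCoefficients := by
  by_cases h1 : ∃ x : K, x ^ 2 = -1
  · exact exists_character_of_sq_eq_neg_one h1 hl hexp
  by_cases h3 : ∃ x : K, x ^ 2 = -3
  · exact exists_character_of_sq_eq_neg_three h3 hl hexp
  have hunits := unit_sq_eq_one h1 h3
  rcases Nat.even_or_odd l with hev | hodd
  -- For even l no congruence is needed, so the trivial modulus serves.
  · exact exists_character_of_neg_one top_ne_bot conjI_top hl hexp hunits
      (fun α _ γ => sq_mul_pow_ne_neg_one_of_even h1 hev α γ)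
  · obtain ⟨p, π, hp, hπ, hp4⟩ := exists_prime_sq_eq_neg h1 hunits hodd hexp
    rcases hp.eq_two_or_odd with rfl | hp2
    · refine exists_character_of_neg_one (M := Ideal.span {(16 : 𝓞 K)}) ?_ ?_ hl hexp hunits
        (fun α hα γ => sq_mul_pow_ne_neg_one_of_norm hl hexp
          (mul_conjO_add_sq_notMem_of_sq_eq_neg_two hπ) hα γ)
      · rw [Ne, Ideal.span_singleton_eq_bot]
        exact OfNat.ofNat_ne_zero 16
      · rw [conjI_span, map_ofNat]
    · refine exists_character_of_neg_one (M := Ideal.span {π}) ?_ ?_ hl hexp hunits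
        (fun α hα γ => sq_mul_pow_ne_neg_one_of_norm hl hexp
          (mul_conjO_add_sq_notMem_of_mod_four_eq_three hp hπ (by omega)) hα γ)
      · rw [Ne, Ideal.span_singleton_eq_bot]
        rintro rfl
        apply hp.ne_zero
        rw [zero_pow two_ne_zero, eq_comm, neg_eq_zero] at hπ
        exact_mod_cast hπ
      · rw [conjI_span, conjO_eq_neg hp.pos hπ, Ideal.span_singleton_neg]

end IsImagQuad

/-! ### The bijection -/

/-- The map which sends a Hecke character to its CM field is well defined on twist classes, takes
values in the fields with `e_K ∣ l`, and is bijective. -/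
theorem theorem2p4 (l : ℕ) (hl : 1 ≤ l) :
    ∃ j : Quotient (twistSetoid l) → {K : ImagQuadField // K.classExponent ∣ l},
      (∀ ψ : RationalHeckeCharacter l, (j (Quotient.mk (twistSetoid l) ψ)).1 = ψ.field) ∧
      Function.Bijective j := by
  have hl0 : l ≠ 0 := by omega
  refine ⟨Quotient.lift (fun ψ : RationalHeckeCharacter l =>
    (⟨ψ.field, IsImagQuad.exponent_dvd ψ.char ψ.rational hl0⟩ :
      {K : ImagQuadField // K.classExponent ∣ l})) ?_, fun ψ => rfl, ?_, ?_⟩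
  · rintro ψ ψ' ⟨h, -⟩
    exact Subtype.ext h
  · rintro ⟨K, ψ, hψ⟩ ⟨K', ψ', hψ'⟩ h
    obtain rfl : K = K' := congrArg Subtype.val h
    exact Quotient.sound ⟨rfl, IsImagQuad.isTwist ψ ψ' hψ hψ' hl0⟩
  · rintro ⟨K, hK⟩
    obtain ⟨ψ, hψ⟩ := IsImagQuad.exists_character (K := K) hl0 hK
    exact ⟨Quotient.mk _ ⟨K, ψ, hψ⟩, rfl⟩
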